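/- Let $0<q<1$ and let $\mathcal A=C(SU_q(2))$ be the universal unital $C^*$-algebra generated by $\alpha,\beta$ subject to $\alpha^*\alpha+\beta^*\beta=1=\alpha\alpha^*+q^2\beta\beta^*$, $\alpha\beta=q\beta\alpha$, $\alpha\beta^*=q\beta^*\alpha$, $\beta^*\beta=\beta\beta^*$. Let $\mathcal A_f$ be the $*$-subalgebra generated by $\alpha$ and $\beta$, let $h$ be the Haar state of $SU_q(2)$, and let $\pi$ be the representation of $\mathcal A$ by left multiplication on the GNS space $L_2(h)$. For $n\in\{0,\frac12,1,\dots\}$ and $i,j\in\{-n,-n+1,\dots,n\}$ let $e^{(n)}_{ij}\in L_2(h)$ be the normalized matrix element $t^{(n)}_{ij}$ of the spin $n$ irreducible unitary representation, realized on the $q$-symmetric tensors in the $2n$-th tensor power of the fundamental representation $\begin{pmatrix}\alpha& q\beta^*\\-\beta&\alpha^*\end{pmatrix}$ (rows and columns labelled by $-\frac12,\frac12$). Let $D_1,D_2$ be the self-adjoint operators on $L_2(h)$ that are diagonal in the orthonormal basis $(e^{(n)}_{ij})$, with $D_1e^{(n)}_{ij}=-2n\,e^{(n)}_{ij}$ and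 $D_2e^{(n)}_{ij}=(-2n-1)e^{(n)}_{ij}$ for $j\ne n$, and $D_1e^{(n)}_{in}=D_2e^{(n)}_{in}=(2n+1)e^{(n)}_{in}$. Let $\mathscr H$ be the Hilbert space with orthonormal basis $u^n_{ij}$ ($n\in\{0,\frac12,1,\dots\}$, $i=-n,\dots,n$, $j=-n-\frac12,\dots,n+\frac12$) and $d^n_{ij}$ ($n\in\{\frac12,1,\dots\}$, $i=-n,\dots,n$, $j=-n+\frac12,\dots,n-\frac12$), steps being $1$; set $u^n_{ij}=0$, $d^n_{ij}=0$ for indices out of range. Let $D$ be the self-adjoint operator with $Du^n_{ij}=(2n+1)u^n_{ij}$, $Dd^n_{ij}=-2n\,d^n_{ij}$. Write $v^n_{ij}=(u^n_{ij},d^n_{ij})$, $[m]=\frac{q^m-q^{-m}}{q-q^{-1}}$, and for a $2\times2$ matrix $M$ let $T v^n_{ij}=M v^{n'}_{i'j'}+\cdots$ mean $Tu^n_{ij}=M_{11}u^{n'}_{i'j'}+M_{21}d^{n'}_{i'j'}+\cdots$ and $Td^n_{ij}=M_{12}u^{n'}_{i'j'}+M_{22}d^{n'}_{i'j'}+\cdots$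 (whenever $u^n_{ij}$, respectively $d^n_{ij}$, is one of the basis vectors). Put $$a^+_{nij}=q^{(i+j-\frac12)/2}[n+i+1]^{\frac12}\begin{pmatrix}q^{-n-\frac12}\frac{[n+j+\frac32]^{1/2}}{[2n+2]}&0\\ q^{\frac12}\frac{[n-j+\frac12]^{1/2}}{[2n+1][2n+2]}&q^{-n}\frac{[n+j+\frac12]^{1/2}}{[2n+1]}\end{pmatrix},$$ $$a^-_{nij}=q^{(i+j-\frac12)/2}[n-i]^{\frac12}\begin{pmatrix}q^{n+1}\frac{[n-j+\frac12]^{1/2}}{[2n+1]}&-q^{\frac12}\frac{[n+j+\frac12]^{1/2}}{[2n][2n+1]}\\0&q^{n+\frac12}\frac{[n-j-\frac12]^{1/2}}{[2n]}\end{pmatrix},$$ $$b^+_{nij}=q^{(i+j-\frac12)/2}[n+i+1]^{\frac12}\begin{pmatrix}\frac{[n-j+\frac32]^{1/2}}{[2n+2]}&0\\-q^{-n-1}\frac{[n+j+\frac12]^{1/2}}{[2n+1][2n+2]}&q^{-\frac12}\frac{[n-j+\frac12]^{1/2}}{[2n+1]}\end{pmatrix},$$ $$b^-_{nij}=q^{(i+j-\frac12)/2}[n-i]^{\frac12}\begin{pmatrix}-q^{-\frac12}\frac{[n+j+\frac12]^{1/2}}{[2n+1]}&-q^n\frac{[n-j+\frac12]^{1/2}}{[2n][2n+1]}\\0&-\frac{[n+j-\frac12]^{1/2}}{[2n]}\end{pmatrix},$$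 $\tilde a^\pm_{nij}=(a^\mp_{n\pm\frac12,i-\frac12,j-\frac12})^*$ and $\tilde b^\pm_{nij}=(b^\mp_{n\pm\frac12,i-\frac12,j+\frac12})^*$. Let $\mathcal K_q$ be the two-sided (algebraic) ideal of $\mathcal L(\mathscr H)$ generated by the operator $u^n_{ij}\mapsto q^nu^n_{ij}$, $d^n_{ij}\mapsto q^nd^n_{ij}$. Then there is a unitary $U\colon L_2(h)\oplus L_2(h)\to\mathscr H$ with $$U(e^{(n)}_{ij}\oplus0)=d^n_{i,j+\frac12}\ (j<n),\qquad U(e^{(n)}_{in}\oplus0)=u^n_{i,n+\frac12},\qquad U(0\oplus e^{(n)}_{ij})=u^n_{i,j-\frac12},$$ and it satisfies $$U(D_1\oplus|D_2|)U^*=D$$ (including equality of domains). Moreover there is a unital $*$-representation $\pi'$ of $\mathcal A$ on $\mathscr H$ (the representation of Dabrowski et al., determined by the following formulas) with $$\pi'(\alpha^*)v^n_{ij}=a^+_{nij}v^{n+\frac12}_{i+\frac12,j+\frac12}+a^-_{nij}v^{n-\frac12}_{i+\frac12,j+\frac12},\qquad \pi'(-\beta)v^n_{ij}=b^+_{nij}v^{n+\frac12}_{i+\frac12,j-\frac12}+b^-_{nij}v^{n-\frac12}_{i+\frac12,j-\frac12},$$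 $$\pi'(\alpha)v^n_{ij}=\tilde a^+_{nij}v^{n+\frac12}_{i-\frac12,j-\frac12}+\tilde a^-_{nij}v^{n-\frac12}_{i-\frac12,j-\frac12},\qquad \pi'(-\beta^*)v^n_{ij}=\tilde b^+_{nij}v^{n+\frac12}_{i-\frac12,j+\frac12}+\tilde b^-_{nij}v^{n-\frac12}_{i-\frac12,j+\frac12},$$ and $$U(\pi(a)\oplus\pi(a))U^*-\pi'(a)\in\mathcal K_q\qquad\text{for all }a\in\mathcal A_f.$$ -/

import Mathlib

open scoped ENNReal ComplexOrder InnerProductSpace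

noncomputable section

namespace SUq2

/-! ### The C*-algebra of continuous functions on `SU_q(2)` -/

/-- The defining relations of the quantum group `SU_q(2)` for elements `a`, `b` (the images of
`α`, `β`) of a unital C*-algebra. -/
structure Rel (q : ℝ) {B : Type*} [CStarAlgebra B] (a b : B) : Prop where
  star_mul_add : star a * a + star b * b = 1
  mul_star_add : a * star a + (q : ℂ) ^ 2 • (b * star b) = 1
  comm : a * b - (q : ℂ) • (b * a) = 0
  comm_star : a * star b - (q : ℂ) • (star b * a) = 0
  normal : star b * b = b * star b

/-- A pair of elements of a nonzero unital C*-algebra satisfying the relations. C*-algebras in the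
lowest universe suffice: a C*-algebra generated by two elements has at most continuum many
elements. -/
structure Realization (q : ℝ) : Type 1 where
  alg : Type
  [cstar : CStarAlgebra alg]
  [nontriv : Nontrivial alg]
  a : alg
  b : alg
  rel : Rel q a b

attribute [instance] Realization.cstar Realization.nontriv

theorem norm_le_one_of_star_mul_add {B : Type*} [CStarAlgebra B] [Nontrivial B] {x y : B}
    (h : star x * x + star y * y = 1) : ‖x‖ ≤ 1 := by
  let _ := CStarAlgebra.spectralOrder B
  let _ := CStarAlgebra.spectralOrderedRing B
  have h1 : star x * x ≤ 1 := by
    rw [← h]; exact le_add_of_nonneg_right (star_mul_self_nonneg y)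
  have h2 : ‖star x * x‖ ≤ ‖(1 : B)‖ :=
    CStarAlgebra.norm_le_norm_of_nonneg_of_le (star_mul_self_nonneg x) h1
  rw [CStarRing.norm_star_mul_self, norm_one] at h2
  nlinarith [norm_nonneg x]

/-- Bounded families indexed by all realizations, a C*-algebra under the supremum norm. -/
abbrev Family (q : ℝ) : Type 1 := lp (fun r : Realization q => r.alg) ∞

instance (q : ℝ) : CStarAlgebra (Family q) where

/-- The family of all first components. -/
def familyA (q : ℝ) : Family q :=
  ⟨fun r => r.a, memℓp_infty ⟨1, by
    rintro _ ⟨r, rfl⟩; exact norm_le_one_of_star_mul_add r.rel.star_mul_add⟩⟩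

/-- The family of all second components. -/
def familyB (q : ℝ) : Family q :=
  ⟨fun r => r.b, memℓp_infty ⟨1, by
    rintro _ ⟨r, rfl⟩
    exact norm_le_one_of_star_mul_add ((add_comm _ _).trans r.rel.star_mul_add)⟩⟩

/-- The closed unital *-subalgebra generated by the two universal families; the norm of a
*-polynomial in them is its supremum over all realizations. -/
def closedSubalgebra (q : ℝ) : StarSubalgebra ℂ (Family q) :=
  (StarAlgebra.adjoin ℂ {familyA q, familyB q}).topologicalClosure

/-- The universal C*-algebra on two generators `α`, `β` subject to the relations `Rel`
(its universal property is `existsUnique_hom` below). -/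
abbrev Alg (q : ℝ) : Type 1 := closedSubalgebra q

instance (q : ℝ) : CStarAlgebra (Alg q) :=
  StarSubalgebra.cstarAlgebra (closedSubalgebra q)
    (h_closed := StarSubalgebra.isClosed_topologicalClosure _)

instance (q : ℝ) : PartialOrder (Alg q) := CStarAlgebra.spectralOrder _
instance (q : ℝ) : StarOrderedRing (Alg q) := CStarAlgebra.spectralOrderedRing _

/-- The generator `α`. -/
def α (q : ℝ) : Alg q := ⟨familyA q, StarSubalgebra.le_topologicalClosure _
  (StarAlgebra.subset_adjoin _ _ (by simp))⟩
/-- The generator `β`. -/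
def β (q : ℝ) : Alg q := ⟨familyB q, StarSubalgebra.le_topologicalClosure _
  (StarAlgebra.subset_adjoin _ _ (by simp))⟩

/-- Evaluation of the universal algebra at a realization. -/
def evalHom {q : ℝ} (r : Realization q) : Alg q →⋆ₐ[ℂ] r.alg where
  toFun x := x.1 r
  map_one' := rfl
  map_mul' _ _ := rfl
  map_zero' := rfl
  map_add' _ _ := rfl
  commutes' _ := rfl
  map_star' _ := rfl

theorem rel_generators (q : ℝ) : Rel q (α q) (β q) where
  star_mul_add := Subtype.ext <| lp.ext <| funext fun r => r.rel.star_mul_add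
  mul_star_add := Subtype.ext <| lp.ext <| funext fun r => r.rel.mul_star_add
  comm := Subtype.ext <| lp.ext <| funext fun r => r.rel.comm
  comm_star := Subtype.ext <| lp.ext <| funext fun r => r.rel.comm_star
  normal := Subtype.ext <| lp.ext <| funext fun r => r.rel.normal

/-- The universal property: every pair satisfying the relations is the image of `(α, β)` under
a unique unital *-homomorphism. -/
theorem existsUnique_hom (q : ℝ) {B : Type} [CStarAlgebra B] {a b : B} (h : Rel q a b) :
    ∃! φ : Alg q →⋆ₐ[ℂ] B, φ (α q) = a ∧ φ (β q) = b := by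
  have hex : ∃ φ : Alg q →⋆ₐ[ℂ] B, φ (α q) = a ∧ φ (β q) = b := by
    rcases subsingleton_or_nontrivial B with hB | hB
    · exact ⟨{ toFun := fun _ => 0
               map_one' := Subsingleton.elim _ _
               map_mul' := fun _ _ => Subsingleton.elim _ _
               map_zero' := rfl
               map_add' := fun _ _ => Subsingleton.elim _ _
               commutes' := fun _ => Subsingleton.elim _ _
               map_star' := fun _ => Subsingleton.elim _ _ },
        Subsingleton.elim _ _, Subsingleton.elim _ _⟩
    · exact ⟨evalHom ⟨B, a, b, h⟩, rfl, rfl⟩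
  obtain ⟨φ, h1, h2⟩ := hex
  refine ⟨φ, ⟨h1, h2⟩, ?_⟩
  rintro ψ ⟨h3, h4⟩
  let S := StarAlgebra.adjoin ℂ {familyA q, familyB q}
  have hc : ∀ θ : Alg q →⋆ₐ[ℂ] B, Continuous θ := fun θ =>
    AddMonoidHomClass.continuous_of_bound θ 1 fun x => by
      simpa using NonUnitalStarAlgHom.norm_apply_le θ x
  refine StarAlgHom.ext_topologicalClosure (S := S) (hc ψ) (hc φ) ?_
  refine StarAlgHom.ext_adjoin ?_
  rintro ⟨x, hx⟩ hx'
  rcases hx' with hx' | hx'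
  · obtain rfl : x = familyA q := hx'
    exact h3.trans h1.symm
  · obtain rfl : x = familyB q := hx'
    exact h4.trans h2.symm


/-- The *-subalgebra generated by `α` and `β`. -/
def polyAlg (q : ℝ) : StarSubalgebra ℂ (Alg q) := StarAlgebra.adjoin ℂ {α q, β q}

/-! ### The Haar state, given by
`h(a) = (1 - q²) ∑ₙ q^{2n} ⟨e_{n,0}, π₀(a) e_{n,0}⟩` for the representation `π₀` on `ℓ²(ℕ × ℤ)` with
`π₀(α) e_{n,k} = √(1 - q^{2n}) e_{n-1,k}` and `π₀(β) e_{n,k} = q^n e_{n,k+1}` -/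

/-- The weighted pull-back `x ↦ (k ↦ c k * x (σ k))`. -/
def pullFun {ι κ : Type} (σ : κ → ι) (c : κ → ℝ) (x : ι → ℂ) (k : κ) : ℂ := (c k : ℂ) * x (σ k)

theorem pullFun_bound {ι κ : Type} {σ : κ → ι} (hσ : Function.Injective σ) {c : κ → ℝ}
    (hc : ∀ k, |c k| ≤ 1) (x : lp (fun _ : ι => ℂ) 2) :
    Summable (fun k => ‖pullFun σ c x k‖ ^ (2 : ℝ)) ∧
      ∑' k, ‖pullFun σ c x k‖ ^ (2 : ℝ) ≤ ‖x‖ ^ (2 : ℝ) := by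
  have h1 : HasSum (fun i => ‖x i‖ ^ (2 : ℝ)) (‖x‖ ^ (2 : ℝ)) := by
    simpa using lp.hasSum_norm (p := 2) (by norm_num) x
  have h2 : Summable (fun k => ‖x (σ k)‖ ^ (2 : ℝ)) := h1.summable.comp_injective hσ
  have h3 : ∀ k, ‖pullFun σ c x k‖ ^ (2 : ℝ) ≤ ‖x (σ k)‖ ^ (2 : ℝ) := fun k => by
    rw [pullFun, norm_mul, Complex.norm_real, Real.norm_eq_abs]
    exact Real.rpow_le_rpow (by positivity)
      (mul_le_of_le_one_left (norm_nonneg _) (hc k)) (by norm_num)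
  have h4 := Summable.of_nonneg_of_le (fun k => by positivity) h3 h2
  refine ⟨h4, (h4.tsum_le_tsum h3 h2).trans ?_⟩
  rw [← h1.tsum_eq]
  exact h2.tsum_le_tsum_of_inj σ hσ (fun i _ => by positivity) (fun _ => le_rfl) h1.summable

/-- The weighted pull-back along an injection, with weights bounded by one, as a bounded operator
between `ℓ²`-spaces. -/
def wpull {ι κ : Type} (σ : κ → ι) (hσ : Function.Injective σ) (c : κ → ℝ)
    (hc : ∀ k, |c k| ≤ 1) :
    lp (fun _ : ι => ℂ) 2 →L[ℂ] lp (fun _ : κ => ℂ) 2 :=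
  LinearMap.mkContinuous
    { toFun := fun x => ⟨pullFun σ c x, memℓp_gen (by simpa using (pullFun_bound hσ hc x).1)⟩
      map_add' := fun x y => lp.ext <| funext fun k => mul_add _ _ _
      map_smul' := fun z x => lp.ext <| funext fun k => mul_left_comm _ _ _ } 1 fun x => by
    rw [one_mul]
    refine lp.norm_le_of_tsum_le (by norm_num) (norm_nonneg _) ?_
    simpa using (pullFun_bound hσ hc x).2

theorem wpull_apply {ι κ : Type} (σ : κ → ι) (hσ : Function.Injective σ) (c : κ → ℝ)
    (hc : ∀ k, |c k| ≤ 1) (x : lp (fun _ : ι => ℂ) 2) (k : κ) :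
    wpull σ hσ c hc x k = c k * x (σ k) := rfl

theorem adjoint_wpull_apply {ι κ : Type} (σ : κ → ι) (hσ : Function.Injective σ) (c : κ → ℝ)
    (hc : ∀ k, |c k| ≤ 1) (y : lp (fun _ : κ => ℂ) 2) (k : κ) :
    ContinuousLinearMap.adjoint (wpull σ hσ c hc) y (σ k) = c k * y k := by
  classical
  have h : wpull σ hσ c hc (lp.single 2 (σ k) 1) = (c k : ℂ) • lp.single 2 k (1 : ℂ) := by
    refine lp.ext <| funext fun m => ?_
    rw [wpull_apply, lp.coeFn_smul, Pi.smul_apply, smul_eq_mul]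
    by_cases hm : m = k
    · subst hm; simp
    · simp [hm, hσ.eq_iff]
  have h2 := lp.inner_single_left (𝕜 := ℂ) (σ k) (1 : ℂ)
    (ContinuousLinearMap.adjoint (wpull σ hσ c hc) y)
  rw [ContinuousLinearMap.adjoint_inner_right, h, inner_smul_left, lp.inner_single_left] at h2
  simpa using h2.symm

theorem adjoint_wpull_apply_of_notMem {ι κ : Type} (σ : κ → ι) (hσ : Function.Injective σ)
    (c : κ → ℝ) (hc : ∀ k, |c k| ≤ 1) (y : lp (fun _ : κ => ℂ) 2) (i : ι)
    (hi : ∀ k, σ k ≠ i) :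
    ContinuousLinearMap.adjoint (wpull σ hσ c hc) y i = 0 := by
  classical
  have h : wpull σ hσ c hc (lp.single 2 i 1) = 0 := by
    refine lp.ext <| funext fun m => ?_
    rw [wpull_apply]
    simp [hi m]
  have h2 := lp.inner_single_left (𝕜 := ℂ) i (1 : ℂ)
    (ContinuousLinearMap.adjoint (wpull σ hσ c hc) y)
  rw [ContinuousLinearMap.adjoint_inner_right, h, inner_zero_left] at h2
  simpa using h2.symm

/-- `ℓ²(ℕ × ℤ)`. -/
abbrev K : Type := lp (fun _ : ℕ × ℤ => ℂ) 2

instance : Nontrivial K :=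
  ⟨⟨lp.single 2 (0, 0) 1, 0, fun h => by
    have := congrArg (fun x : K => ‖x‖) h
    simp at this⟩⟩

/-- `e_{n,k} ↦ √(1 - q^{2n}) e_{n-1,k}`. -/
def a₀ (q : Set.Ioo (0 : ℝ) 1) : K →L[ℂ] K :=
  wpull (fun x => (x.1 + 1, x.2)) (fun x y h => by simpa [Prod.ext_iff] using h)
    (fun x => √(1 - (q : ℝ) ^ (2 * (x.1 + 1)))) (fun x => by
      rw [abs_of_nonneg (Real.sqrt_nonneg _)]
      refine Real.sqrt_le_one.mpr ?_
      have := pow_nonneg q.2.1.le (2 * (x.1 + 1))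
      linarith)

/-- `e_{n,k} ↦ q^n e_{n,k+1}`. -/
def b₀ (q : Set.Ioo (0 : ℝ) 1) : K →L[ℂ] K :=
  wpull (fun x => (x.1, x.2 - 1)) (fun x y h => by simpa [Prod.ext_iff] using h)
    (fun x => (q : ℝ) ^ x.1) (fun x => by
      rw [abs_of_nonneg (pow_nonneg q.2.1.le _)]
      exact pow_le_one₀ q.2.1.le q.2.2.le)

theorem a₀_apply (q : Set.Ioo (0 : ℝ) 1) (x : K) (n : ℕ) (k : ℤ) :
    a₀ q x (n, k) = (√(1 - (q : ℝ) ^ (2 * (n + 1))) : ℝ) * x (n + 1, k) := rfl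
theorem b₀_apply (q : Set.Ioo (0 : ℝ) 1) (x : K) (n : ℕ) (k : ℤ) :
    b₀ q x (n, k) = ((q : ℝ) ^ n : ℝ) * x (n, k - 1) := rfl
theorem star_a₀_apply_succ (q : Set.Ioo (0 : ℝ) 1) (x : K) (n : ℕ) (k : ℤ) :
    star (a₀ q) x (n + 1, k) = (√(1 - (q : ℝ) ^ (2 * (n + 1))) : ℝ) * x (n, k) :=
  adjoint_wpull_apply _ _ _ _ x (n, k)
theorem star_a₀_apply_zero (q : Set.Ioo (0 : ℝ) 1) (x : K) (k : ℤ) :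
    star (a₀ q) x (0, k) = 0 :=
  adjoint_wpull_apply_of_notMem _ _ _ _ x (0, k) (fun m h => by simp at h)
theorem star_b₀_apply (q : Set.Ioo (0 : ℝ) 1) (x : K) (n : ℕ) (k : ℤ) :
    star (b₀ q) x (n, k) = ((q : ℝ) ^ n : ℝ) * x (n, k + 1) := by
  have := adjoint_wpull_apply (fun x : ℕ × ℤ => (x.1, x.2 - 1))
    (fun x y h => by simpa [Prod.ext_iff] using h)
    (fun x => (q : ℝ) ^ x.1) (fun x => by
      rw [abs_of_nonneg (pow_nonneg q.2.1.le _)]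
      exact pow_le_one₀ q.2.1.le q.2.2.le) x (n, k + 1)
  rwa [add_sub_cancel_right] at this

theorem sqrt_mul_sqrt (q : Set.Ioo (0 : ℝ) 1) (m : ℕ) (z : ℂ) :
    ((√(1 - (q : ℝ) ^ m) : ℝ) : ℂ) * (((√(1 - (q : ℝ) ^ m) : ℝ) : ℂ) * z) =
      (1 - (q : ℝ) ^ m) * z := by
  rw [← mul_assoc, ← Complex.ofReal_mul, Real.mul_self_sqrt]
  · push_cast; ring
  · linarith [pow_le_one₀ (n := m) q.2.1.le q.2.2.le]

theorem rel₀ (q : Set.Ioo (0 : ℝ) 1) : Rel (q : ℝ) (a₀ q) (b₀ q) where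
  star_mul_add := by
    refine ContinuousLinearMap.ext fun x => lp.ext <| funext fun ⟨n, k⟩ => ?_
    change star (a₀ q) (a₀ q x) (n, k) + star (b₀ q) (b₀ q x) (n, k) = x (n, k)
    rw [star_b₀_apply, b₀_apply, add_sub_cancel_right]
    rcases n with _ | n
    · rw [star_a₀_apply_zero]; simp
    · rw [star_a₀_apply_succ, a₀_apply, sqrt_mul_sqrt]; push_cast; ring
  mul_star_add := by
    refine ContinuousLinearMap.ext fun x => lp.ext <| funext fun ⟨n, k⟩ => ?_
    change a₀ q (star (a₀ q) x) (n, k) + ((q : ℝ) : ℂ) ^ 2 * b₀ q (star (b₀ q) x) (n, k) = x (n, k)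
    rw [a₀_apply, star_a₀_apply_succ, sqrt_mul_sqrt, b₀_apply, star_b₀_apply, sub_add_cancel]
    push_cast; ring
  comm := by
    refine ContinuousLinearMap.ext fun x => lp.ext <| funext fun ⟨n, k⟩ => ?_
    change a₀ q (b₀ q x) (n, k) - ((q : ℝ) : ℂ) * b₀ q (a₀ q x) (n, k) = 0
    rw [a₀_apply, b₀_apply, b₀_apply, a₀_apply]
    push_cast; ring
  comm_star := by
    refine ContinuousLinearMap.ext fun x => lp.ext <| funext fun ⟨n, k⟩ => ?_
    change a₀ q (star (b₀ q) x) (n, k) - ((q : ℝ) : ℂ) * star (b₀ q) (a₀ q x) (n, k) = 0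
    rw [a₀_apply, star_b₀_apply, star_b₀_apply, a₀_apply]
    push_cast; ring
  normal := by
    refine ContinuousLinearMap.ext fun x => lp.ext <| funext fun ⟨n, k⟩ => ?_
    change star (b₀ q) (b₀ q x) (n, k) = b₀ q (star (b₀ q) x) (n, k)
    rw [b₀_apply, star_b₀_apply, star_b₀_apply, b₀_apply]
    simp

/-- The representation `π₀` of the universal algebra on `ℓ²(ℕ × ℤ)`. -/
def π₀ (q : Set.Ioo (0 : ℝ) 1) : Alg (q : ℝ) →⋆ₐ[ℂ] (K →L[ℂ] K) :=
  evalHom ⟨K →L[ℂ] K, a₀ q, b₀ q, rel₀ q⟩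

/-- The basis vector `e_{n,0}`. -/
def δ (n : ℕ) : K := lp.single 2 (n, 0) 1

theorem haar_summable (q : Set.Ioo (0 : ℝ) 1) (x : Alg (q : ℝ)) :
    Summable (fun n : ℕ => (((q : ℝ) ^ (2 * n) : ℝ) : ℂ) * ⟪δ n, π₀ q x (δ n)⟫_ℂ) := by
  have hq : Summable (fun n : ℕ => ((q : ℝ) ^ 2) ^ n * ‖π₀ q x‖) :=
    (summable_geometric_of_lt_one (by positivity)
      (pow_lt_one₀ q.2.1.le q.2.2 two_ne_zero)).mul_right _
  refine Summable.of_norm_bounded hq fun n => ?_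
  have hδ : ‖δ n‖ = 1 := by simp [δ]
  rw [norm_mul, Complex.norm_real, Real.norm_eq_abs, abs_of_nonneg (pow_nonneg q.2.1.le _), pow_mul]
  gcongr
  refine (norm_inner_le_norm _ _).trans ?_
  have := (π₀ q x).le_opNorm (δ n)
  rw [hδ] at *
  linarith

/-- The Haar state as a linear functional. -/
def haarLin (q : Set.Ioo (0 : ℝ) 1) : Alg (q : ℝ) →ₗ[ℂ] ℂ where
  toFun x := (1 - ((q : ℝ) : ℂ) ^ 2) *
    ∑' n : ℕ, (((q : ℝ) ^ (2 * n) : ℝ) : ℂ) * ⟪δ n, π₀ q x (δ n)⟫_ℂ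
  map_add' x y := by
    rw [← mul_add, ← (haar_summable q x).tsum_add (haar_summable q y)]
    simp only [map_add, add_apply, inner_add_right, mul_add]
  map_smul' z x := by
    simp only [map_smul, smul_apply, inner_smul_right, RingHom.id_apply, smul_eq_mul]
    rw [mul_left_comm z, ← tsum_mul_left (a := z)]
    simp only [mul_left_comm z]

theorem haarLin_nonneg (q : Set.Ioo (0 : ℝ) 1) (x : Alg (q : ℝ)) (hx : 0 ≤ x) :
    0 ≤ haarLin q x := by
  obtain ⟨y, rfl⟩ := CStarAlgebra.nonneg_iff_eq_star_mul_self.mp hx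
  have h1 : (0 : ℂ) ≤ 1 - ((q : ℝ) : ℂ) ^ 2 := by
    rw [← Complex.ofReal_pow, ← Complex.ofReal_one, ← Complex.ofReal_sub,
      Complex.zero_le_real]
    linarith [pow_le_one₀ (n := 2) q.2.1.le q.2.2.le]
  refine mul_nonneg h1 (tsum_nonneg fun n => mul_nonneg ?_ ?_)
  · exact Complex.zero_le_real.mpr (pow_nonneg q.2.1.le _)
  · rw [map_mul, map_star]
    change 0 ≤ ⟪δ n, ContinuousLinearMap.adjoint (π₀ q y) (π₀ q y (δ n))⟫_ℂ
    rw [ContinuousLinearMap.adjoint_inner_right, inner_self_eq_norm_sq_to_K]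
    exact pow_nonneg (Complex.zero_le_real.mpr (norm_nonneg (π₀ q y (δ n)))) 2

/-- The Haar state `h` of `SU_q(2)`. -/
def haar (q : Set.Ioo (0 : ℝ) 1) : Alg (q : ℝ) →ₚ[ℂ] ℂ :=
  PositiveLinearMap.mk₀ (haarLin q) (haarLin_nonneg q)

/-! ### The space `L₂(h)`, left multiplication, and the basis of matrix elements -/

/-- `L₂(h)`, the GNS space of the Haar state. -/
abbrev L2 (q : Set.Ioo (0 : ℝ) 1) : Type 1 := (haar q).GNS

/-- The class `a Ω` of `a` in `L₂(h)`. -/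
def toL2 (q : Set.Ioo (0 : ℝ) 1) (a : Alg (q : ℝ)) : L2 q :=
  ((haar q).toPreGNS a : (haar q).GNS)

/-- The representation of the algebra on `L₂(h)` by left multiplication, `π(a) (b Ω) = (a b) Ω`. -/
def leftReg (q : Set.Ioo (0 : ℝ) 1) : Alg (q : ℝ) →⋆ₐ[ℂ] (L2 q →L[ℂ] L2 q) :=
  (haar q).gnsStarAlgHom

/-- Matrix elements of the irreducible representation of spin `N / 2`, up to positive scalars.

Let `u = !![α, q β*; -β, α*]` be the fundamental (spin `1/2`) unitary representation, with
rows and columns labelled by `-, +` (that is, by `-1/2, 1/2`).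
The irreducible representation of spin `N / 2` is the restriction of
the `N`-fold tensor power of `u` to the span of the orthogonal `q`-symmetric tensors `S_{N,k}`, where
`S_{N,k}` is the sum over all words in `-, +` of length `N` with exactly `k` letters `+`,
a word being weighted by `q` to the number of pairs formed by a letter `-` and a later letter `+`.
Thus `S_{N+1,k} = q^k e_- ⊗ S_{N,k} + e_+ ⊗ S_{N,k-1}`, and
`matElt q N k l = ⟨S_{N,k}, u^{⊗N} S_{N,l}⟩` obeys the recursion below.
The usual labels are `n = N / 2`, `i = k - n`, `j = l - n`. -/
def matElt (q : ℝ) : ℕ → ℤ → ℤ → Alg q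
  | 0, k, l => if k = 0 ∧ l = 0 then 1 else 0
  | N + 1, k, l =>
      (q : ℂ) ^ (k + l) • (α q * matElt q N k l)
      + (q : ℂ) ^ k • (((q : ℂ) • star (β q)) * matElt q N k (l - 1))
      + (q : ℂ) ^ l • ((-β q) * matElt q N (k - 1) l)
      + star (α q) * matElt q N (k - 1) (l - 1)

/-- The basis vector `e^{(n)}_{ij}` of `L₂(h)`, `n = N / 2`, `i = k - n`, `j = l - n`: the
normalized matrix element `t^{(n)}_{ij}`. -/
def e (q : Set.Ioo (0 : ℝ) 1) (N : ℕ) (k l : ℤ) : L2 q :=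
  ((‖toL2 q (matElt q N k l)‖⁻¹ : ℝ) : ℂ) • toL2 q (matElt q N k l)

/-- The labels `(2n, n + i, n + j)` of the basis `e^{(n)}_{ij}`: `n ∈ {0, 1/2, 1, …}` and
`i, j ∈ {-n, -n + 1, …, n}`. -/
abbrev LLabel : Type := {x : ℕ × ℤ × ℤ // (0 ≤ x.2.1 ∧ x.2.1 ≤ x.1) ∧ (0 ≤ x.2.2 ∧ x.2.2 ≤ x.1)}

/-! ### Unbounded operators -/

/-- The diagonal operator `e i ↦ c i • e i` for an orthonormal basis `e` and real numbers `c i`,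
with its maximal domain (so that it is self-adjoint): `x` is in the domain when the series
`∑ i, c i • ⟪e i, x⟫ • e i` converges unconditionally. -/
def diagOp {ι E : Type*} [NormedAddCommGroup E] [InnerProductSpace ℂ E] (e : ι → E) (c : ι → ℝ) :
    E →ₗ.[ℂ] E where
  domain :=
    { carrier := {x | Summable fun i => (c i : ℂ) • ⟪e i, x⟫_ℂ • e i}
      add_mem' := fun {x y} hx hy => by
        simpa [inner_add_right, add_smul, smul_add] using Summable.add hx hy
      zero_mem' := by simp
      smul_mem' := fun z x hx => by
        have h : Summable fun i => z • (c i : ℂ) • ⟪e i, x⟫_ℂ • e i := Summable.const_smul z hx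
        refine h.congr fun i => ?_
        simp only [inner_smul_right, smul_smul]
        congr 1; ring }
  toFun :=
    { toFun := fun x => ∑' i, (c i : ℂ) • ⟪e i, (x : E)⟫_ℂ • e i
      map_add' := fun x y => by
        rw [← Summable.tsum_add x.2 y.2]
        simp [add_smul, smul_add]
      map_smul' := fun z x => by
        rw [RingHom.id_apply, ← tsum_const_smul'' z]
        refine tsum_congr fun i => ?_
        simp only [Submodule.coe_smul, inner_smul_right, smul_smul]
        congr 1; ring }

/-- The orthogonal direct sum of two unbounded operators. -/
def pmapSum {E F : Type*} [NormedAddCommGroup E] [InnerProductSpace ℂ E]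
    [NormedAddCommGroup F] [InnerProductSpace ℂ F] (S : E →ₗ.[ℂ] E) (T : F →ₗ.[ℂ] F) :
    WithLp 2 (E × F) →ₗ.[ℂ] WithLp 2 (E × F) where
  domain := (S.domain.prod T.domain).comap (WithLp.linearEquiv 2 ℂ (E × F)).toLinearMap
  toFun :=
    { toFun := fun x => WithLp.toLp 2 (S ⟨x.1.fst, x.2.1⟩, T ⟨x.1.snd, x.2.2⟩)
      map_add' := fun x y => by
        rw [← WithLp.toLp_add, Prod.mk_add_mk, ← LinearPMap.map_add, ← LinearPMap.map_add]
        rfl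
      map_smul' := fun z x => by
        rw [RingHom.id_apply, ← WithLp.toLp_smul, Prod.smul_mk, ← LinearPMap.map_smul,
          ← LinearPMap.map_smul]
        rfl }

/-- The unbounded operator `U T U*` for a unitary `U`. -/
def pmapConj {E F : Type*} [NormedAddCommGroup E] [InnerProductSpace ℂ E]
    [NormedAddCommGroup F] [InnerProductSpace ℂ F] (U : E ≃ₗᵢ[ℂ] F) (T : E →ₗ.[ℂ] E) :
    F →ₗ.[ℂ] F where
  domain := T.domain.comap U.symm.toLinearEquiv.toLinearMap
  toFun :=
    { toFun := fun y => U (T ⟨U.symm y.1, y.2⟩)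
      map_add' := fun x y => by
        rw [← map_add U, ← LinearPMap.map_add]
        congr 2
        exact Subtype.ext (map_add U.symm _ _)
      map_smul' := fun z x => by
        rw [RingHom.id_apply, ← map_smul U, ← LinearPMap.map_smul]
        congr 2
        exact Subtype.ext (map_smul U.symm _ _) }

/-- The eigenvalues of `D₁`: `-2n` if `j ≠ n` and `2n + 1` if `j = n`. -/
def eigD₁ (x : LLabel) : ℝ := if x.1.2.2 = x.1.1 then x.1.1 + 1 else -x.1.1

/-- The eigenvalues of `D₂`: `-2n - 1` if `j ≠ n` and `2n + 1` if `j = n`. -/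
def eigD₂ (x : LLabel) : ℝ := if x.1.2.2 = x.1.1 then x.1.1 + 1 else -x.1.1 - 1

/-- The operator `D₁` on `L₂(h)`. -/
def D₁ (q : Set.Ioo (0 : ℝ) 1) : L2 q →ₗ.[ℂ] L2 q :=
  diagOp (fun x : LLabel => e q x.1.1 x.1.2.1 x.1.2.2) eigD₁

/-- The absolute value `|D₂|` of the diagonal operator `D₂` on `L₂(h)` with eigenvalues `eigD₂`. -/
def absD₂ (q : Set.Ioo (0 : ℝ) 1) : L2 q →ₗ.[ℂ] L2 q :=
  diagOp (fun x : LLabel => e q x.1.1 x.1.2.1 x.1.2.2) fun x => |eigD₂ x|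

/-! ### The spectral triple of Dabrowski et al. -/

/-- `(N, k, p) = (2n, n + i, n + j + 1/2)` labels a basis vector `u^n_{ij}` (for `s = 0`, where
`-n ≤ i ≤ n` and `-n - 1/2 ≤ j ≤ n + 1/2`) or `d^n_{ij}` (for `s = 1`, where `-n ≤ i ≤ n` and
`-n + 1/2 ≤ j ≤ n - 1/2`). -/
def IsLabel (s : Fin 2) (N k p : ℤ) : Prop :=
  (0 ≤ k ∧ k ≤ N) ∧ (if s = 0 then 0 ≤ p ∧ p ≤ N + 1 else 1 ≤ p ∧ p ≤ N)

/-- The labels `(s, N, k, p)` of all the basis vectors `u^n_{ij}` and `d^n_{ij}`. -/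
abbrev HLabel : Type := {x : Fin 2 × ℤ × ℤ × ℤ // IsLabel x.1 x.2.1 x.2.2.1 x.2.2.2}

/-- The carrier Hilbert space, with orthonormal basis the `u^n_{ij}` and the `d^n_{ij}`. -/
abbrev H : Type := lp (fun _ : HLabel => ℂ) 2

open Classical in
/-- The pair `v^n_{ij} = (u^n_{ij}, d^n_{ij})`, indexed by `s`, where
`(N, k, p) = (2n, n + i, n + j + 1/2)`; a vector whose label is out of range is zero. -/
def v (N k p : ℤ) (s : Fin 2) : H :=
  if h : IsLabel s N k p then lp.single 2 ⟨(s, N, k, p), h⟩ 1 else 0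

/-- The basis vector `u^n_{ij}`, where `(N, k, p) = (2n, n + i, n + j + 1/2)`. -/
abbrev uVec (N k p : ℤ) : H := v N k p 0

/-- The basis vector `d^n_{ij}`, where `(N, k, p) = (2n, n + i, n + j + 1/2)`. -/
abbrev dVec (N k p : ℤ) : H := v N k p 1

/-- The Dirac operator `D`: `D u^n_{ij} = (2n + 1) u^n_{ij}`, `D d^n_{ij} = -2n d^n_{ij}`. -/
def D : H →ₗ.[ℂ] H :=
  diagOp (fun x : HLabel => v x.1.2.1 x.1.2.2.1 x.1.2.2.2 x.1.1)
    fun x => if x.1.1 = 0 then x.1.2.1 + 1 else -x.1.2.1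

/-- The `q`-number `[m]`. -/
def qnum (q m : ℝ) : ℝ := (q ^ m - q ^ (-m)) / (q - q⁻¹)

/-- The matrix `a⁺_{nij}`. -/
def aPlus (q n i j : ℝ) : Matrix (Fin 2) (Fin 2) ℝ :=
  (q ^ ((i + j - 1 / 2) / 2) * √(qnum q (n + i + 1))) •
    !![q ^ (-n - 1 / 2) * (√(qnum q (n + j + 3 / 2)) / qnum q (2 * n + 2)),
       0;
       q ^ (1 / 2 : ℝ) * (√(qnum q (n - j + 1 / 2)) / (qnum q (2 * n + 1) * qnum q (2 * n + 2))),
       q ^ (-n) * (√(qnum q (n + j + 1 / 2)) / qnum q (2 * n + 1))]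

/-- The matrix `a⁻_{nij}`. -/
def aMinus (q n i j : ℝ) : Matrix (Fin 2) (Fin 2) ℝ :=
  (q ^ ((i + j - 1 / 2) / 2) * √(qnum q (n - i))) •
    !![q ^ (n + 1) * (√(qnum q (n - j + 1 / 2)) / qnum q (2 * n + 1)),
       -(q ^ (1 / 2 : ℝ) * (√(qnum q (n + j + 1 / 2)) / (qnum q (2 * n) * qnum q (2 * n + 1))));
       0,
       q ^ (n + 1 / 2) * (√(qnum q (n - j - 1 / 2)) / qnum q (2 * n))]

/-- The matrix `b⁺_{nij}`. -/
def bPlus (q n i j : ℝ) : Matrix (Fin 2) (Fin 2) ℝ :=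
  (q ^ ((i + j - 1 / 2) / 2) * √(qnum q (n + i + 1))) •
    !![√(qnum q (n - j + 3 / 2)) / qnum q (2 * n + 2),
       0;
       -(q ^ (-n - 1) * (√(qnum q (n + j + 1 / 2)) / (qnum q (2 * n + 1) * qnum q (2 * n + 2)))),
       q ^ (-1 / 2 : ℝ) * (√(qnum q (n - j + 1 / 2)) / qnum q (2 * n + 1))]

/-- The matrix `b⁻_{nij}`. -/
def bMinus (q n i j : ℝ) : Matrix (Fin 2) (Fin 2) ℝ :=
  (q ^ ((i + j - 1 / 2) / 2) * √(qnum q (n - i))) •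
    !![-(q ^ (-1 / 2 : ℝ) * (√(qnum q (n + j + 1 / 2)) / qnum q (2 * n + 1))),
       -(q ^ n * (√(qnum q (n - j + 1 / 2)) / (qnum q (2 * n) * qnum q (2 * n + 1))));
       0,
       -(√(qnum q (n + j - 1 / 2)) / qnum q (2 * n))]

open scoped Matrix in
/-- The matrix `ã⁺_{nij}`. -/
def aTildePlus (q n i j : ℝ) : Matrix (Fin 2) (Fin 2) ℝ :=
  (aMinus q (n + 1 / 2) (i - 1 / 2) (j - 1 / 2))ᴴ

open scoped Matrix in
/-- The matrix `ã⁻_{nij}`. -/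
def aTildeMinus (q n i j : ℝ) : Matrix (Fin 2) (Fin 2) ℝ :=
  (aPlus q (n - 1 / 2) (i - 1 / 2) (j - 1 / 2))ᴴ

open scoped Matrix in
/-- The matrix `b̃⁺_{nij}`. -/
def bTildePlus (q n i j : ℝ) : Matrix (Fin 2) (Fin 2) ℝ :=
  (bMinus q (n + 1 / 2) (i - 1 / 2) (j + 1 / 2))ᴴ

open scoped Matrix in
/-- The matrix `b̃⁻_{nij}`. -/
def bTildeMinus (q n i j : ℝ) : Matrix (Fin 2) (Fin 2) ℝ :=
  (bPlus q (n - 1 / 2) (i - 1 / 2) (j + 1 / 2))ᴴ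

/-- For `(N, k, p) = (2n, n + i, n + j + 1/2)` and a family `M` of matrices indexed by `(n, i, j)`,
the image of the component `s` of `v^n_{ij}` under the operator with matrix `M_{nij}` from the span
of the pair `v^n_{ij}` to the span of the pair `w`. The columns of the matrix are indexed by the
source and its rows by the target: `u^n_{ij}` goes to `M₀₀ w₀ + M₁₀ w₁` and `d^n_{ij}` goes to
`M₀₁ w₀ + M₁₁ w₁`. -/
def act (M : ℝ → ℝ → ℝ → Matrix (Fin 2) (Fin 2) ℝ) (N k p : ℤ) (w : Fin 2 → H) (s : Fin 2) : H :=
  ∑ r, ((M (N / 2) (k - N / 2) (p - N / 2 - 1 / 2) r s : ℝ) : ℂ) • w r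

/-- `ρ` is the representation `π'` of Dabrowski et al. (it is determined by these formulas, already
by the first two). With `(N, k, p) = (2n, n + i, n + j + 1/2)`, the pair
`v^{n ± 1/2}_{i ± 1/2, j ± 1/2}` is indexed by the correspondingly shifted labels; for instance
`v^{n + 1/2}_{i + 1/2, j + 1/2}` is `v (N + 1) (k + 1) (p + 1)` and `v^{n - 1/2}_{i + 1/2, j - 1/2}`
is `v (N - 1) k (p - 1)`. -/
structure IsPiPrime (q : Set.Ioo (0 : ℝ) 1) (ρ : Alg (q : ℝ) →⋆ₐ[ℂ] (H →L[ℂ] H)) : Prop where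
  star_alpha : ∀ s N k p, IsLabel s N k p → ρ (star (α q)) (v N k p s) =
    act (aPlus q) N k p (v (N + 1) (k + 1) (p + 1)) s + act (aMinus q) N k p (v (N - 1) k p) s
  neg_beta : ∀ s N k p, IsLabel s N k p → ρ (-β q) (v N k p s) =
    act (bPlus q) N k p (v (N + 1) (k + 1) p) s + act (bMinus q) N k p (v (N - 1) k (p - 1)) s
  alpha : ∀ s N k p, IsLabel s N k p → ρ (α q) (v N k p s) =
    act (aTildePlus q) N k p (v (N + 1) k p) s +
      act (aTildeMinus q) N k p (v (N - 1) (k - 1) (p - 1)) s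
  neg_star_beta : ∀ s N k p, IsLabel s N k p → ρ (-star (β q)) (v N k p s) =
    act (bTildePlus q) N k p (v (N + 1) k (p + 1)) s +
      act (bTildeMinus q) N k p (v (N - 1) (k - 1) p) s

/-! ### The ideal and bounded operators built from `π` -/

/-- The bounded operator `u^n_{ij} ↦ q^n u^n_{ij}`, `d^n_{ij} ↦ q^n d^n_{ij}`. -/
def qPow (q : Set.Ioo (0 : ℝ) 1) : H →L[ℂ] H :=
  wpull id Function.injective_id (fun x : HLabel => (q : ℝ) ^ ((x.1.2.1 : ℝ) / 2)) fun x => by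
    have h : (0 : ℝ) ≤ x.1.2.1 := by exact_mod_cast x.2.1.1.trans x.2.1.2
    rw [abs_of_nonneg (Real.rpow_nonneg q.2.1.le _)]
    exact Real.rpow_le_one q.2.1.le q.2.2.le (by positivity)

/-- The two-sided (algebraic) ideal of the ring of bounded operators generated by `qPow`. -/
def Kq (q : Set.Ioo (0 : ℝ) 1) : TwoSidedIdeal (H →L[ℂ] H) := TwoSidedIdeal.span {qPow q}

/-- The orthogonal direct sum of two bounded operators. -/
def opSum {E F : Type*} [NormedAddCommGroup E] [InnerProductSpace ℂ E]
    [NormedAddCommGroup F] [InnerProductSpace ℂ F] (S : E →L[ℂ] E) (T : F →L[ℂ] F) :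
    WithLp 2 (E × F) →L[ℂ] WithLp 2 (E × F) :=
  (WithLp.prodContinuousLinearEquiv 2 ℂ E F).symm.toContinuousLinearMap ∘L
    (S.prodMap T) ∘L (WithLp.prodContinuousLinearEquiv 2 ℂ E F).toContinuousLinearMap

/-- The bounded operator `U T U*` for a unitary `U`. -/
def opConj {E F : Type*} [NormedAddCommGroup E] [InnerProductSpace ℂ E]
    [NormedAddCommGroup F] [InnerProductSpace ℂ F] (U : E ≃ₗᵢ[ℂ] F) (T : E →L[ℂ] E) :
    F →L[ℂ] F :=
  U.toContinuousLinearEquiv.toContinuousLinearMap ∘L T ∘L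
    U.symm.toContinuousLinearEquiv.toContinuousLinearMap

end SUq2

end

open SUq2

noncomputable section

namespace SUq2

/-! ### Matrix elements over an abstract quantum `SL(2)` matrix -/

/-! Throughout, N = 2n, k = n + i, and T_N(k,l) is the matrix element `qT` or `matElt`. The point is
that π' is itself unitarily equivalent to π ⊕ π. For fixed N, k, p the pair `v N k p` is matched
with an orthonormal basis of the plane spanned by e_{k,p-1} ⊕ 0 and 0 ⊕ e_{k,p}. For p = 0 and p =
N+1 only one of these two vectors exists, and likewise only the u-vector exists. Every choice of
angles that respects these boundary cases (`IsRot`) gives a unitary `rotEquiv`. The degenerate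
angles `cosTop`, `sinTop` give U. The angles `cosRot`, `sinRot` give a second unitary W, and π' is
defined as W(π ⊕ π)W*. It is then automatically a *-representation, and only its formulas have to be
checked (`star_α_v`, `neg_β_v`; the other two are their adjoints). The identity for D is a matching
of eigenvalues under a bijection of labels (`pmapConj_pmapSum_diagOp`).

This needs the exact action of the generators on the orthonormal basis. Left multiplication of
T_N(k,l) by a generator gives a combination of T_{N+1} and T_{N-1}, with coefficients that follow
from the quantum SL(2) relations alone (`a_mul_qT`, `b_mul_qT`, `c_mul_qT`, `d_mul_qT`). The Haar
state kills T_N for N > 0 (`haarLin_matElt_succ`), by its modular property with respect to α.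
Orthogonality follows by moving generators across the inner product, and the ratios of norms follow
by comparing each generator with its adjoint. After normalization the coefficients become geometric
means (`star_α_eInt`, `neg_β_eInt`).

For the comparison, `gnum q m` = 1 - q^{2m} tends to 1 exponentially fast. The angles of W do not
approach those of U uniformly: up to O(q^N) they are functions of N - p. The parts of the generators
without decay in p, namely α* raising and β lowering the spin, preserve N - p. The other parts carry
a power of q of order p, and the angles approach the degenerate ones like q^{N-p}. Accordingly the
entries of the two representations differ by O(q^N) (`abs_entry_sub_le` and its companions). Since
the generator of `Kq` has weight q^{N/2}, such a difference is a bounded sum of shifts times `qPow`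
(`mem_Kq_of_shift`). The passage to all polynomials uses only the ideal property
(`sub_mem_of_mem_adjoin`). -/

/-- The number `1 - q^{2m}`, a multiple of the `q`-number of `m`. -/
def gnum {F : Type*} [Field F] (q : F) (m : ℤ) : F := 1 - (q ^ m) ^ 2

section Abstract

variable {F R : Type*} [Field F] [Ring R] [Algebra F R]

/-- The entries of a quantum `SL(2)` matrix `!![a, b; c, d]`. -/
structure QMat (q : F) (a b c d : R) : Prop where
  ab : a * b = q • (b * a)
  ac : a * c = q • (c * a)
  bd : b * d = q • (d * b)
  cd : c * d = q • (d * c)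
  bc : b * c = c * b
  ad : a * d = 1 + q • (b * c)
  -- This is d a = 1 + q⁻¹ b c multiplied by q, so that no inverse of q appears.
  da : q • (d * a) = q • 1 + b * c

/-- The relations are invariant under transposition. Every statement about columns therefore yields
one about rows through `qT_swap`. -/
theorem QMat.swap {q : F} {a b c d : R} (h : QMat q a b c d) : QMat q a c b d :=
  ⟨h.ac, h.ab, h.cd, h.bd, h.bc.symm, by rw [h.ad, h.bc], by rw [h.da, h.bc]⟩

/-- The matrix elements of the `N`-th symmetric power of the matrix `!![a, b; c, d]` in the basis of
`q`-symmetric tensors. -/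
def qT (q : F) (a b c d : R) : ℕ → ℤ → ℤ → R
  | 0, k, l => if k = 0 ∧ l = 0 then 1 else 0
  | N + 1, k, l =>
      q ^ (k + l) • (a * qT q a b c d N k l)
      + q ^ k • (b * qT q a b c d N k (l - 1))
      + q ^ l • (c * qT q a b c d N (k - 1) l)
      + d * qT q a b c d N (k - 1) (l - 1)

theorem qT_swap (q : F) (a b c d : R) (N : ℕ) (k l : ℤ) :
    qT q a c b d N k l = qT q a b c d N l k := by
  induction N generalizing k l with
  | zero => simp [qT, and_comm]
  | succ N ih => simp only [qT, ih]; rw [add_comm l k]; abel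

theorem qT_eq_zero (q : F) (a b c d : R) (N : ℕ) (k l : ℤ)
    (h : ¬ ((0 ≤ k ∧ k ≤ N) ∧ (0 ≤ l ∧ l ≤ N))) : qT q a b c d N k l = 0 := by
  induction N generalizing k l with
  | zero => rw [qT, if_neg]; push_cast at h; omega
  | succ N ih =>
    push_cast at h
    rw [qT, ih k l (by omega), ih k (l - 1) (by omega), ih (k - 1) l (by omega),
      ih (k - 1) (l - 1) (by omega)]
    simp

/-- The recursion by splitting off the last tensor factor. -/
theorem qT_succ_right {q : F} (hq : q ≠ 0) (a b c d : R) (N : ℕ) (k l : ℤ) :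
    qT q a b c d (N + 1) k l = qT q a b c d N k l * a
      + q ^ (N + 1 - l) • (qT q a b c d N k (l - 1) * b)
      + q ^ (N + 1 - k) • (qT q a b c d N (k - 1) l * c)
      + q ^ (2 * N + 2 - k - l) • (qT q a b c d N (k - 1) (l - 1) * d) := by
  induction N generalizing k l with
  | zero =>
    simp only [qT]
    by_cases hk : k = 0 <;> by_cases hk1 : k = 1 <;> by_cases hl : l = 0 <;>
      by_cases hl1 : l = 1 <;> subst_vars <;> simp_all [sub_eq_zero]
  | succ N ih =>
    -- Splitting off the first and then the last tensor factor leaves the same sixteen terms as the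
    -- opposite order.
    conv_lhs => rw [qT, ih, ih, ih, ih]
    have e (x y : ℤ) : q ^ x * q ^ y = q ^ (x + y) := (zpow_add₀ hq x y).symm
    simp only [qT, mul_add, add_mul, smul_add, smul_smul, mul_smul_comm, smul_mul_assoc, mul_assoc,
      e]
    push_cast
    ring_nf
    abel

/-- Both column contractions of the fundamental matrix with the `N`-th symmetric power. -/
def ColRel (q : F) (a b c d : R) (N : ℕ) : Prop := ∀ k l : ℤ,
  gnum q (N + 1) • (q ^ k • (a * qT q a b c d N k l) + c * qT q a b c d N (k - 1) l) =
      (q ^ l * gnum q (N - l + 1)) • qT q a b c d (N + 1) k l ∧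
  gnum q (N + 1) • (q ^ k • (b * qT q a b c d N k (l - 1)) + d * qT q a b c d N (k - 1) (l - 1)) =
      gnum q l • qT q a b c d (N + 1) k l

/-- Background for `ColRel`: the component of e_- ⊗ S_{N,l}, respectively e_+ ⊗ S_{N,l-1}, along
S_{N+1,l} is a scalar multiple, and the scalars are q^l (1 - q^{2(N+1-l)})/(1 - q^{2(N+1)}) and (1 -
q^{2l})/(1 - q^{2(N+1)}). -/
theorem colRel_zero (q : F) (a b c d : R) : ColRel q a b c d 0 := by
  intro k l
  simp only [qT]
  by_cases hk : k = 0 <;> by_cases hk1 : k = 1 <;> by_cases hl : l = 0 <;>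
      by_cases hl1 : l = 1 <;> subst_vars <;> simp_all [sub_eq_zero, gnum]

/-- `ColRel` at l and at l - 1 expresses T_{N+1}(k,l) and T_{N+1}(k,l-1) through spin N. After
multiplication by a and b the terms with a b and b a cancel, and the rest collapses by a d - q b c =
1. The factor q in front of `h2` compensates the exponent l - 1. -/
theorem ColRel.lower_left {q : F} (hq : q ≠ 0) {a b c d : R} (h : QMat q a b c d) {N : ℕ}
    (H : ColRel q a b c d N) (k l : ℤ) :
    gnum q l • (a * qT q a b c d (N + 1) k l)
      - (q ^ l * gnum q (N + 2 - l)) • (b * qT q a b c d (N + 1) k (l - 1)) =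
      gnum q (N + 1) • qT q a b c d N (k - 1) (l - 1) := by
  have h1 := congrArg (a * ·) (H k l).2
  have h2 := congrArg (b * ·) (H k (l - 1)).1
  have e : q ^ (l - 1) = q ^ l * q⁻¹ := zpow_sub_one₀ hq l
  have e' : (N : ℤ) - (l - 1) + 1 = N + 2 - l := by ring
  have hab (X : R) : a * (b * X) = q • (b * (a * X)) := by
    rw [← mul_assoc, h.ab, smul_mul_assoc, mul_assoc]
  have had (X : R) : a * (d * X) = X + q • (b * (c * X)) := by
    rw [← mul_assoc, h.ad, add_mul, smul_mul_assoc, mul_assoc, one_mul]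
  simp only [mul_add, smul_add, mul_smul_comm, e, e', hab, had] at h1 h2
  linear_combination (norm := skip) q • h2 - h1
  match_scalars <;> field_simp <;> ring

theorem ColRel.lower_right {q : F} (hq : q ≠ 0) {a b c d : R} (h : QMat q a b c d) {N : ℕ}
    (H : ColRel q a b c d N) (k l : ℤ) :
    gnum q l • (c * qT q a b c d (N + 1) (k - 1) l)
      - (q ^ l * gnum q (N + 2 - l)) • (d * qT q a b c d (N + 1) (k - 1) (l - 1)) =
      -(q ^ k * gnum q (N + 1)) • qT q a b c d N (k - 1) (l - 1) := by
  have h1 := congrArg (c * ·) (H (k - 1) l).2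
  have h2 := congrArg (d * ·) (H (k - 1) (l - 1)).1
  have e : q ^ (l - 1) = q ^ l * q⁻¹ := zpow_sub_one₀ hq l
  have ek : q ^ (k - 1) = q ^ k * q⁻¹ := zpow_sub_one₀ hq k
  have e' : (N : ℤ) - (l - 1) + 1 = N + 2 - l := by ring
  have hcd (X : R) : c * (d * X) = q • (d * (c * X)) := by
    rw [← mul_assoc, h.cd, smul_mul_assoc, mul_assoc]
  have hcb (X : R) : c * (b * X) = q • (d * (a * X)) - q • X := by
    rw [← mul_assoc, ← h.bc, ← sub_eq_iff_eq_add'.mpr h.da, sub_mul, smul_mul_assoc, smul_mul_assoc,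
      mul_assoc, one_mul]
  simp only [mul_add, smul_add, mul_smul_comm, e, ek, e', hcd, hcb] at h1 h2
  linear_combination (norm := skip) q • h2 - h1
  match_scalars <;> field_simp <;> ring

theorem gnum_add {q : F} (hq : q ≠ 0) (m n : ℤ) :
    gnum q (m + n) = gnum q n + (q ^ n) ^ 2 * gnum q m := by
  simp only [gnum, zpow_add₀ hq]; ring

/-- The right-hand sides of `lower_left` and `lower_right` cancel in the combination q^k h1 + h2.
Hence the two column contractions of spin N + 1 are proportional, and the recursion defining T_{N+2}
fixes the common factor. -/
theorem ColRel.succ {q : F} (hq : q ≠ 0) {a b c d : R} (h : QMat q a b c d) {N : ℕ}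
    (H : ColRel q a b c d N) : ColRel q a b c d (N + 1) := by
  intro k l
  have h1 := H.lower_left hq h k l
  have h2 := H.lower_right hq h k l
  have e : gnum q ((N + 1 : ℕ) + 1) = gnum q l + (q ^ l) ^ 2 * gnum q (N + 2 - l) := by
    rw [← gnum_add hq]; push_cast; ring_nf
  have e' : ((N + 1 : ℕ) : ℤ) - l + 1 = N + 2 - l := by push_cast; ring
  rw [e, e', show qT q a b c d (N + 1 + 1) k l = _ from qT.eq_2 .., zpow_add₀ hq]
  constructor
  · linear_combination (norm := module) q ^ k • h1 + h2
  · linear_combination (norm := module) -(q ^ l * q ^ k) • h1 - q ^ l • h2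

theorem colRel {q : F} (hq : q ≠ 0) {a b c d : R} (h : QMat q a b c d) (N : ℕ) :
    ColRel q a b c d N := by
  induction N with
  | zero => exact colRel_zero q a b c d
  | succ N ih => exact ih.succ hq h

/-- For N = 0 the truncated index `N - 1` is harmless because its coefficient `gnum q 0` vanishes.
-/
theorem lower_left {q : F} (hq : q ≠ 0) {a b c d : R} (h : QMat q a b c d) (N : ℕ) (k l : ℤ) :
    gnum q l • (a * qT q a b c d N k l)
      - (q ^ l * gnum q (N + 1 - l)) • (b * qT q a b c d N k (l - 1)) =
      gnum q N • qT q a b c d (N - 1) (k - 1) (l - 1) := by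
  rcases N with _ | N
  · by_cases hl : l = 0 <;> by_cases hl1 : l = 1 <;> simp_all [gnum, qT, sub_eq_zero]
  · convert (colRel hq h N).lower_left hq h k l using 3 <;> push_cast <;> ring_nf

theorem lower_right {q : F} (hq : q ≠ 0) {a b c d : R} (h : QMat q a b c d) (N : ℕ) (k l : ℤ) :
    gnum q l • (c * qT q a b c d N (k - 1) l)
      - (q ^ l * gnum q (N + 1 - l)) • (d * qT q a b c d N (k - 1) (l - 1)) =
      -(q ^ k * gnum q N) • qT q a b c d (N - 1) (k - 1) (l - 1) := by
  rcases N with _ | N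
  · by_cases hl : l = 0 <;> by_cases hl1 : l = 1 <;> simp_all [gnum, qT, sub_eq_zero]
  · convert (colRel hq h N).lower_right hq h k l using 3 <;> push_cast <;> ring_nf

/-! ### Clebsch–Gordan formulas for left multiplication by a matrix entry -/

section LeftMul

variable {q : F} (hq : q ≠ 0) {a b c d : R} (h : QMat q a b c d)
include hq h

/-- The row contraction (`colRel` for the transposed matrix) and `lower_left` are two linear
equations for a T_N(k,l) and b T_N(k,l-1). By `gnum_add` their determinant is minus the square of
`gnum q (N + 1)`, so they can be solved. -/
theorem a_mul_qT (N : ℕ) (hN : gnum q (N + 1) ≠ 0) (k l : ℤ) :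
    a * qT q a b c d N k l =
      (q ^ (k + l) * gnum q (N + 1 - k) * gnum q (N + 1 - l) / gnum q (N + 1) ^ 2) •
        qT q a b c d (N + 1) k l +
      (gnum q N / gnum q (N + 1)) • qT q a b c d (N - 1) (k - 1) (l - 1) := by
  have h1 := ((colRel hq h.swap N) l k).1
  have h2 := lower_left hq h N k l
  have e := gnum_add hq (N + 1 - l) l
  have e' : (N : ℤ) - k + 1 = N + 1 - k := by ring
  simp only [qT_swap q a b c d, e', sub_add_cancel] at h1 e
  rw [← sub_eq_iff_eq_add] at e
  rw [← e] at h2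
  rw [zpow_add₀ hq]
  linear_combination (norm := skip)
    (q ^ l * gnum q (N + 1 - l) / gnum q (N + 1) ^ 2) • h1 + (gnum q (N + 1))⁻¹ • h2
  match_scalars <;> field_simp <;> ring

theorem b_mul_qT (N : ℕ) (hN : gnum q (N + 1) ≠ 0) (k l : ℤ) :
    b * qT q a b c d N k (l - 1) =
      (q ^ k * gnum q (N + 1 - k) * gnum q l / gnum q (N + 1) ^ 2) •
        qT q a b c d (N + 1) k l -
      (q ^ l * gnum q N / gnum q (N + 1)) • qT q a b c d (N - 1) (k - 1) (l - 1) := by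
  have h1 := ((colRel hq h.swap N) l k).1
  have h2 := lower_left hq h N k l
  have e := gnum_add hq (N + 1 - l) l
  have e' : (N : ℤ) - k + 1 = N + 1 - k := by ring
  simp only [qT_swap q a b c d, e', sub_add_cancel] at h1 e
  rw [← sub_eq_iff_eq_add] at e
  rw [← e] at h2 ⊢
  linear_combination (norm := skip)
    ((gnum q (N + 1) - (q ^ l) ^ 2 * gnum q (N + 1 - l)) / gnum q (N + 1) ^ 2) • h1 -
      (q ^ l / gnum q (N + 1)) • h2
  match_scalars <;> field_simp <;> ring

theorem c_mul_qT (N : ℕ) (hN : gnum q (N + 1) ≠ 0) (k l : ℤ) :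
    c * qT q a b c d N (k - 1) l =
      (q ^ l * gnum q k * gnum q (N + 1 - l) / gnum q (N + 1) ^ 2) •
        qT q a b c d (N + 1) k l -
      (q ^ k * gnum q N / gnum q (N + 1)) • qT q a b c d (N - 1) (k - 1) (l - 1) := by
  have := b_mul_qT hq h.swap N hN l k
  simp only [qT_swap q a b c d] at this
  rw [this, mul_right_comm]

theorem d_mul_qT (N : ℕ) (hN : gnum q (N + 1) ≠ 0) (k l : ℤ) :
    d * qT q a b c d N (k - 1) (l - 1) =
      (gnum q k * gnum q l / gnum q (N + 1) ^ 2) • qT q a b c d (N + 1) k l +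
      (q ^ (k + l) * gnum q N / gnum q (N + 1)) • qT q a b c d (N - 1) (k - 1) (l - 1) := by
  have h1 := ((colRel hq h.swap N) l k).2
  have h2 := lower_right hq h N k l
  have e := gnum_add hq (N + 1 - l) l
  simp only [qT_swap q a b c d, sub_add_cancel] at h1 e
  rw [← sub_eq_iff_eq_add] at e
  rw [← e] at h2 ⊢
  rw [zpow_add₀ hq]
  linear_combination (norm := skip)
    ((gnum q (N + 1) - (q ^ l) ^ 2 * gnum q (N + 1 - l)) / gnum q (N + 1) ^ 2) • h1 -
      (q ^ l / gnum q (N + 1)) • h2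
  match_scalars <;> field_simp <;> ring

end LeftMul

end Abstract

/-! ### The matrix elements of `SU_q(2)` -/

theorem qMat_generators {q : ℝ} (hq : q ≠ 0) :
    QMat (q : ℂ) (α q) ((q : ℂ) • star (β q)) (-β q) (star (α q)) := by
  have r := rel_generators q
  have hq' : (q : ℂ) ≠ 0 := by exact_mod_cast hq
  have h1 := sub_eq_zero.mp r.comm
  have h2 := sub_eq_zero.mp r.comm_star
  have h3 := congrArg star h1
  have h4 := congrArg star h2
  simp only [star_mul, star_smul, star_star, Complex.star_def, Complex.conj_ofReal] at h3 h4
  constructor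
  · simp [h2]
  · simp [h1]
  · simp [h3]
  · simp [h4]
  · simp [r.normal]
  · rw [← r.mul_star_add, ← r.normal, smul_mul_assoc, mul_neg, smul_neg, smul_neg, smul_smul, ← sq,
      add_neg_cancel_right]
  · rw [← r.star_mul_add]; simp [r.normal]

theorem matElt_eq_qT (q : ℝ) (N : ℕ) (k l : ℤ) : matElt q N k l =
    qT (q : ℂ) (α q) ((q : ℂ) • star (β q)) (-β q) (star (α q)) N k l := by
  induction N generalizing k l with
  | zero => rfl
  | succ N ih => simp only [matElt, qT, ih]

/-- The adjoint reverses products. It therefore turns the recursion at the last tensor factor into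
the recursion at the first one, with the two basis letters exchanged. -/
theorem star_matElt {q : ℝ} (hq : q ≠ 0) (N : ℕ) (k l : ℤ) :
    star (matElt q N k l) = (-q : ℂ) ^ (l - k) • matElt q N (N - k) (N - l) := by
  have hq' : (q : ℂ) ≠ 0 := by exact_mod_cast hq
  have hq'' : -(q : ℂ) ≠ 0 := neg_ne_zero.mpr hq'
  induction N generalizing k l with
  | zero =>
    simp only [matElt]
    by_cases hk : k = 0 <;> by_cases hl : l = 0 <;> simp_all
  | succ N ih =>
    have hs (m : ℤ) : star ((q : ℂ) ^ m) = (q : ℂ) ^ m := by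
      rw [← Complex.ofReal_zpow, Complex.star_def, Complex.conj_ofReal]
    have hR := qT_succ_right hq' (α q) ((q : ℂ) • star (β q)) (-β q) (star (α q)) N k l
    simp only [← matElt_eq_qT] at hR
    have e1 : ((N + 1 : ℕ) : ℤ) - k = N - (k - 1) := by push_cast; ring
    have e2 : ((N + 1 : ℕ) : ℤ) - l = N - (l - 1) := by push_cast; ring
    have e3 : (N : ℤ) - (k - 1) - 1 = N - k := by ring
    have e4 : (N : ℤ) - (l - 1) - 1 = N - l := by ring
    have e5 : l - (k - 1) = l - k + 1 := by ring
    have e6 : l - 1 - k = l - k - 1 := by ring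
    have e7 : l - 1 - (k - 1) = l - k := by ring
    rw [hR, matElt, e1, e2, e3, e4]
    simp only [star_add, star_mul, star_smul, hs, ih, star_neg, star_star, Complex.star_def, e5, e6,
      e7, neg_mul, zpow_add_one₀ hq'', zpow_sub_one₀ hq'', mul_smul_comm, smul_mul_assoc,
      Complex.conj_ofReal]
    have e8 : (N : ℤ) + 1 - l = N - (l - 1) := by ring
    have e9 : (N : ℤ) + 1 - k = N - (k - 1) := by ring
    have e10 : 2 * (N : ℤ) + 2 - k - l = N - (k - 1) + (N - (l - 1)) := by ring
    rw [e8, e9, e10]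
    match_scalars <;> field_simp

theorem ofReal_gnum (q : ℝ) (m : ℤ) : ((gnum q m : ℝ) : ℂ) = gnum (q : ℂ) m := by
  simp [gnum]

theorem gnum_zero {F : Type*} [Field F] (q : F) : gnum q 0 = 0 := by simp [gnum]

theorem gnum_nonneg (q : Set.Ioo (0 : ℝ) 1) {m : ℤ} (hm : 0 ≤ m) : 0 ≤ gnum (q : ℝ) m := by
  have h1 : (q : ℝ) ^ m ≤ 1 := zpow_le_one₀ q.2.1 q.2.2.le hm
  have h2 : 0 < (q : ℝ) ^ m := zpow_pos q.2.1 m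
  rw [gnum]; nlinarith

theorem gnum_pos (q : Set.Ioo (0 : ℝ) 1) {m : ℤ} (hm : 0 < m) : 0 < gnum (q : ℝ) m := by
  have h1 : (q : ℝ) ^ m < 1 := zpow_lt_one₀ q.2.1 q.2.2 hm
  have h2 : 0 < (q : ℝ) ^ m := zpow_pos q.2.1 m
  rw [gnum]; nlinarith

/-! ### Left multiplication by the generators -/

section LeftMul

variable (q : Set.Ioo (0 : ℝ) 1) (N : ℕ) (k l : ℤ)

theorem gnum_succ_ne_zero : gnum ((q : ℝ) : ℂ) (N + 1) ≠ 0 := by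
  rw [← ofReal_gnum]
  exact_mod_cast (gnum_pos q (by positivity)).ne'

theorem α_mul_matElt : α (q : ℝ) * matElt q N k l =
    (((q : ℝ) ^ (k + l) * gnum (q : ℝ) (N + 1 - k) * gnum (q : ℝ) (N + 1 - l) /
      gnum (q : ℝ) (N + 1) ^ 2 : ℝ) : ℂ) • matElt q (N + 1) k l +
    ((gnum (q : ℝ) N / gnum (q : ℝ) (N + 1) : ℝ) : ℂ) • matElt q (N - 1) (k - 1) (l - 1) := by
  simp only [matElt_eq_qT]
  rw [a_mul_qT (by exact_mod_cast q.2.1.ne') (qMat_generators q.2.1.ne') N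
    (gnum_succ_ne_zero q N)]
  simp [ofReal_gnum]

theorem star_α_mul_matElt : star (α (q : ℝ)) * matElt q N k l =
    ((gnum (q : ℝ) (k + 1) * gnum (q : ℝ) (l + 1) /
      gnum (q : ℝ) (N + 1) ^ 2 : ℝ) : ℂ) • matElt q (N + 1) (k + 1) (l + 1) +
    (((q : ℝ) ^ (k + l + 2) * gnum (q : ℝ) N / gnum (q : ℝ) (N + 1) : ℝ) : ℂ) •
      matElt q (N - 1) k l := by
  have := d_mul_qT (by exact_mod_cast q.2.1.ne') (qMat_generators q.2.1.ne') N
    (gnum_succ_ne_zero q N) (k + 1) (l + 1)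
  simp only [matElt_eq_qT]
  rw [add_sub_cancel_right, add_sub_cancel_right] at this
  rw [this, show k + 1 + (l + 1) = k + l + 2 by ring]
  simp [ofReal_gnum]

theorem neg_β_mul_matElt : -β (q : ℝ) * matElt q N k l =
    (((q : ℝ) ^ l * gnum (q : ℝ) (k + 1) * gnum (q : ℝ) (N + 1 - l) /
      gnum (q : ℝ) (N + 1) ^ 2 : ℝ) : ℂ) • matElt q (N + 1) (k + 1) l -
    (((q : ℝ) ^ (k + 1) * gnum (q : ℝ) N / gnum (q : ℝ) (N + 1) : ℝ) : ℂ) •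
      matElt q (N - 1) k (l - 1) := by
  have := c_mul_qT (by exact_mod_cast q.2.1.ne') (qMat_generators q.2.1.ne') N
    (gnum_succ_ne_zero q N) (k + 1) l
  simp only [matElt_eq_qT]
  rw [add_sub_cancel_right] at this
  rw [this]
  simp [ofReal_gnum]

theorem smul_star_β_mul_matElt : (((q : ℝ) : ℂ) • star (β (q : ℝ))) * matElt q N k l =
    (((q : ℝ) ^ k * gnum (q : ℝ) (N + 1 - k) * gnum (q : ℝ) (l + 1) /
      gnum (q : ℝ) (N + 1) ^ 2 : ℝ) : ℂ) • matElt q (N + 1) k (l + 1) -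
    (((q : ℝ) ^ (l + 1) * gnum (q : ℝ) N / gnum (q : ℝ) (N + 1) : ℝ) : ℂ) •
      matElt q (N - 1) (k - 1) l := by
  have := b_mul_qT (by exact_mod_cast q.2.1.ne') (qMat_generators q.2.1.ne') N
    (gnum_succ_ne_zero q N) k (l + 1)
  simp only [matElt_eq_qT]
  rw [add_sub_cancel_right] at this
  rw [this]
  simp [ofReal_gnum]

end LeftMul

/-! ### The Haar state on matrix elements -/

section Haar

variable (q : Set.Ioo (0 : ℝ) 1)

theorem π₀_α : π₀ q (α q) = a₀ q := rfl
theorem π₀_β : π₀ q (β q) = b₀ q := rfl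

theorem a₀_δ_zero : a₀ q (δ 0) = 0 := by
  refine lp.ext <| funext fun ⟨n, k⟩ => ?_
  rw [a₀_apply]; simp [δ]

theorem a₀_δ_succ (m : ℕ) : a₀ q (δ (m + 1)) = ((√(1 - (q : ℝ) ^ (2 * (m + 1))) : ℝ) : ℂ) • δ m := by
  refine lp.ext <| funext fun ⟨n, k⟩ => ?_
  rw [a₀_apply, lp.coeFn_smul, Pi.smul_apply, smul_eq_mul]
  by_cases h : (n, k) = (m, 0)
  · obtain ⟨rfl, rfl⟩ := Prod.mk.inj h; simp [δ]
  · have h' : (n + 1, k) ≠ (m + 1, 0) := by simpa using h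
    simp only [δ, lp.single_apply_ne _ _ _ h, lp.single_apply_ne _ _ _ h', mul_zero]

theorem star_a₀_δ (m : ℕ) : star (a₀ q) (δ m) = ((√(1 - (q : ℝ) ^ (2 * (m + 1))) : ℝ) : ℂ) • δ (m + 1) := by
  refine lp.ext <| funext fun ⟨n, k⟩ => ?_
  rw [lp.coeFn_smul, Pi.smul_apply, smul_eq_mul]
  rcases n with _ | n
  · rw [star_a₀_apply_zero]; simp [δ]
  rw [star_a₀_apply_succ]
  by_cases h : (n, k) = (m, 0)
  · obtain ⟨rfl, rfl⟩ := Prod.mk.inj h; simp [δ]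
  · have h' : (n + 1, k) ≠ (m + 1, 0) := by simpa using h
    simp only [δ, lp.single_apply_ne _ _ _ h, lp.single_apply_ne _ _ _ h', mul_zero]

/-- The modular property of the Haar state with respect to `α`. -/
theorem haarLin_mul_α (x : Alg (q : ℝ)) :
    haarLin q (x * α q) = ((q : ℝ) : ℂ) ^ 2 * haarLin q (α q * x) := by
  change (1 - ((q : ℝ) : ℂ) ^ 2) * (∑' n : ℕ, _) = _ * ((1 - ((q : ℝ) : ℂ) ^ 2) * (∑' n : ℕ, _))
  -- The term n = 0 on the left vanishes since `a₀` annihilates `δ 0`. Shifting the index of the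
  -- remaining terms by one produces the factor q².
  rw [mul_left_comm, ← tsum_mul_left (a := ((q : ℝ) : ℂ) ^ 2), (haar_summable q _).tsum_eq_zero_add]
  congr 1
  rw [map_mul, map_mul, π₀_α]
  change _ * ⟪δ 0, π₀ q x (a₀ q (δ 0))⟫_ℂ + _ = _
  rw [a₀_δ_zero, map_zero, inner_zero_right, mul_zero, zero_add]
  refine tsum_congr fun n => ?_
  change _ * ⟪δ (n + 1), π₀ q x (a₀ q (δ (n + 1)))⟫_ℂ = _ * (_ * ⟪δ n, a₀ q (π₀ q x (δ n))⟫_ℂ)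
  rw [← ContinuousLinearMap.adjoint_inner_left (a₀ q), ← ContinuousLinearMap.star_eq_adjoint, a₀_δ_succ,
    star_a₀_δ, map_smul, inner_smul_left, inner_smul_right, Complex.conj_ofReal]
  push_cast
  ring

/-- Grading of π₀: α preserves the ℤ-coordinate, β raises it and β* lowers it by one, so T_N(k,l)
shifts it by k - l. -/
theorem π₀_matElt_apply_eq_zero (N : ℕ) (k l m : ℤ) (x : K)
    (hx : ∀ n j, j ≠ m → x (n, j) = 0) (n : ℕ) (j : ℤ) (hj : j ≠ m + k - l) :
    π₀ q (matElt q N k l) x (n, j) = 0 := by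
  induction N generalizing k l n j with
  | zero =>
    rw [matElt]
    split_ifs with h
    · rw [map_one]; exact hx n j (by omega)
    · rw [map_zero]; rfl
  | succ N ih =>
    have h1 := ih k l (n + 1) j hj
    have h2 := ih k (l - 1) n (j + 1) (by omega)
    have h3 := ih (k - 1) l n (j - 1) (by omega)
    have h4 := fun n => ih (k - 1) (l - 1) n j (by omega)
    rw [matElt]
    simp only [map_add, map_smul, map_mul, map_neg, map_star, π₀_α, π₀_β]
    change _ * a₀ q (π₀ q (matElt q N k l) x) (n, j) +
      _ * (_ * star (b₀ q) (π₀ q (matElt q N k (l - 1)) x) (n, j)) +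
      _ * -(b₀ q (π₀ q (matElt q N (k - 1) l) x) (n, j)) +
      star (a₀ q) (π₀ q (matElt q N (k - 1) (l - 1)) x) (n, j) = 0
    have h5 : star (a₀ q) (π₀ q (matElt q N (k - 1) (l - 1)) x) (n, j) = 0 := by
      rcases n with _ | n
      · exact star_a₀_apply_zero q _ _
      · rw [star_a₀_apply_succ, h4, mul_zero]
    rw [a₀_apply, star_b₀_apply, b₀_apply, h1, h2, h3, h5]
    simp

theorem haarLin_matElt_of_ne (N : ℕ) {k l : ℤ} (h : k ≠ l) : haarLin q (matElt q N k l) = 0 := by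
  change _ * (∑' n : ℕ, _) = (0 : ℂ)
  rw [tsum_congr (g := fun _ => 0), tsum_zero, mul_zero]
  intro n
  rw [δ, lp.inner_single_left]
  have := π₀_matElt_apply_eq_zero q N k l 0 (lp.single 2 (n, 0) 1)
    (fun n' j hj => lp.single_apply_ne _ _ _ (by simp [hj])) n 0 (by omega)
  rw [this]; simp

theorem haarLin_star (x : Alg (q : ℝ)) : haarLin q (star x) = star (haarLin q x) :=
  map_star (haar q) x

/-- Right multiplication by α is the adjoint of left multiplication by α*, and the adjoint of a
diagonal matrix element is again a diagonal one. -/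
theorem matElt_mul_α (N : ℕ) (k : ℤ) : matElt q N k k * α (q : ℝ) =
    ((gnum (q : ℝ) (N + 1 - k) * gnum (q : ℝ) (N + 1 - k) /
      gnum (q : ℝ) (N + 1) ^ 2 : ℝ) : ℂ) • matElt q (N + 1) k k +
    (((q : ℝ) ^ (2 * (N + 1 - k)) * gnum (q : ℝ) N / gnum (q : ℝ) (N + 1) : ℝ) : ℂ) •
      matElt q (N - 1) (k - 1) (k - 1) := by
  have h1 := congrArg star (star_α_mul_matElt q N (N - k) (N - k))
  have h2 (M : ℕ) (m : ℤ) : star (matElt q M m m) = matElt q M (M - m) (M - m) := by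
    rw [star_matElt q.2.1.ne', sub_self, zpow_zero, one_smul]
  simp only [star_mul, star_add, star_smul, star_star, h2, Complex.star_def,
    Complex.conj_ofReal] at h1
  rw [sub_sub_cancel, show (N : ℤ) - k + 1 = N + 1 - k by ring,
    show (N : ℤ) - k + (N - k) + 2 = 2 * (N + 1 - k) by ring,
    show ((N + 1 : ℕ) : ℤ) - (N + 1 - k) = k by push_cast; ring] at h1
  rw [h1]
  rcases N with _ | N
  · simp [gnum_zero]
  · rw [show ((N + 1 - 1 : ℕ) : ℤ) - ((N + 1 : ℕ) - k) = k - 1 by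
      push_cast [Nat.add_sub_cancel]; ring]

/-- For k ≠ l the grading of π₀ suffices. For k = l both sides of h(Tα) = q² h(αT), with T =
T_N(k,k), are expanded in T_{N+1}(k,k) and T_{N-1}(k-1,k-1). The lower terms drop out and the
coefficient of the upper one is nonzero for 0 ≤ k ≤ N. -/
theorem haarLin_matElt_succ (N : ℕ) (k l : ℤ) : haarLin q (matElt q (N + 1) k l) = 0 := by
  have hq0 : (q : ℝ) ≠ 0 := q.2.1.ne'
  by_cases hkl : k = l
  swap
  · exact haarLin_matElt_of_ne q _ hkl
  subst hkl
  by_cases hr : 0 ≤ k ∧ k ≤ N + 1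
  swap
  · rw [matElt_eq_qT, qT_eq_zero _ _ _ _ _ _ _ _ (by push_cast; tauto), map_zero]
  have main : ∀ N : ℕ, ∀ k : ℤ, 0 ≤ k → k ≤ N → haarLin q (matElt q (N + 1) k k) = 0 := by
    intro N
    induction N using Nat.strong_induction_on with
    | _ N ih =>
    intro k hk hkN
    have h1 := haarLin_mul_α q (matElt q N k k)
    rw [matElt_mul_α, α_mul_matElt] at h1
    simp only [map_add, map_smul, smul_eq_mul] at h1
    -- The lower term contributes nothing: its Haar value is zero by induction, its label is out of
    -- range, or its scalar factor is zero. The last case covers k = N, where 2(N + 1 - k) = 2, and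
    -- also N = 0.
    have h0 : ((((q : ℝ) ^ (2 * (N + 1 - k)) - (q : ℝ) ^ 2) * (gnum (q : ℝ) N / gnum (q : ℝ) (N + 1)) : ℝ) : ℂ) *
        haarLin q (matElt q (N - 1) (k - 1) (k - 1)) = 0 := by
      rcases N with _ | _ | N
      · simp [gnum_zero]
      · by_cases hk1 : k = 1
        · subst hk1; simp
        · rw [matElt_eq_qT, qT_eq_zero _ _ _ _ _ _ _ _ (by push_cast; omega)]; simp
      · by_cases hk' : 0 ≤ k - 1 ∧ k - 1 ≤ N
        · rw [show N + 1 + 1 - 1 = N + 1 from rfl, ih N (by omega) _ hk'.1 hk'.2, mul_zero]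
        · by_cases hk'' : k = 0
          · rw [matElt_eq_qT, qT_eq_zero _ _ _ _ _ _ _ _ (by push_cast; omega)]; simp
          · have hk3 : k = N + 2 := by push_cast at hkN; omega
            subst hk3
            simp [show (N : ℤ) + 1 + 1 + 1 - (N + 2) = 1 by ring]
    have h2 : (((1 - (q : ℝ) ^ 2 * (q : ℝ) ^ (k + k)) * (gnum (q : ℝ) (N + 1 - k) * gnum (q : ℝ) (N + 1 - k) /
      gnum (q : ℝ) (N + 1) ^ 2) : ℝ) : ℂ) * haarLin q (matElt q (N + 1) k k) = 0 := by
      push_cast at *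
      linear_combination h1 - h0
    refine (mul_eq_zero.mp h2).resolve_left ?_
    have hlt : (q : ℝ) ^ (2 : ℕ) * (q : ℝ) ^ (k + k) < 1 := by
      rw [← zpow_natCast, ← zpow_add₀ hq0]
      exact zpow_lt_one₀ q.2.1 q.2.2 (by push_cast; omega)
    have g1 := gnum_pos q (m := N + 1 - k) (by omega)
    have g2 := gnum_pos q (m := N + 1) (by omega)
    have : (0 : ℝ) < (1 - (q : ℝ) ^ 2 * (q : ℝ) ^ (k + k)) * (gnum (q : ℝ) (N + 1 - k) * gnum (q : ℝ) (N + 1 - k) /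
      gnum (q : ℝ) (N + 1) ^ 2) := mul_pos (by linarith) (by positivity)
    exact_mod_cast this.ne'
  rcases hr.2.lt_or_eq with hk | hk
  · exact main N k hr.1 (by omega)
  -- The top label k = N + 1, where the coefficient above degenerates, is the adjoint of the label
  -- 0.
  · have h3 := haarLin_star q (matElt q (N + 1) 0 0)
    rw [main N 0 le_rfl (by positivity), star_matElt q.2.1.ne'] at h3
    subst hk
    simpa using h3

theorem haarLin_one : haarLin q 1 = 1 := by
  change (1 - ((q : ℝ) : ℂ) ^ 2) * (∑' n : ℕ, _) = _
  have h : ∀ n : ℕ, (((q : ℝ) ^ (2 * n) : ℝ) : ℂ) * ⟪δ n, π₀ q 1 (δ n)⟫_ℂ =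
      (((q : ℝ) : ℂ) ^ 2) ^ n := by
    intro n
    rw [map_one]
    change _ * ⟪δ n, δ n⟫_ℂ = _
    rw [δ, lp.inner_single_left]
    simp [pow_mul]
  have hlt : (q : ℝ) ^ 2 < 1 := pow_lt_one₀ q.2.1.le q.2.2 two_ne_zero
  rw [tsum_congr h, tsum_geometric_of_norm_lt_one, mul_inv_cancel₀]
  · rw [sub_ne_zero]; exact_mod_cast hlt.ne'
  · rw [← Complex.ofReal_pow, Complex.norm_real, Real.norm_eq_abs, abs_of_nonneg (by positivity)]
    exact hlt

end Haar

/-! ### Orthogonality of the matrix elements -/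

section Orthogonality

variable (q : Set.Ioo (0 : ℝ) 1)

theorem inner_toL2 (x y : Alg (q : ℝ)) : ⟪toL2 q x, toL2 q y⟫_ℂ = haarLin q (star x * y) :=
  (UniformSpace.Completion.inner_coe _ _).trans ((haar q).preGNS_inner_def _ _)

theorem toL2_add (x y : Alg (q : ℝ)) : toL2 q (x + y) = toL2 q x + toL2 q y := by
  simp [toL2, UniformSpace.Completion.coe_add]

theorem toL2_smul (c : ℂ) (x : Alg (q : ℝ)) : toL2 q (c • x) = c • toL2 q x := by
  simp [toL2, UniformSpace.Completion.coe_smul]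

/-- The linear map `a ↦ a Ω`. -/
def toL2Lin : Alg (q : ℝ) →ₗ[ℂ] L2 q where
  toFun := toL2 q
  map_add' := toL2_add q
  map_smul' := toL2_smul q

theorem toL2_zero : toL2 q 0 = 0 := map_zero (toL2Lin q)
theorem toL2_sub (x y : Alg (q : ℝ)) : toL2 q (x - y) = toL2 q x - toL2 q y :=
  map_sub (toL2Lin q) x y

theorem leftReg_toL2 (x y : Alg (q : ℝ)) : leftReg q x (toL2 q y) = toL2 q (x * y) :=
  (haar q).gnsNonUnitalStarAlgHom_apply_coe

/-- The vector `t Ω` of a matrix element `t`. -/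
def matVec (N : ℕ) (k l : ℤ) : L2 q := toL2 q (matElt q N k l)

theorem matVec_eq_zero (N : ℕ) (k l : ℤ) (h : ¬ ((0 ≤ k ∧ k ≤ N) ∧ (0 ≤ l ∧ l ≤ N))) :
    matVec q N k l = 0 := by
  rw [matVec, matElt_eq_qT, qT_eq_zero _ _ _ _ _ _ _ _ h, toL2_zero]

theorem inner_leftReg (x : Alg (q : ℝ)) (y z : L2 q) :
    ⟪y, leftReg q x z⟫_ℂ = ⟪leftReg q (star x) y, z⟫_ℂ := by
  rw [map_star, ContinuousLinearMap.star_eq_adjoint, ContinuousLinearMap.adjoint_inner_left]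

section

variable (N : ℕ) (k l : ℤ)

theorem α_matVec : leftReg q (α (q : ℝ)) (matVec q N k l) =
    (((q : ℝ) ^ (k + l) * gnum (q : ℝ) (N + 1 - k) * gnum (q : ℝ) (N + 1 - l) /
      gnum (q : ℝ) (N + 1) ^ 2 : ℝ) : ℂ) • matVec q (N + 1) k l +
    ((gnum (q : ℝ) N / gnum (q : ℝ) (N + 1) : ℝ) : ℂ) • matVec q (N - 1) (k - 1) (l - 1) := by
  rw [matVec, leftReg_toL2, α_mul_matElt, toL2_add, toL2_smul, toL2_smul]; rfl

theorem star_α_matVec : leftReg q (star (α (q : ℝ))) (matVec q N k l) =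
    ((gnum (q : ℝ) (k + 1) * gnum (q : ℝ) (l + 1) /
      gnum (q : ℝ) (N + 1) ^ 2 : ℝ) : ℂ) • matVec q (N + 1) (k + 1) (l + 1) +
    (((q : ℝ) ^ (k + l + 2) * gnum (q : ℝ) N / gnum (q : ℝ) (N + 1) : ℝ) : ℂ) •
      matVec q (N - 1) k l := by
  rw [matVec, leftReg_toL2, star_α_mul_matElt, toL2_add, toL2_smul, toL2_smul]; rfl

theorem neg_β_matVec : leftReg q (-β (q : ℝ)) (matVec q N k l) =
    (((q : ℝ) ^ l * gnum (q : ℝ) (k + 1) * gnum (q : ℝ) (N + 1 - l) /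
      gnum (q : ℝ) (N + 1) ^ 2 : ℝ) : ℂ) • matVec q (N + 1) (k + 1) l -
    (((q : ℝ) ^ (k + 1) * gnum (q : ℝ) N / gnum (q : ℝ) (N + 1) : ℝ) : ℂ) •
      matVec q (N - 1) k (l - 1) := by
  rw [matVec, leftReg_toL2, neg_β_mul_matElt, toL2_sub, toL2_smul, toL2_smul]; rfl

theorem star_β_matVec : leftReg q (star (β (q : ℝ))) (matVec q N k l) =
    (((q : ℝ)⁻¹ * ((q : ℝ) ^ k * gnum (q : ℝ) (N + 1 - k) * gnum (q : ℝ) (l + 1) /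
      gnum (q : ℝ) (N + 1) ^ 2) : ℝ) : ℂ) • matVec q (N + 1) k (l + 1) -
    (((q : ℝ)⁻¹ * ((q : ℝ) ^ (l + 1) * gnum (q : ℝ) N / gnum (q : ℝ) (N + 1)) : ℝ) : ℂ) •
      matVec q (N - 1) (k - 1) l := by
  have h := congrArg (fun x => (((q : ℝ)⁻¹ : ℝ) : ℂ) • toL2 q x) (smul_star_β_mul_matElt q N k l)
  have hq : ((q : ℝ) : ℂ) ≠ 0 := by exact_mod_cast q.2.1.ne'
  simp only [smul_mul_assoc, toL2_smul, toL2_sub, smul_sub, smul_smul, ← Complex.ofReal_mul] at h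
  rw [inv_mul_cancel₀ q.2.1.ne', Complex.ofReal_one, one_smul] at h
  rw [matVec, leftReg_toL2, h]; rfl

theorem matVec_succ : matVec q (N + 1) k l =
    (((q : ℝ) : ℂ) ^ (k + l)) • leftReg q (α q) (matVec q N k l) +
    (((q : ℝ) : ℂ) ^ k * (q : ℝ)) • leftReg q (star (β q)) (matVec q N k (l - 1)) +
    (((q : ℝ) : ℂ) ^ l) • leftReg q (-β q) (matVec q N (k - 1) l) +
    leftReg q (star (α q)) (matVec q N (k - 1) (l - 1)) := by
  simp only [matVec, leftReg_toL2, matElt, toL2_add, toL2_smul, smul_mul_assoc, smul_smul]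

end

/-- Induction on the smaller spin: the vector of spin N' + 1 is a sum of generators applied to
vectors of spin N'. Moved to the other side, each generator changes the larger spin by one, so it
stays at least N', and the label shifts match so that distinct labels stay distinct. The base case
is the vanishing of the Haar state on nontrivial matrix elements. -/
theorem inner_matVec_of_le (N' N : ℕ) (k l k' l' : ℤ) (hN : N' ≤ N)
    (hne : ¬ (N = N' ∧ k = k' ∧ l = l')) : ⟪matVec q N k l, matVec q N' k' l'⟫_ℂ = 0 := by
  induction N' generalizing N k l k' l' with
  | zero =>
    by_cases h0 : k' = 0 ∧ l' = 0
    · obtain ⟨rfl, rfl⟩ := h0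
      rcases N with _ | N
      · rw [matVec_eq_zero q 0 k l (by push_cast; omega), inner_zero_left]
      · rw [← inner_conj_symm, matVec, matVec, inner_toL2]
        have : star (matElt q 0 0 0) * matElt q (N + 1) k l = matElt q (N + 1) k l := by
          rw [show matElt q 0 0 0 = 1 from if_pos ⟨rfl, rfl⟩, star_one, one_mul]
        rw [this, haarLin_matElt_succ, map_zero]
    · rw [matVec_eq_zero q 0 k' l' (by push_cast; omega), inner_zero_right]
  | succ N' ih =>
    obtain ⟨M, rfl⟩ : ∃ M, N = M + 1 := ⟨N - 1, by omega⟩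
    rw [matVec_succ q N' k' l']
    simp only [inner_add_right, inner_smul_right, inner_leftReg, star_star, star_neg]
    simp only [map_neg, star_α_matVec, α_matVec, star_β_matVec, neg_apply]
    have hβ := neg_β_matVec q (M + 1) k l
    rw [map_neg, neg_apply, neg_eq_iff_eq_neg] at hβ
    simp only [hβ, inner_neg_left, inner_add_left, inner_sub_left, inner_smul_left,
      Nat.add_sub_cancel]
    rw [ih (M + 1 + 1) _ _ _ _ (by omega) (by omega), ih (M + 1 + 1) _ _ _ _ (by omega) (by omega),
      ih (M + 1 + 1) _ _ _ _ (by omega) (by omega), ih (M + 1 + 1) _ _ _ _ (by omega) (by omega),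
      ih M _ _ _ _ (by omega) (by omega), ih M _ _ _ _ (by omega) (by omega),
      ih M _ _ _ _ (by omega) (by omega), ih M _ _ _ _ (by omega) (by omega)]
    simp

theorem inner_matVec {N N' : ℕ} {k l k' l' : ℤ}
    (hne : ¬ (N = N' ∧ k = k' ∧ l = l')) : ⟪matVec q N k l, matVec q N' k' l'⟫_ℂ = 0 := by
  rcases le_total N' N with h | h
  · exact inner_matVec_of_le q N' N k l k' l' h hne
  · rw [← inner_conj_symm, inner_matVec_of_le q N N' k' l' k l h (by tauto), map_zero]

theorem inner_matVec_self (N : ℕ) (k l : ℤ) :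
    ⟪matVec q N k l, matVec q N k l⟫_ℂ = ((‖matVec q N k l‖ ^ 2 : ℝ) : ℂ) := by
  rw [inner_self_eq_norm_sq_to_K]; norm_cast

/-! ### Recursions for the norms of the matrix elements -/

section Norms

variable (N : ℕ) (k l : ℤ)

/-- Both sides compute ⟪z, x y⟫ = ⟪x* z, y⟫; the remainders `y₁`, `z₁` are orthogonal and drop out.
Applied to a generator and its adjoint, this gives the ratio of the norms at consecutive spins. -/
theorem norm_sq_relation {x : Alg (q : ℝ)} {y z y₁ z₁ : L2 q} {A B : ℝ}
    (h1 : leftReg q x y = (A : ℂ) • z + y₁) (h2 : leftReg q (star x) z = (B : ℂ) • y + z₁)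
    (h3 : ⟪z, y₁⟫_ℂ = 0) (h4 : ⟪z₁, y⟫_ℂ = 0) :
    A * ‖z‖ ^ 2 = B * ‖y‖ ^ 2 := by
  have h := inner_leftReg q x z y
  rw [h1, h2, inner_add_left, inner_add_right, h3, h4, inner_smul_left, inner_smul_right,
    inner_self_eq_norm_sq_to_K, inner_self_eq_norm_sq_to_K, Complex.conj_ofReal] at h
  simp only [add_zero] at h
  have h' : (A : ℂ) * (‖z‖ : ℂ) ^ 2 = B * (‖y‖ : ℂ) ^ 2 := h
  exact_mod_cast h'

theorem norm_relation_α :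
    (q : ℝ) ^ (k + l) * gnum (q : ℝ) (N + 1 - k) * gnum (q : ℝ) (N + 1 - l) /
      gnum (q : ℝ) (N + 1) ^ 2 * ‖matVec q (N + 1) k l‖ ^ 2 =
    (q : ℝ) ^ (k + l + 2) * gnum (q : ℝ) (N + 1) / gnum (q : ℝ) (N + 2) *
      ‖matVec q N k l‖ ^ 2 := by
  have h2 := (star_α_matVec q (N + 1) k l).trans (add_comm _ _)
  rw [Nat.add_sub_cancel] at h2
  have := norm_sq_relation q (α_matVec q N k l) h2
    (by rw [inner_smul_right, inner_matVec, mul_zero]; omega)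
    (by rw [inner_smul_left, inner_matVec, mul_zero]; omega)
  rw [this]; push_cast; ring_nf

theorem norm_relation_star_α :
    gnum (q : ℝ) (k + 1) * gnum (q : ℝ) (l + 1) /
      gnum (q : ℝ) (N + 1) ^ 2 * ‖matVec q (N + 1) (k + 1) (l + 1)‖ ^ 2 =
    gnum (q : ℝ) (N + 1) / gnum (q : ℝ) (N + 2) * ‖matVec q N k l‖ ^ 2 := by
  have h2 := (α_matVec q (N + 1) (k + 1) (l + 1)).trans (add_comm _ _)
  rw [Nat.add_sub_cancel, add_sub_cancel_right, add_sub_cancel_right,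
    ← star_star (α (q : ℝ))] at h2
  have := norm_sq_relation q (star_α_matVec q N k l) h2
    (by rw [inner_smul_right, inner_matVec, mul_zero]; omega)
    (by rw [inner_smul_left, inner_matVec, mul_zero]; omega)
  rw [this]; push_cast; ring_nf

theorem norm_relation_neg_β :
    gnum (q : ℝ) (k + 1) * gnum (q : ℝ) (N + 1 - l) /
      gnum (q : ℝ) (N + 1) ^ 2 * ‖matVec q (N + 1) (k + 1) l‖ ^ 2 =
    gnum (q : ℝ) (N + 1) / gnum (q : ℝ) (N + 2) * ‖matVec q N k l‖ ^ 2 := by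
  have h1 := neg_β_matVec q N k l
  have h2 := congrArg Neg.neg (star_β_matVec q (N + 1) (k + 1) l)
  rw [neg_sub, sub_eq_add_neg, Nat.add_sub_cancel, add_sub_cancel_right, ← neg_apply, ← map_neg,
    ← star_neg] at h2
  rw [sub_eq_add_neg] at h1
  have := norm_sq_relation q h1 h2
    (by rw [inner_neg_right, inner_smul_right, inner_matVec, mul_zero, neg_zero]; omega)
    (by rw [inner_neg_left, inner_smul_left, inner_matVec, mul_zero, neg_zero]; omega)
  have hq := q.2.1.ne'
  have hl : (q : ℝ) ^ l ≠ 0 := zpow_ne_zero _ hq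
  have e : ((N + 1 : ℕ) : ℤ) = N + 1 := by push_cast; ring
  rw [e, zpow_add_one₀ hq, show (N : ℤ) + 1 + 1 = N + 2 by ring] at this
  refine mul_left_cancel₀ hl ?_
  linear_combination (norm := skip) this
  field_simp
  ring

theorem norm_relation_star_β :
    gnum (q : ℝ) (N + 1 - k) * gnum (q : ℝ) (l + 1) /
      gnum (q : ℝ) (N + 1) ^ 2 * ‖matVec q (N + 1) k (l + 1)‖ ^ 2 =
    (q : ℝ) ^ 2 * (gnum (q : ℝ) (N + 1) / gnum (q : ℝ) (N + 2)) * ‖matVec q N k l‖ ^ 2 := by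
  have h1 := star_β_matVec q N k l
  have h2 := congrArg Neg.neg (neg_β_matVec q (N + 1) k (l + 1))
  rw [neg_sub, sub_eq_add_neg, Nat.add_sub_cancel, add_sub_cancel_right, ← neg_apply, ← map_neg,
    neg_neg, ← star_star (β (q : ℝ))] at h2
  rw [sub_eq_add_neg] at h1
  have := norm_sq_relation q h1 h2
    (by rw [inner_neg_right, inner_smul_right, inner_matVec, mul_zero, neg_zero]; omega)
    (by rw [inner_neg_left, inner_smul_left, inner_matVec, mul_zero, neg_zero]; omega)
  have hq := q.2.1.ne'
  have hk : (q : ℝ) ^ k ≠ 0 := zpow_ne_zero _ hq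
  have e : ((N + 1 : ℕ) : ℤ) = N + 1 := by push_cast; ring
  rw [e, zpow_add_one₀ hq, show (N : ℤ) + 1 + 1 = N + 2 by ring] at this
  refine mul_left_cancel₀ hk ?_
  linear_combination (norm := skip) q * this
  field_simp
  ring

/-- A vanishing norm at spin N + 1 would force one at spin N. Which generator is used depends on
whether k or l has its top value N + 1 and must be lowered to stay in range. -/
theorem matVec_ne_zero (h : (0 ≤ k ∧ k ≤ N) ∧ (0 ≤ l ∧ l ≤ N)) : matVec q N k l ≠ 0 := by
  induction N generalizing k l with
  | zero =>
    obtain ⟨rfl, rfl⟩ : k = 0 ∧ l = 0 := by push_cast at h; omega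
    intro h0
    have h1 : ⟪matVec q 0 0 0, matVec q 0 0 0⟫_ℂ = 1 := by
      rw [matVec, inner_toL2, show matElt q 0 0 0 = 1 from if_pos ⟨rfl, rfl⟩, star_one, one_mul,
        haarLin_one]
    rw [h0, inner_zero_left] at h1
    exact zero_ne_one h1
  | succ N ih =>
    intro h0
    have g1 := gnum_pos q (m := N + 1) (by omega)
    have g2 := gnum_pos q (m := N + 2) (by omega)
    have hq := q.2.1
    push_cast at h
    have key (c : ℝ) (hc : 0 < c) (k' l' : ℤ) (h' : (0 ≤ k' ∧ k' ≤ N) ∧ (0 ≤ l' ∧ l' ≤ N))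
        (A : ℝ) (e : A * ‖matVec q (N + 1) k l‖ ^ 2 = c * ‖matVec q N k' l'‖ ^ 2) : False := by
      have := norm_pos_iff.mpr (ih k' l' h')
      rw [h0, norm_zero] at e
      nlinarith [mul_pos hc (pow_pos this 2)]
    by_cases hk : k ≤ N <;> by_cases hl : l ≤ N
    · exact key _ (by positivity) _ _ (by omega) _ (norm_relation_α q N k l)
    · have := norm_relation_star_β q N k (l - 1)
      rw [sub_add_cancel] at this
      exact key _ (by positivity) _ _ (by omega) _ this
    · have := norm_relation_neg_β q N (k - 1) l
      rw [sub_add_cancel] at this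
      exact key _ (by positivity) _ _ (by omega) _ this
    · have := norm_relation_star_α q N (k - 1) (l - 1)
      rw [sub_add_cancel, sub_add_cancel] at this
      exact key _ (by positivity) _ _ (by omega) _ this

end Norms

end Orthogonality

/-! ### The orthonormal basis of normalized matrix elements -/

section Basis

variable (q : Set.Ioo (0 : ℝ) 1)

theorem e_eq (N : ℕ) (k l : ℤ) : e q N k l = ((‖matVec q N k l‖⁻¹ : ℝ) : ℂ) • matVec q N k l := rfl

theorem norm_smul_e (N : ℕ) (k l : ℤ) :
    ((‖matVec q N k l‖ : ℝ) : ℂ) • e q N k l = matVec q N k l := by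
  rw [e_eq, smul_smul]
  by_cases h : matVec q N k l = 0
  · rw [h, smul_zero]
  · rw [← Complex.ofReal_mul, mul_inv_cancel₀ (norm_ne_zero_iff.mpr h), Complex.ofReal_one, one_smul]

/-- The vector `e q N k l` for an integer `N`, zero when the labels are out of range. -/
def eInt (N k l : ℤ) : L2 q := if 0 ≤ N then e q N.toNat k l else 0

theorem eInt_natCast (N : ℕ) (k l : ℤ) : eInt q N k l = e q N k l := by simp [eInt]

theorem eInt_natCast_add_one (N : ℕ) (k l : ℤ) : eInt q (N + 1) k l = e q (N + 1) k l :=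
  eInt_natCast q (N + 1) k l

theorem eInt_eq_zero (N k l : ℤ) (h : ¬ ((0 ≤ k ∧ k ≤ N) ∧ (0 ≤ l ∧ l ≤ N))) :
    eInt q N k l = 0 := by
  rw [eInt]
  split_ifs with hN
  · lift N to ℕ using hN
    rw [Int.toNat_natCast, e_eq, matVec_eq_zero q N k l h, smul_zero]
  · rfl

theorem inner_eInt_of_ne {N k l N' k' l' : ℤ} (h : ¬ (N = N' ∧ k = k' ∧ l = l')) :
    ⟪eInt q N k l, eInt q N' k' l'⟫_ℂ = 0 := by
  simp only [eInt]
  split_ifs with h1 h2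
  · rw [e_eq, e_eq, inner_smul_left, inner_smul_right, inner_matVec, mul_zero, mul_zero]
    omega
  all_goals simp

theorem inner_eInt_self {N k l : ℤ} (h : (0 ≤ k ∧ k ≤ N) ∧ (0 ≤ l ∧ l ≤ N)) :
    ⟪eInt q N k l, eInt q N k l⟫_ℂ = 1 := by
  lift N to ℕ using h.1.1.trans h.1.2
  rw [eInt_natCast, e_eq, inner_smul_left, inner_smul_right, inner_matVec_self,
    Complex.conj_ofReal]
  have := norm_ne_zero_iff.mpr (matVec_ne_zero q N k l h)
  norm_cast
  field_simp

theorem leftReg_e {x : Alg (q : ℝ)} {N N₁ N₂ : ℕ} {k k₁ k₂ l l₁ l₂ : ℤ} {A B : ℂ}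
    (h : leftReg q x (matVec q N k l) = A • matVec q N₁ k₁ l₁ + B • matVec q N₂ k₂ l₂) :
    leftReg q x (e q N k l) =
      (A * (‖matVec q N₁ k₁ l₁‖ / ‖matVec q N k l‖ : ℝ)) • e q N₁ k₁ l₁ +
      (B * (‖matVec q N₂ k₂ l₂‖ / ‖matVec q N k l‖ : ℝ)) • e q N₂ k₂ l₂ := by
  rw [e_eq q N k l, map_smul, h]
  nth_rw 1 [← norm_smul_e q N₁]
  nth_rw 1 [← norm_smul_e q N₂]
  simp only [smul_add, smul_smul]
  push_cast
  congr 2 <;> ring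

/-- With A and A' the coefficients of an operator and of its adjoint between y and z, the
coefficient between the normalized vectors is their geometric mean. -/
theorem mul_div_eq_sqrt {A A' y z : ℝ} (hA : 0 ≤ A) (hy : 0 < y) (hz : 0 ≤ z)
    (h : A * z ^ 2 = A' * y ^ 2) : A * (z / y) = √(A * A') := by
  have h' : A' = A * (z / y) ^ 2 := by field_simp; linarith
  rw [h', show A * (A * (z / y) ^ 2) = (A * (z / y)) ^ 2 by ring, Real.sqrt_sq (by positivity)]

theorem star_α_eInt (N k l : ℤ) : leftReg q (star (α (q : ℝ))) (eInt q N k l) =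
    (√(gnum (q : ℝ) (k + 1) * gnum (q : ℝ) (l + 1) /
      (gnum (q : ℝ) (N + 1) * gnum (q : ℝ) (N + 2))) : ℂ) • eInt q (N + 1) (k + 1) (l + 1) +
    (((q : ℝ) ^ (k + l + 1) * √(gnum (q : ℝ) (N - k) * gnum (q : ℝ) (N - l) /
      (gnum (q : ℝ) N * gnum (q : ℝ) (N + 1))) : ℝ) : ℂ) • eInt q (N - 1) k l := by
  by_cases h : (0 ≤ k ∧ k ≤ N) ∧ (0 ≤ l ∧ l ≤ N)
  · lift N to ℕ using h.1.1.trans h.1.2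
    rw [eInt_natCast, leftReg_e q (star_α_matVec q N k l), eInt_natCast_add_one]
    have hy := norm_pos_iff.mpr (matVec_ne_zero q N k l h)
    have g1 := gnum_pos q (m := N + 1) (by omega)
    have g2 := gnum_pos q (m := N + 2) (by omega)
    have g3 := gnum_pos q (m := k + 1) (by omega)
    have g4 := gnum_pos q (m := l + 1) (by omega)
    congr 1
    · rw [← Complex.ofReal_mul, mul_div_eq_sqrt (by positivity) hy (norm_nonneg _)
        (norm_relation_star_α q N k l)]
      congr 3
      field_simp
    -- For N = 0 both lowering coefficients contain `gnum q 0`, which is zero (in a denominator on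
    -- the right).
    · rcases N with _ | N
      · simp [gnum_zero]
      have g5 := gnum_pos q (m := N + 1) (by omega)
      have e1 : ((N + 1 : ℕ) : ℤ) - 1 = N := by push_cast; ring
      have e2 : ((N + 1 : ℕ) : ℤ) = N + 1 := by push_cast; ring
      have e3 : (N : ℤ) + 1 + 1 = N + 2 := by ring
      rw [e1, eInt_natCast, Nat.add_sub_cancel]
      simp only [e2, e3]
      rw [e2, e3] at g1
      have hq := q.2.1
      rw [← Complex.ofReal_mul, mul_div_eq_sqrt (by positivity) hy (norm_nonneg _)
        (norm_relation_α q N k l).symm]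
      congr 2
      rw [← Real.sqrt_sq (show 0 ≤ (q : ℝ) ^ (k + l + 1) by positivity), ← Real.sqrt_mul (by positivity)]
      congr 1
      rw [show k + l + 2 = k + l + 1 + 1 by ring, zpow_add_one₀ hq.ne', zpow_add_one₀ hq.ne']
      field_simp
  · rw [eInt_eq_zero q N k l h, map_zero]
    have h1 : eInt q (N - 1) k l = 0 := eInt_eq_zero q _ _ _ (by omega)
    rw [h1, smul_zero, add_zero]
    -- An out-of-range source can have an in-range target only if k = -1 or l = -1, and then the
    -- coefficient is zero. The formula thus holds for all integer labels.
    by_cases hkl : k + 1 = 0 ∨ l + 1 = 0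
    · rcases hkl with hk | hk <;> simp [hk, gnum_zero]
    · rw [eInt_eq_zero q _ _ _ (by omega), smul_zero]

theorem neg_β_eInt (N k l : ℤ) : leftReg q (-β (q : ℝ)) (eInt q N k l) =
    (((q : ℝ) ^ l * √(gnum (q : ℝ) (k + 1) * gnum (q : ℝ) (N + 1 - l) /
      (gnum (q : ℝ) (N + 1) * gnum (q : ℝ) (N + 2))) : ℝ) : ℂ) • eInt q (N + 1) (k + 1) l +
    ((-((q : ℝ) ^ k * √(gnum (q : ℝ) (N - k) * gnum (q : ℝ) l /
      (gnum (q : ℝ) N * gnum (q : ℝ) (N + 1)))) : ℝ) : ℂ) • eInt q (N - 1) k (l - 1) := by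
  have hq := q.2.1
  by_cases h : (0 ≤ k ∧ k ≤ N) ∧ (0 ≤ l ∧ l ≤ N)
  · lift N to ℕ using h.1.1.trans h.1.2
    have h0 := neg_β_matVec q N k l
    rw [sub_eq_add_neg, ← neg_smul] at h0
    rw [eInt_natCast, leftReg_e q h0, eInt_natCast_add_one]
    have hy := norm_pos_iff.mpr (matVec_ne_zero q N k l h)
    have g1 := gnum_pos q (m := N + 1) (by omega)
    have g2 := gnum_pos q (m := N + 2) (by omega)
    have g3 := gnum_pos q (m := k + 1) (by omega)
    have g4 := gnum_pos q (m := N + 1 - l) (by omega)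
    congr 1
    · rw [← Complex.ofReal_mul, mul_div_eq_sqrt (A' := (q : ℝ) ^ l * (gnum (q : ℝ) (N + 1) /
        gnum (q : ℝ) (N + 2))) (by positivity) hy (norm_nonneg _) (by
        rw [mul_assoc ((q : ℝ) ^ l) (_ / _), ← norm_relation_neg_β q N k l]
        field_simp)]
      congr 2
      rw [← Real.sqrt_sq (show 0 ≤ (q : ℝ) ^ l by positivity), ← Real.sqrt_mul (by positivity),
        Real.sqrt_sq (by positivity)]
      congr 1
      field_simp
    · rcases N with _ | N
      · simp [gnum_zero]
      have g5 := gnum_pos q (m := N + 1) (by omega)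
      have e1 : ((N + 1 : ℕ) : ℤ) - 1 = N := by push_cast; ring
      have e2 : ((N + 1 : ℕ) : ℤ) = N + 1 := by push_cast; ring
      have e3 : (N : ℤ) + 1 + 1 = N + 2 := by ring
      rw [e1, eInt_natCast, Nat.add_sub_cancel]
      simp only [e2, e3]
      rw [e2, e3] at g1
      have hr := norm_relation_star_β q N k (l - 1)
      rw [sub_add_cancel] at hr
      rw [neg_mul, Complex.ofReal_neg, ← Complex.ofReal_mul, mul_div_eq_sqrt (A' := (q : ℝ) ^ (k - 1) *
        (gnum (q : ℝ) (N + 1 - k) * gnum (q : ℝ) l / gnum (q : ℝ) (N + 1) ^ 2)) (by positivity) hy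
        (norm_nonneg _) (by
          rw [mul_assoc ((q : ℝ) ^ (k - 1)), hr, zpow_add_one₀ hq.ne', zpow_sub_one₀ hq.ne']
          field_simp)]
      congr 3
      rw [← Real.sqrt_sq (show 0 ≤ (q : ℝ) ^ k by positivity), ← Real.sqrt_mul (by positivity)]
      congr 1
      rw [zpow_add_one₀ hq.ne', zpow_sub_one₀ hq.ne']
      field_simp
  · rw [eInt_eq_zero q N k l h, map_zero]
    have h1 : eInt q (N - 1) k (l - 1) = 0 := eInt_eq_zero q _ _ _ (by omega)
    rw [h1, smul_zero, add_zero]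
    by_cases hkl : k + 1 = 0 ∨ N + 1 - l = 0
    · rcases hkl with hk | hk <;> simp [hk, gnum_zero]
    · rw [eInt_eq_zero q _ _ _ (by omega), smul_zero]

theorem dense_polyAlg : Dense (polyAlg (q : ℝ) : Set (Alg (q : ℝ))) := by
  intro x
  rw [closure_subtype]
  have hx : (x : Family (q : ℝ)) ∈ closure
    ((StarAlgebra.adjoin ℂ {familyA (q : ℝ), familyB q} : StarSubalgebra ℂ (Family (q : ℝ))) : Set (Family (q : ℝ))) := x.2
  refine closure_mono ?_ hx
  have h : (polyAlg (q : ℝ)).map (closedSubalgebra (q : ℝ)).subtype =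
      StarAlgebra.adjoin ℂ {familyA (q : ℝ), familyB q} := by
    rw [polyAlg, StarAlgHom.map_adjoin, Set.image_pair]
    rfl
  rw [← h]
  rfl

/-- The map is evaluation of the contractive representation π at the cyclic vector. -/
theorem continuous_toL2 : Continuous (toL2 q) := by
  have h : ∀ x, toL2 q x = leftReg q x (toL2 q 1) := fun x => by rw [leftReg_toL2, mul_one]
  have hc : Continuous (leftReg q) := AddMonoidHomClass.continuous_of_bound _ 1 fun x => by
    simpa using NonUnitalStarAlgHom.norm_apply_le (leftReg q) x
  rw [funext h]
  exact (ContinuousLinearMap.apply ℂ (L2 q) (toL2 q 1)).continuous.comp hc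

theorem denseRange_toL2 : DenseRange (toL2 q) :=
  UniformSpace.Completion.denseRange_coe (α := (haar q).PreGNS)

/-- The span of the matrix elements. -/
def matSpan : Submodule ℂ (L2 q) :=
  Submodule.span ℂ (Set.range fun x : ℕ × ℤ × ℤ => matVec q x.1 x.2.1 x.2.2)

theorem matVec_mem (N : ℕ) (k l : ℤ) : matVec q N k l ∈ matSpan q :=
  Submodule.subset_span ⟨(N, k, l), rfl⟩

theorem leftReg_mem_matSpan {x : Alg (q : ℝ)} (hx : ∀ N k l, leftReg q x (matVec q N k l) ∈ matSpan q)
    {y : L2 q} (hy : y ∈ matSpan q) : leftReg q x y ∈ matSpan q := by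
  induction hy using Submodule.span_induction with
  | mem y hy => obtain ⟨z, rfl⟩ := hy; exact hx _ _ _
  | zero => rw [map_zero]; exact zero_mem _
  | add y z _ _ h1 h2 => rw [map_add]; exact add_mem h1 h2
  | smul c y _ h => rw [map_smul]; exact Submodule.smul_mem _ _ h

/-- Invariance under x and under x* is carried along together, because the induction over a
generated *-subalgebra includes a step for adjoints. -/
theorem leftReg_polyAlg_mem {x : Alg (q : ℝ)} (hx : x ∈ polyAlg (q : ℝ)) :
    ∀ y ∈ matSpan q, leftReg q x y ∈ matSpan q ∧ leftReg q (star x) y ∈ matSpan q := by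
  induction hx using StarAlgebra.adjoin_induction with
  | mem x hx =>
    have key (M N : ℕ) (k l k' l' : ℤ) (A B : ℂ) :
      A • matVec q M k l + B • matVec q N k' l' ∈ matSpan q :=
      add_mem (Submodule.smul_mem _ _ (matVec_mem q _ _ _)) (Submodule.smul_mem _ _ (matVec_mem q _ _ _))
    rcases hx with rfl | rfl
    · refine fun y hy => ⟨leftReg_mem_matSpan q (fun N k l => ?_) hy,
        leftReg_mem_matSpan q (fun N k l => ?_) hy⟩
      · rw [α_matVec]; exact key _ _ _ _ _ _ _ _
      · rw [star_α_matVec]; exact key _ _ _ _ _ _ _ _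
    · refine fun y hy => ⟨leftReg_mem_matSpan q (fun N k l => ?_) hy,
        leftReg_mem_matSpan q (fun N k l => ?_) hy⟩
      · rw [← neg_neg (β (q : ℝ)), map_neg, neg_apply, neg_β_matVec, sub_eq_add_neg, ← neg_smul]
        exact neg_mem (key _ _ _ _ _ _ _ _)
      · rw [star_β_matVec, sub_eq_add_neg, ← neg_smul]; exact key _ _ _ _ _ _ _ _
  | algebraMap r =>
    intro y hy
    rw [← algebraMap_star_comm, AlgHomClass.commutes, AlgHomClass.commutes]
    exact ⟨Submodule.smul_mem _ r hy, Submodule.smul_mem _ (star r) hy⟩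
  | add x z _ _ h1 h2 =>
    intro y hy
    rw [star_add, map_add, map_add]
    exact ⟨add_mem (h1 y hy).1 (h2 y hy).1, add_mem (h1 y hy).2 (h2 y hy).2⟩
  | mul x z _ _ h1 h2 =>
    intro y hy
    rw [star_mul, map_mul, map_mul]
    exact ⟨(h1 _ (h2 y hy).1).1, (h2 _ (h1 y hy).2).2⟩
  | star x _ h =>
    intro y hy
    rw [star_star]
    exact (h y hy).symm

/-- The span contains the cyclic vector T_0(0,0) Ω and is invariant under the dense *-subalgebra. -/
theorem dense_matSpan : Dense (matSpan q : Set (L2 q)) := by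
  have h1 : Dense (toL2 q '' (polyAlg (q : ℝ) : Set (Alg (q : ℝ)))) :=
    (denseRange_toL2 q).dense_image (continuous_toL2 q) (dense_polyAlg q)
  refine h1.mono ?_
  rintro _ ⟨x, hx, rfl⟩
  have := (leftReg_polyAlg_mem q hx _ (matVec_mem q 0 0 0)).1
  rwa [matVec, leftReg_toL2, show matElt (q : ℝ) 0 0 0 = 1 from if_pos ⟨rfl, rfl⟩, mul_one] at this

theorem mem_of_eInt_mem {S : Submodule ℂ (L2 q)} (hS : IsClosed (S : Set (L2 q)))
    (h : ∀ N k l : ℤ, (0 ≤ k ∧ k ≤ N) ∧ (0 ≤ l ∧ l ≤ N) → eInt q N k l ∈ S) (y : L2 q) : y ∈ S := by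
  have h1 : matSpan q ≤ S := by
    refine Submodule.span_le.mpr ?_
    rintro _ ⟨⟨N, k, l⟩, rfl⟩
    by_cases hr : (0 ≤ k ∧ k ≤ (N : ℤ)) ∧ (0 ≤ l ∧ l ≤ (N : ℤ))
    · have := h N k l hr
      rw [eInt_natCast] at this
      change matVec q N k l ∈ S
      rw [← norm_smul_e]
      exact Submodule.smul_mem _ _ this
    · change matVec q N k l ∈ S
      rw [matVec_eq_zero q N k l hr]; exact zero_mem _
  exact hS.closure_subset_iff.mpr h1 (dense_matSpan q y)

end Basis

/-! ### Rotated bases of `L₂(h) ⊕ L₂(h)` -/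

/-- Coefficients of a family of rotations which fix the vectors without a partner. -/
structure IsRot (C S : ℤ → ℤ → ℝ) : Prop where
  sq_add_sq : ∀ N p, 0 ≤ N → 0 ≤ p → p ≤ N + 1 → C N p ^ 2 + S N p ^ 2 = 1
  cos_top : ∀ N, C N (N + 1) = 0
  sin_zero : ∀ N, S N 0 = 0

/-- The (symmetric) matrix of the change of basis. -/
def rotMat (C S : ℤ → ℤ → ℝ) (N p : ℤ) : Matrix (Fin 2) (Fin 2) ℝ :=
  !![S N p, C N p; C N p, -S N p]

section Rotation

variable (q : Set.Ioo (0 : ℝ) 1) (C S : ℤ → ℤ → ℝ)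

/-- The rotated basis: the pair of vectors with labels `0` and `1` spans the plane of
`e N k (p - 1) ⊕ 0` and `0 ⊕ e N k p`. -/
def rotVec (N k p : ℤ) (s : Fin 2) : WithLp 2 (L2 q × L2 q) :=
  WithLp.toLp 2 ((rotMat C S N p s 0 : ℂ) • eInt q N k (p - 1), (rotMat C S N p s 1 : ℂ) • eInt q N k p)

variable {C S} (h : IsRot C S)
include h

/-- For p = 0 the vector e_{k,-1} is zero and so is the sine; for p = N + 1 the vector e_{k,N+1} is
zero and so is the cosine. In both cases the second vector of the pair disappears, as d does. -/
theorem rotVec_eq_zero {N k p : ℤ} {s : Fin 2} (hl : ¬ IsLabel s N k p) :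
    rotVec q C S N k p s = 0 := by
  simp only [IsLabel] at hl
  by_cases hr : (0 ≤ k ∧ k ≤ N) ∧ (0 ≤ p ∧ p ≤ N + 1)
  · fin_cases s
    · simp at hl; omega
    · have hp : p = 0 ∨ p = N + 1 := by simp at hl; omega
      rcases hp with rfl | rfl
      · simp [rotVec, rotMat, h.sin_zero, eInt_eq_zero q N k (-1) (by omega)]
      · simp [rotVec, rotMat, h.cos_top, eInt_eq_zero q N k (N + 1) (by omega)]
  · rw [rotVec, eInt_eq_zero q N k p (by omega), eInt_eq_zero q N k (p - 1) (by omega)]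
    simp

/-- The norm of e_{k,p-1} is one except at p = 0, where the sine kills the term. -/
theorem sin_mul_inner {N k p : ℤ} (hk : 0 ≤ k ∧ k ≤ N) (hp : 0 ≤ p ∧ p ≤ N + 1) :
    (S N p : ℂ) * ⟪eInt q N k (p - 1), eInt q N k (p - 1)⟫_ℂ = S N p := by
  by_cases hp0 : p = 0
  · subst hp0; simp [h.sin_zero]
  · rw [inner_eInt_self q (by omega), mul_one]

theorem cos_mul_inner {N k p : ℤ} (hk : 0 ≤ k ∧ k ≤ N) (hp : 0 ≤ p ∧ p ≤ N + 1) :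
    (C N p : ℂ) * ⟪eInt q N k p, eInt q N k p⟫_ℂ = C N p := by
  by_cases hp0 : p = N + 1
  · subst hp0; simp [h.cos_top]
  · rw [inner_eInt_self q (by omega), mul_one]

theorem orthonormal_rotVec : Orthonormal ℂ
    (fun x : HLabel => rotVec q C S x.1.2.1 x.1.2.2.1 x.1.2.2.2 x.1.1) := by
  classical
  rw [orthonormal_iff_ite]
  rintro ⟨⟨s, N, k, p⟩, hx⟩ ⟨⟨s', N', k', p'⟩, hx'⟩
  simp only [rotVec, WithLp.prod_inner_apply, inner_smul_left, inner_smul_right,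
    Complex.conj_ofReal, Subtype.mk.injEq, Prod.mk.injEq]
  by_cases he : N = N' ∧ k = k' ∧ p = p'
  · obtain ⟨rfl, rfl, rfl⟩ := he
    simp only [IsLabel] at hx hx'
    have hp : 0 ≤ p ∧ p ≤ N + 1 := by split_ifs at hx <;> omega
    have e1 := sin_mul_inner q h hx.1 hp
    have e2 := cos_mul_inner q h hx.1 hp
    have e3 : (C N p : ℂ) ^ 2 + (S N p : ℂ) ^ 2 = 1 := by
      exact_mod_cast h.sq_add_sq N p (by omega) hp.1 hp.2
    have e4 : 1 ≤ p → ⟪eInt q N k (p - 1), eInt q N k (p - 1)⟫_ℂ = 1 :=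
      fun h => inner_eInt_self q (by omega)
    have e5 : p ≤ N → ⟪eInt q N k p, eInt q N k p⟫_ℂ = 1 := fun h => inner_eInt_self q (by omega)
    generalize ⟪eInt q N k (p - 1), eInt q N k (p - 1)⟫_ℂ = X at *
    generalize ⟪eInt q N k p, eInt q N k p⟫_ℂ = Y at *
    fin_cases s <;> fin_cases s' <;> simp [rotMat]
    · linear_combination (S N p : ℂ) * e1 + (C N p : ℂ) * e2 + e3
    · linear_combination (C N p : ℂ) * e1 - (S N p : ℂ) * e2
    · linear_combination (C N p : ℂ) * e1 - (S N p : ℂ) * e2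
    · simp at hx
      rw [e4 (by omega), e5 (by omega)]
      linear_combination e3
  · rw [inner_eInt_of_ne q (by omega), inner_eInt_of_ne q he, if_neg (by tauto)]
    simp

/-- `rotMat` is symmetric and orthogonal on the relevant range, hence its own inverse. The vector
e_{k,l} ⊕ 0 lies in the plane with p = l + 1. -/
theorem toLp_inl {N k l : ℤ} (hl : 0 ≤ l ∧ l ≤ N) : WithLp.toLp 2 (eInt q N k l, (0 : L2 q)) =
    (S N (l + 1) : ℂ) • rotVec q C S N k (l + 1) 0 +
      (C N (l + 1) : ℂ) • rotVec q C S N k (l + 1) 1 := by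
  have e3 : (C N (l + 1) : ℂ) ^ 2 + (S N (l + 1) : ℂ) ^ 2 = 1 := by
    exact_mod_cast h.sq_add_sq N (l + 1) (by omega) (by omega) (by omega)
  simp only [rotVec, rotMat, ← WithLp.toLp_smul, ← WithLp.toLp_add, Prod.smul_mk, Prod.mk_add_mk,
    smul_smul, add_sub_cancel_right, ← add_smul]
  congr 2
  · nth_rw 1 [← one_smul ℂ (eInt q N k l), ← e3]
    congr 1; simp; ring
  · simp; rw [mul_comm, add_neg_cancel, zero_smul]

theorem toLp_inr {N k p : ℤ} (hp : 0 ≤ p ∧ p ≤ N) : WithLp.toLp 2 ((0 : L2 q), eInt q N k p) =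
    (C N p : ℂ) • rotVec q C S N k p 0 - (S N p : ℂ) • rotVec q C S N k p 1 := by
  have e3 : (C N p : ℂ) ^ 2 + (S N p : ℂ) ^ 2 = 1 := by
    exact_mod_cast h.sq_add_sq N p (by omega) (by omega) (by omega)
  simp only [rotVec, rotMat, ← WithLp.toLp_smul, ← WithLp.toLp_sub, Prod.smul_mk, Prod.mk_sub_mk,
    smul_smul, ← sub_smul]
  congr 2
  · simp; rw [mul_comm, sub_self, zero_smul]
  · nth_rw 1 [← one_smul ℂ (eInt q N k p), ← e3]
    congr 1; simp; ring

theorem top_le_closure_span_rotVec : ⊤ ≤ (Submodule.span ℂ (Set.range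
    (fun x : HLabel => rotVec q C S x.1.2.1 x.1.2.2.1 x.1.2.2.2 x.1.1))).topologicalClosure := by
  set T := (Submodule.span ℂ (Set.range
    (fun x : HLabel => rotVec q C S x.1.2.1 x.1.2.2.1 x.1.2.2.2 x.1.1))).topologicalClosure with hT
  have hc : IsClosed (T : Set (WithLp 2 (L2 q × L2 q))) := Submodule.isClosed_topologicalClosure _
  have hm (N k p : ℤ) (s : Fin 2) : rotVec q C S N k p s ∈ T := by
    by_cases hl : IsLabel s N k p
    · exact Submodule.le_topologicalClosure _ (Submodule.subset_span ⟨⟨(s, N, k, p), hl⟩, rfl⟩)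
    · rw [rotVec_eq_zero q h hl]; exact zero_mem _
  let i₁ : L2 q →L[ℂ] WithLp 2 (L2 q × L2 q) :=
    (WithLp.prodContinuousLinearEquiv 2 ℂ (L2 q) (L2 q)).symm.toContinuousLinearMap ∘L
      ContinuousLinearMap.inl ℂ _ _
  let i₂ : L2 q →L[ℂ] WithLp 2 (L2 q × L2 q) :=
    (WithLp.prodContinuousLinearEquiv 2 ℂ (L2 q) (L2 q)).symm.toContinuousLinearMap ∘L
      ContinuousLinearMap.inr ℂ _ _
  have h1 (y : L2 q) : i₁ y ∈ T :=
    mem_of_eInt_mem q (S := T.comap i₁.toLinearMap) (hc.preimage i₁.continuous) (fun N k l hr => by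
      change WithLp.toLp 2 (eInt q N k l, (0 : L2 q)) ∈ T
      rw [toLp_inl q h hr.2]
      exact add_mem (Submodule.smul_mem _ _ (hm _ _ _ _)) (Submodule.smul_mem _ _ (hm _ _ _ _))) y
  have h2 (y : L2 q) : i₂ y ∈ T :=
    mem_of_eInt_mem q (S := T.comap i₂.toLinearMap) (hc.preimage i₂.continuous) (fun N k l hr => by
      change WithLp.toLp 2 ((0 : L2 q), eInt q N k l) ∈ T
      rw [toLp_inr q h hr.2]
      exact sub_mem (Submodule.smul_mem _ _ (hm _ _ _ _)) (Submodule.smul_mem _ _ (hm _ _ _ _))) y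
  rintro z -
  have e : z = i₁ z.fst + i₂ z.snd := by
    change z = WithLp.toLp 2 (z.fst, (0 : L2 q)) + WithLp.toLp 2 ((0 : L2 q), z.snd)
    rw [← WithLp.toLp_add, Prod.mk_add_mk, add_zero, zero_add]
    rfl
  rw [e]
  exact add_mem (h1 _) (h2 _)

/-- The rotated basis as a Hilbert basis. -/
def rotBasis : HilbertBasis HLabel ℂ (WithLp 2 (L2 q × L2 q)) :=
  HilbertBasis.mk (orthonormal_rotVec q h) (top_le_closure_span_rotVec q h)

theorem rotBasis_apply (x : HLabel) :
    rotBasis q h x = rotVec q C S x.1.2.1 x.1.2.2.1 x.1.2.2.2 x.1.1 := by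
  rw [rotBasis, HilbertBasis.coe_mk]

/-- The unitary mapping the rotated basis to the standard basis. -/
def rotEquiv : WithLp 2 (L2 q × L2 q) ≃ₗᵢ[ℂ] H := (rotBasis q h).repr

theorem rotEquiv_rotVec (N k p : ℤ) (s : Fin 2) : rotEquiv q h (rotVec q C S N k p s) = v N k p s := by
  classical
  by_cases hl : IsLabel s N k p
  · have := (rotBasis q h).repr_self ⟨(s, N, k, p), hl⟩
    rw [rotBasis_apply] at this
    rw [v, dif_pos hl, rotEquiv]
    convert this
  · rw [rotVec_eq_zero q h hl, map_zero, v, dif_neg hl]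

theorem rotEquiv_symm_v (N k p : ℤ) (s : Fin 2) :
    (rotEquiv q h).symm (v N k p s) = rotVec q C S N k p s := by
  rw [← rotEquiv_rotVec q h, LinearIsometryEquiv.symm_apply_apply]

end Rotation

/-! ### The representation carried over to `H` -/

section Conj

variable (q : Set.Ioo (0 : ℝ) 1) (V : WithLp 2 (L2 q × L2 q) ≃ₗᵢ[ℂ] H)

theorem conj_opSum_apply (A B : L2 q →L[ℂ] L2 q) (x : H) : opConj V (opSum A B) x =
    V (WithLp.toLp 2 (A (V.symm x).fst, B (V.symm x).snd)) := rfl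

/-- The representation `V (π ⊕ π) V*`. -/
def conjRep : Alg (q : ℝ) →⋆ₐ[ℂ] (H →L[ℂ] H) where
  toFun a := opConj V (opSum (leftReg q a) (leftReg q a))
  map_one' := by
    rw [map_one]
    ext1 x
    exact V.apply_symm_apply x
  map_mul' a b := by
    rw [map_mul]
    ext1 x
    change _ = opConj V _ (opConj V _ x)
    rw [conj_opSum_apply, conj_opSum_apply, conj_opSum_apply, V.symm_apply_apply]
    rfl
  map_zero' := by
    rw [map_zero]
    ext1 x
    exact map_zero V
  map_add' a b := by
    rw [map_add]
    ext1 x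
    rw [add_apply, conj_opSum_apply, conj_opSum_apply, conj_opSum_apply]
    exact map_add V (WithLp.toLp 2 (_, _)) (WithLp.toLp 2 (_, _))
  commutes' r := by
    rw [AlgHomClass.commutes, Algebra.algebraMap_eq_smul_one, Algebra.algebraMap_eq_smul_one]
    ext1 x
    rw [conj_opSum_apply]
    trans V (r • V.symm x)
    · rfl
    · rw [map_smul, V.apply_symm_apply]
      rfl
  map_star' a := by
    rw [map_star]
    refine (ContinuousLinearMap.eq_adjoint_iff _ _).mpr fun x y => ?_
    rw [conj_opSum_apply, conj_opSum_apply]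
    conv_lhs => rw [← V.apply_symm_apply y]
    conv_rhs => rw [← V.apply_symm_apply x]
    rw [V.inner_map_map, V.inner_map_map, WithLp.prod_inner_apply, WithLp.prod_inner_apply]
    congr 1 <;> exact ContinuousLinearMap.adjoint_inner_left _ _ _

theorem conjRep_apply (a : Alg (q : ℝ)) :
    conjRep q V a = opConj V (opSum (leftReg q a) (leftReg q a)) := rfl

end Conj

section Transport

variable (q : Set.Ioo (0 : ℝ) 1) {C S : ℤ → ℤ → ℝ} (h : IsRot C S)
include h

/-- The matrix of `V (π(x) ⊕ π(x)) V*` for an element `x` which acts on the basis of matrix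
elements by a sum of two weighted shifts. -/
theorem conjRep_v {x : Alg (q : ℝ)} {N k p N₁ k₁ p₁ N₂ k₂ p₂ : ℤ} {s : Fin 2} {A₁ B₁ A₂ B₂ : ℝ}
    {M₁ M₂ : Matrix (Fin 2) (Fin 2) ℝ}
    (hA : leftReg q x (eInt q N k (p - 1)) = (A₁ : ℂ) • eInt q N₁ k₁ (p₁ - 1) +
      (A₂ : ℂ) • eInt q N₂ k₂ (p₂ - 1))
    (hB : leftReg q x (eInt q N k p) = (B₁ : ℂ) • eInt q N₁ k₁ p₁ + (B₂ : ℂ) • eInt q N₂ k₂ p₂)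
    (h₁ : eInt q N₁ k₁ (p₁ - 1) ≠ 0 →
      rotMat C S N p s 0 * A₁ = M₁ 0 s * rotMat C S N₁ p₁ 0 0 + M₁ 1 s * rotMat C S N₁ p₁ 1 0)
    (h₁' : eInt q N₁ k₁ p₁ ≠ 0 →
      rotMat C S N p s 1 * B₁ = M₁ 0 s * rotMat C S N₁ p₁ 0 1 + M₁ 1 s * rotMat C S N₁ p₁ 1 1)
    (h₂ : eInt q N₂ k₂ (p₂ - 1) ≠ 0 →
      rotMat C S N p s 0 * A₂ = M₂ 0 s * rotMat C S N₂ p₂ 0 0 + M₂ 1 s * rotMat C S N₂ p₂ 1 0)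
    (h₂' : eInt q N₂ k₂ p₂ ≠ 0 →
      rotMat C S N p s 1 * B₂ = M₂ 0 s * rotMat C S N₂ p₂ 0 1 + M₂ 1 s * rotMat C S N₂ p₂ 1 1) :
    conjRep q (rotEquiv q h) x (v N k p s) =
      ∑ r, (M₁ r s : ℂ) • v N₁ k₁ p₁ r + ∑ r, (M₂ r s : ℂ) • v N₂ k₂ p₂ r := by
  -- Coefficients have to agree only in front of nonzero vectors, which spares the identities at the
  -- boundary of the label range.
  have key {a b c : ℝ} {y : L2 q} (hy : y ≠ 0 → a = b + c) : (a : ℂ) • y = (b : ℂ) • y + (c : ℂ) • y := by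
    by_cases hy0 : y = 0
    · simp [hy0]
    · rw [hy hy0, Complex.ofReal_add, add_smul]
  have k₁ := key h₁
  have k₁' := key h₁'
  have k₂ := key h₂
  have k₂' := key h₂'
  rw [conjRep_apply, conj_opSum_apply, rotEquiv_symm_v]
  simp only [← rotEquiv_rotVec q h, ← map_smul, Fin.sum_univ_two, ← map_add]
  congr 1
  change WithLp.toLp 2 (leftReg q x ((rotMat C S N p s 0 : ℂ) • eInt q N k (p - 1)),
    leftReg q x ((rotMat C S N p s 1 : ℂ) • eInt q N k p)) = _
  rw [map_smul, map_smul, hA, hB]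
  simp only [rotVec, ← WithLp.toLp_smul, ← WithLp.toLp_add, Prod.smul_mk, Prod.mk_add_mk,
    smul_smul, smul_add, ← Complex.ofReal_mul]
  rw [k₁, k₁', k₂, k₂']

end Transport

/-! ### The coefficients of Dabrowski et al. in terms of integers -/

section Coefficients

variable (q : Set.Ioo (0 : ℝ) 1)

theorem one_sub_sq_pos : 0 < 1 - (q : ℝ) ^ 2 := by
  have := pow_lt_one₀ q.2.1.le q.2.2 two_ne_zero
  linarith

theorem qnum_intCast (m : ℤ) :
    qnum q m = (q : ℝ) ^ (1 - m : ℝ) * gnum (q : ℝ) m / (1 - (q : ℝ) ^ 2) := by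
  have hq := q.2.1
  have h1 := one_sub_sq_pos q
  have h2 : (q : ℝ) - (q : ℝ)⁻¹ ≠ 0 := by
    have : (q : ℝ) - (q : ℝ)⁻¹ = -((1 - (q : ℝ) ^ 2) / q) := by field_simp; ring
    rw [this]
    exact neg_ne_zero.mpr (by positivity)
  have h3 : (q : ℝ) ^ 2 - 1 ≠ 0 := by linarith
  rw [qnum, gnum, Real.rpow_sub hq, Real.rpow_one, Real.rpow_neg hq.le, Real.rpow_intCast]
  have h4 : (q : ℝ) ^ m ≠ 0 := zpow_ne_zero _ hq.ne'
  field_simp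
  ring

theorem sqrt_qnum_intCast (m : ℤ) :
    √(qnum q m) = (q : ℝ) ^ ((1 - m) / 2 : ℝ) * √(gnum (q : ℝ) m) / √(1 - (q : ℝ) ^ 2) := by
  rw [qnum_intCast, Real.sqrt_div' _ (one_sub_sq_pos q).le,
    Real.sqrt_mul (Real.rpow_nonneg q.2.1.le _), Real.sqrt_eq_rpow, ← Real.rpow_mul q.2.1.le]
  congr 3
  ring

/-- Each √[m] contributes q^{(1-m)/2} and each denominator [M] contributes q^{-(1-M)}; together with
the explicit powers these add up to an integer exponent E. The two factors (1 - q²)^{-1/2} cancel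
against the one in [M]. -/
theorem entry_one_denom {a b c x y : ℝ} (m₁ m₂ M E : ℤ) (ha : a = m₁) (hb : b = m₂) (hc : c = M)
    (hE : x + y + (1 - m₁) / 2 + (1 - m₂) / 2 - (1 - M) = (E : ℝ)) :
    (q : ℝ) ^ x * √(qnum q a) * ((q : ℝ) ^ y * (√(qnum q b) / qnum q c)) =
      (q : ℝ) ^ E * (√(gnum (q : ℝ) m₁) * √(gnum (q : ℝ) m₂)) / gnum (q : ℝ) M := by
  have hq := q.2.1
  have h1 := one_sub_sq_pos q
  have h2 := Real.sq_sqrt h1.le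
  have h3 : √(1 - (q : ℝ) ^ 2) ≠ 0 := (Real.sqrt_pos.mpr h1).ne'
  subst ha hb hc
  rw [sqrt_qnum_intCast, sqrt_qnum_intCast, qnum_intCast, ← Real.rpow_intCast, ← hE,
    Real.rpow_sub hq _ (1 - M), Real.rpow_add hq, Real.rpow_add hq, Real.rpow_add hq]
  -- This happens for M = 0, that is for N = 0 in the lowering matrices; both sides are then a
  -- division by zero with value 0.
  by_cases hM : gnum (q : ℝ) M = 0
  · simp [hM]
  generalize √(1 - (q : ℝ) ^ 2) = r at h2 h3 ⊢
  rw [← h2]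
  have h4 (t : ℝ) : (q : ℝ) ^ t ≠ 0 := (Real.rpow_pos_of_pos hq t).ne'
  have := h4 (1 - M)
  field_simp

/-- As with one denominator, except that the second one leaves a factor 1 - q². -/
theorem entry_two_denom {a b c d x y : ℝ} (m₁ m₂ M M' E : ℤ) (ha : a = m₁) (hb : b = m₂) (hc : c = M)
    (hd : d = M')
    (hE : x + y + (1 - m₁) / 2 + (1 - m₂) / 2 - (1 - M) - (1 - M') = (E : ℝ)) :
    (q : ℝ) ^ x * √(qnum q a) * ((q : ℝ) ^ y * (√(qnum q b) / (qnum q c * qnum q d))) =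
      (q : ℝ) ^ E * (1 - (q : ℝ) ^ 2) * (√(gnum (q : ℝ) m₁) * √(gnum (q : ℝ) m₂)) /
        (gnum (q : ℝ) M * gnum (q : ℝ) M') := by
  have hq := q.2.1
  have h1 := one_sub_sq_pos q
  have h2 := Real.sq_sqrt h1.le
  have h3 : √(1 - (q : ℝ) ^ 2) ≠ 0 := (Real.sqrt_pos.mpr h1).ne'
  subst ha hb hc hd
  rw [sqrt_qnum_intCast, sqrt_qnum_intCast, qnum_intCast, qnum_intCast, ← Real.rpow_intCast, ← hE,
    Real.rpow_sub hq _ (1 - M'), Real.rpow_sub hq _ (1 - M), Real.rpow_add hq, Real.rpow_add hq,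
    Real.rpow_add hq]
  by_cases hM : gnum (q : ℝ) M = 0
  · simp [hM]
  by_cases hM' : gnum (q : ℝ) M' = 0
  · simp [hM']
  generalize √(1 - (q : ℝ) ^ 2) = r at h2 h3 ⊢
  rw [← h2]
  have h4 (t : ℝ) : (q : ℝ) ^ t ≠ 0 := (Real.rpow_pos_of_pos hq t).ne'
  have := h4 (1 - M)
  have := h4 (1 - M')
  field_simp

variable (N k p : ℤ)

theorem aPlus_zero_zero : aPlus q (N / 2) (k - N / 2) (p - N / 2 - 1 / 2) 0 0 =
    √(gnum (q : ℝ) (k + 1)) * √(gnum (q : ℝ) (p + 1)) / gnum (q : ℝ) (N + 2) := by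
  have := entry_one_denom q (k + 1) (p + 1) (N + 2) 0 (a := N / 2 + (k - N / 2) + 1)
    (b := N / 2 + (p - N / 2 - 1 / 2) + 3 / 2) (c := 2 * (N / 2) + 2)
    (x := ((k - N / 2) + (p - N / 2 - 1 / 2) - 1 / 2) / 2) (y := -(N / 2) - 1 / 2)
    (by push_cast; ring) (by push_cast; ring) (by push_cast; ring) (by push_cast; ring)
  rw [zpow_zero, one_mul] at this
  exact this

theorem aPlus_one_zero : aPlus q (N / 2) (k - N / 2) (p - N / 2 - 1 / 2) 1 0 =
    (q : ℝ) ^ (N + p + 1) * (1 - (q : ℝ) ^ 2) * (√(gnum (q : ℝ) (k + 1)) *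
      √(gnum (q : ℝ) (N + 1 - p))) / (gnum (q : ℝ) (N + 1) * gnum (q : ℝ) (N + 2)) :=
  entry_two_denom q (k + 1) (N + 1 - p) (N + 1) (N + 2) (N + p + 1)
    (by push_cast; ring) (by push_cast; ring) (by push_cast; ring) (by push_cast; ring)
    (by push_cast; ring)

theorem aPlus_zero_one (n i j : ℝ) : aPlus q n i j 0 1 = 0 := mul_zero _

theorem aPlus_one_one : aPlus q (N / 2) (k - N / 2) (p - N / 2 - 1 / 2) 1 1 =
    √(gnum (q : ℝ) (k + 1)) * √(gnum (q : ℝ) p) / gnum (q : ℝ) (N + 1) := by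
  have := entry_one_denom q (k + 1) p (N + 1) 0 (a := N / 2 + (k - N / 2) + 1)
    (b := N / 2 + (p - N / 2 - 1 / 2) + 1 / 2) (c := 2 * (N / 2) + 1)
    (x := ((k - N / 2) + (p - N / 2 - 1 / 2) - 1 / 2) / 2) (y := -(N / 2))
    (by push_cast; ring) (by ring) (by push_cast; ring) (by push_cast; ring)
  rw [zpow_zero, one_mul] at this
  exact this

theorem aMinus_zero_zero : aMinus q (N / 2) (k - N / 2) (p - N / 2 - 1 / 2) 0 0 =
    (q : ℝ) ^ (k + p + 1) * (√(gnum (q : ℝ) (N - k)) * √(gnum (q : ℝ) (N + 1 - p))) /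
      gnum (q : ℝ) (N + 1) :=
  entry_one_denom q (N - k) (N + 1 - p) (N + 1) (k + p + 1)
    (by push_cast; ring) (by push_cast; ring) (by push_cast; ring) (by push_cast; ring)

theorem aMinus_one_zero (n i j : ℝ) : aMinus q n i j 1 0 = 0 := mul_zero _

theorem aMinus_zero_one : aMinus q (N / 2) (k - N / 2) (p - N / 2 - 1 / 2) 0 1 =
    -((q : ℝ) ^ (k + N) * (1 - (q : ℝ) ^ 2) * (√(gnum (q : ℝ) (N - k)) * √(gnum (q : ℝ) p)) /
      (gnum (q : ℝ) N * gnum (q : ℝ) (N + 1))) := by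
  rw [← entry_two_denom q (N - k) p N (N + 1) (k + N) (a := N / 2 - (k - N / 2))
    (b := N / 2 + (p - N / 2 - 1 / 2) + 1 / 2) (c := 2 * (N / 2)) (d := 2 * (N / 2) + 1)
    (x := ((k - N / 2) + (p - N / 2 - 1 / 2) - 1 / 2) / 2) (y := 1 / 2)
    (by push_cast; ring) (by ring) (by ring) (by push_cast; ring)
    (by push_cast; ring), ← mul_neg]
  rfl

theorem aMinus_one_one : aMinus q (N / 2) (k - N / 2) (p - N / 2 - 1 / 2) 1 1 =
    (q : ℝ) ^ (k + p) * (√(gnum (q : ℝ) (N - k)) * √(gnum (q : ℝ) (N - p))) / gnum (q : ℝ) N :=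
  entry_one_denom q (N - k) (N - p) N (k + p)
    (by push_cast; ring) (by push_cast; ring) (by ring) (by push_cast; ring)

theorem bPlus_zero_zero : bPlus q (N / 2) (k - N / 2) (p - N / 2 - 1 / 2) 0 0 =
    (q : ℝ) ^ p * (√(gnum (q : ℝ) (k + 1)) * √(gnum (q : ℝ) (N + 2 - p))) / gnum (q : ℝ) (N + 2) := by
  have := entry_one_denom q (k + 1) (N + 2 - p) (N + 2) p (a := N / 2 + (k - N / 2) + 1)
    (b := N / 2 - (p - N / 2 - 1 / 2) + 3 / 2) (c := 2 * (N / 2) + 2)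
    (x := ((k - N / 2) + (p - N / 2 - 1 / 2) - 1 / 2) / 2) (y := 0)
    (by push_cast; ring) (by push_cast; ring) (by push_cast; ring) (by push_cast; ring)
  rw [Real.rpow_zero, one_mul] at this
  exact this

theorem bPlus_one_zero : bPlus q (N / 2) (k - N / 2) (p - N / 2 - 1 / 2) 1 0 =
    -((q : ℝ) ^ N * (1 - (q : ℝ) ^ 2) * (√(gnum (q : ℝ) (k + 1)) * √(gnum (q : ℝ) p)) /
      (gnum (q : ℝ) (N + 1) * gnum (q : ℝ) (N + 2))) := by
  rw [← entry_two_denom q (k + 1) p (N + 1) (N + 2) N (a := N / 2 + (k - N / 2) + 1)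
    (b := N / 2 + (p - N / 2 - 1 / 2) + 1 / 2) (c := 2 * (N / 2) + 1) (d := 2 * (N / 2) + 2)
    (x := ((k - N / 2) + (p - N / 2 - 1 / 2) - 1 / 2) / 2) (y := -(N / 2) - 1)
    (by push_cast; ring) (by ring) (by push_cast; ring) (by push_cast; ring)
    (by push_cast; ring), ← mul_neg]
  rfl

theorem bPlus_zero_one (n i j : ℝ) : bPlus q n i j 0 1 = 0 := mul_zero _

theorem bPlus_one_one : bPlus q (N / 2) (k - N / 2) (p - N / 2 - 1 / 2) 1 1 =
    (q : ℝ) ^ (p - 1) * (√(gnum (q : ℝ) (k + 1)) * √(gnum (q : ℝ) (N + 1 - p))) /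
      gnum (q : ℝ) (N + 1) :=
  entry_one_denom q (k + 1) (N + 1 - p) (N + 1) (p - 1)
    (by push_cast; ring) (by push_cast; ring) (by push_cast; ring) (by push_cast; ring)

theorem bMinus_zero_zero : bMinus q (N / 2) (k - N / 2) (p - N / 2 - 1 / 2) 0 0 =
    -((q : ℝ) ^ k * (√(gnum (q : ℝ) (N - k)) * √(gnum (q : ℝ) p)) / gnum (q : ℝ) (N + 1)) := by
  rw [← entry_one_denom q (N - k) p (N + 1) k (a := N / 2 - (k - N / 2))
    (b := N / 2 + (p - N / 2 - 1 / 2) + 1 / 2) (c := 2 * (N / 2) + 1)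
    (x := ((k - N / 2) + (p - N / 2 - 1 / 2) - 1 / 2) / 2) (y := -1 / 2)
    (by push_cast; ring) (by ring) (by push_cast; ring) (by push_cast; ring), ← mul_neg]
  rfl

theorem bMinus_zero_one : bMinus q (N / 2) (k - N / 2) (p - N / 2 - 1 / 2) 0 1 =
    -((q : ℝ) ^ (k + p + N - 1) * (1 - (q : ℝ) ^ 2) * (√(gnum (q : ℝ) (N - k)) *
      √(gnum (q : ℝ) (N + 1 - p))) / (gnum (q : ℝ) N * gnum (q : ℝ) (N + 1))) := by
  rw [← entry_two_denom q (N - k) (N + 1 - p) N (N + 1) (k + p + N - 1) (a := N / 2 - (k - N / 2))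
    (b := N / 2 - (p - N / 2 - 1 / 2) + 1 / 2) (c := 2 * (N / 2)) (d := 2 * (N / 2) + 1)
    (x := ((k - N / 2) + (p - N / 2 - 1 / 2) - 1 / 2) / 2) (y := N / 2)
    (by push_cast; ring) (by push_cast; ring) (by ring) (by push_cast; ring)
    (by push_cast; ring), ← mul_neg]
  rfl

theorem bMinus_one_zero (n i j : ℝ) : bMinus q n i j 1 0 = 0 := mul_zero _

theorem bMinus_one_one : bMinus q (N / 2) (k - N / 2) (p - N / 2 - 1 / 2) 1 1 =
    -((q : ℝ) ^ k * (√(gnum (q : ℝ) (N - k)) * √(gnum (q : ℝ) (p - 1))) / gnum (q : ℝ) N) := by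
  have := entry_one_denom q (N - k) (p - 1) N k (a := N / 2 - (k - N / 2))
    (b := N / 2 + (p - N / 2 - 1 / 2) - 1 / 2) (c := 2 * (N / 2))
    (x := ((k - N / 2) + (p - N / 2 - 1 / 2) - 1 / 2) / 2) (y := 0)
    (by push_cast; ring) (by push_cast; ring) (by ring) (by push_cast; ring)
  rw [← this, Real.rpow_zero, one_mul, ← mul_neg]
  rfl

end Coefficients

/-! ### The representation of Dabrowski et al. -/

section PiPrime

variable (q : Set.Ioo (0 : ℝ) 1)

/-- The cosine of the rotation between the basis of matrix elements and the spinor basis. -/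
def cosRot (N p : ℤ) : ℝ := √(gnum (q : ℝ) (N + 1 - p) / gnum (q : ℝ) (N + 1))

/-- The sine of the rotation between the basis of matrix elements and the spinor basis. -/
def sinRot (N p : ℤ) : ℝ := -((q : ℝ) ^ (N + 1 - p) * √(gnum (q : ℝ) p / gnum (q : ℝ) (N + 1)))

/-- The circle identity is q^{2(N+1-p)} (1 - q^{2p}) + (1 - q^{2(N+1-p)}) = 1 - q^{2(N+1)}. -/
theorem isRot_cosRot : IsRot (cosRot q) (sinRot q) where
  sq_add_sq N p hN hp hpN := by
    have h1 := gnum_pos q (m := N + 1) (by omega)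
    have hq := q.2.1
    rw [cosRot, sinRot, neg_sq, mul_pow,
      Real.sq_sqrt (div_nonneg (gnum_nonneg q (by omega)) h1.le),
      Real.sq_sqrt (div_nonneg (gnum_nonneg q (by omega)) h1.le), mul_div_assoc', ← add_div,
      div_eq_one_iff_eq h1.ne', gnum, gnum, gnum, mul_sub, mul_one, ← mul_pow, ← zpow_add₀ hq.ne',
      sub_add_cancel]
    ring
  cos_top N := by rw [cosRot, sub_self, gnum_zero, zero_div, Real.sqrt_zero]
  sin_zero N := by rw [sinRot, gnum_zero, zero_div, Real.sqrt_zero, mul_zero, neg_zero]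

theorem of_eInt_ne_zero {N k l : ℤ} (h : eInt q N k l ≠ 0) :
    (0 ≤ k ∧ k ≤ N) ∧ (0 ≤ l ∧ l ≤ N) := by
  by_contra h'
  exact h (eInt_eq_zero q N k l (by omega))

theorem rotMat_zero_zero (C S : ℤ → ℤ → ℝ) (N p : ℤ) : rotMat C S N p 0 0 = S N p := rfl
theorem rotMat_zero_one (C S : ℤ → ℤ → ℝ) (N p : ℤ) : rotMat C S N p 0 1 = C N p := rfl
theorem rotMat_one_zero (C S : ℤ → ℤ → ℝ) (N p : ℤ) : rotMat C S N p 1 0 = C N p := rfl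
theorem rotMat_one_one (C S : ℤ → ℤ → ℝ) (N p : ℤ) : rotMat C S N p 1 1 = -S N p := rfl

theorem sq_sqrt_gnum {m : ℤ} (hm : 0 ≤ m) : √(gnum (q : ℝ) m) ^ 2 = 1 - ((q : ℝ) ^ m) ^ 2 :=
  Real.sq_sqrt (gnum_nonneg q hm)

theorem sqrt_gnum_ne_zero {m : ℤ} (hm : 0 < m) : √(gnum (q : ℝ) m) ≠ 0 :=
  (Real.sqrt_pos.mpr (gnum_pos q hm)).ne'

theorem sqrt_gnum_mul_div {a b c d : ℤ} (ha : 0 ≤ a) (hb : 0 ≤ b) (hc : 0 ≤ c) :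
    √(gnum (q : ℝ) a * gnum (q : ℝ) b / (gnum (q : ℝ) c * gnum (q : ℝ) d)) =
      √(gnum (q : ℝ) a) * √(gnum (q : ℝ) b) / (√(gnum (q : ℝ) c) * √(gnum (q : ℝ) d)) := by
  rw [Real.sqrt_div (mul_nonneg (gnum_nonneg q ha) (gnum_nonneg q hb)),
    Real.sqrt_mul (gnum_nonneg q ha), Real.sqrt_mul (gnum_nonneg q hc)]

theorem cosRot_eq {N p : ℤ} (hp : p ≤ N + 1) :
    cosRot q N p = √(gnum (q : ℝ) (N + 1 - p)) / √(gnum (q : ℝ) (N + 1)) :=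
  Real.sqrt_div (gnum_nonneg q (by omega)) _

theorem sinRot_eq {N p : ℤ} (hp : 0 ≤ p) : sinRot q N p =
    -((q : ℝ) ^ (N + 1 - p) * (√(gnum (q : ℝ) p) / √(gnum (q : ℝ) (N + 1)))) := by
  rw [sinRot, Real.sqrt_div (gnum_nonneg q hp)]

theorem gnum_eq_sqrt_sq {m : ℤ} (hm : 0 ≤ m) : gnum (q : ℝ) m = √(gnum (q : ℝ) m) ^ 2 :=
  (Real.sq_sqrt (gnum_nonneg q hm)).symm

theorem isLabel_le {s : Fin 2} {N k p : ℤ} (hl : IsLabel s N k p) : 0 ≤ p ∧ p ≤ N + 1 := by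
  have := hl.2
  split_ifs at this <;> omega

/-- All roots are treated as unknowns whose squares are polynomials in powers of q. With P = q^p, Q
= q^N and K = q^k, every entry becomes an algebraic identity. -/
theorem star_α_v {s : Fin 2} {N k p : ℤ} (hl : IsLabel s N k p) :
    conjRep q (rotEquiv q (isRot_cosRot q)) (star (α q)) (v N k p s) =
      act (aPlus q) N k p (v (N + 1) (k + 1) (p + 1)) s +
        act (aMinus q) N k p (v (N - 1) k p) s := by
  have hp := isLabel_le hl
  have hk := hl.1
  have hq : (q : ℝ) ≠ 0 := q.2.1.ne'
  have hP : (q : ℝ) ^ p ≠ 0 := zpow_ne_zero _ hq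
  have hQ : (q : ℝ) ^ N ≠ 0 := zpow_ne_zero _ hq
  have g1 := sqrt_gnum_ne_zero q (m := N + 1) (by omega)
  have g2 := sqrt_gnum_ne_zero q (m := N + 2) (by omega)
  have s1 := sq_sqrt_gnum q (m := N + 1) (by omega)
  have s2 := sq_sqrt_gnum q (m := N + 2) (by omega)
  have s3 := sq_sqrt_gnum q (m := p) (by omega)
  have s4 := sq_sqrt_gnum q (m := p + 1) (by omega)
  have s5 := sq_sqrt_gnum q (m := N + 1 - p) (by omega)
  have s6 := sq_sqrt_gnum q (m := N) (by omega)
  have hA := star_α_eInt q N k (p - 1)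
  have hB := star_α_eInt q N k p
  rw [sub_add_cancel, show N - (p - 1) = N + 1 - p by ring,
    show k + (p - 1) + 1 = k + p by ring] at hA
  have c₀ := cosRot_eq q hp.2
  have d₀ := sinRot_eq q (N := N) hp.1
  have c₁ := cosRot_eq q (N := N + 1) (p := p + 1) (by omega)
  have d₁ := sinRot_eq q (N := N + 1) (p := p + 1) (by omega)
  rw [show N + 1 + 1 - (p + 1) = N + 1 - p by ring, show N + 1 + 1 = N + 2 by ring] at c₁ d₁
  have d₂ := sinRot_eq q (N := N - 1) (p := p) (by omega)
  rw [sub_add_cancel] at d₂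
  have hz := zpow_add₀ hq
  have hz' := zpow_sub₀ hq
  simp only [hz, hz', zpow_ofNat, pow_one] at s1 s2 s3 s4 s5 s6 d₀ d₁ d₂
  have f1 := gnum_eq_sqrt_sq q (m := N + 1) (by omega)
  have f2 := gnum_eq_sqrt_sq q (m := N + 2) (by omega)
  refine conjRep_v q (isRot_cosRot q) (p₁ := p + 1) (N₁ := N + 1) (k₁ := k + 1) (p₂ := p)
    (by rw [add_sub_cancel_right]; exact hA) hB ?_ ?_ ?_ ?_
  all_goals
    intro he
    have hr := of_eInt_ne_zero q he
    obtain rfl | rfl : s = 0 ∨ s = 1 := by omega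
  all_goals simp only [rotMat_zero_zero, rotMat_zero_one, rotMat_one_zero, rotMat_one_one,
    aPlus_zero_zero, aPlus_zero_one, aPlus_one_zero, aPlus_one_one, aMinus_zero_zero,
    aMinus_zero_one, aMinus_one_zero, aMinus_one_one, c₀, d₀, c₁, d₁, d₂, hz, zpow_ofNat,
    pow_one]
  case refine_1.inl | refine_1.inr | refine_2.inl | refine_2.inr =>
    rw [sqrt_gnum_mul_div q (by omega) (by omega) (by omega)]
    generalize √(gnum (q : ℝ) (N + 1)) = u1 at *
    generalize √(gnum (q : ℝ) (N + 2)) = u2 at *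
    generalize √(gnum (q : ℝ) p) = yp at *
    generalize √(gnum (q : ℝ) (p + 1)) = yp1 at *
    generalize √(gnum (q : ℝ) (N + 1 - p)) = z at *
    generalize √(gnum (q : ℝ) (k + 1)) = x at *
    try rw [f1]
    try rw [f2]
    clear c₀ d₀ c₁ d₁ hA hB d₂ hz hz' he s6 f1 f2
    generalize (q : ℝ) ^ p = P at *
    generalize (q : ℝ) ^ N = Q at *
    field_simp
    all_goals first
      | linear_combination (z * x * yp1) * (s2 - s1)
      | (field_simp at *; grind)
  -- Spin-lowering entries. The split form of the cosine at level N - 1 needs p ≤ N, which comes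
  -- only from the target vector being nonzero.
  all_goals
    have c₂ := cosRot_eq q (N := N - 1) (p := p) (by omega)
    have s8 := sq_sqrt_gnum q (m := N - p) (by omega)
    have g3 := sqrt_gnum_ne_zero q (m := N) (by omega)
    rw [sub_add_cancel] at c₂
    rw [sqrt_gnum_mul_div q (by omega) (by omega) (by omega), c₂]
    have f0 := gnum_eq_sqrt_sq q (m := N) (by omega)
    simp only [hz'] at s8
    generalize √(gnum (q : ℝ) (N + 1)) = u1 at *
    generalize √(gnum (q : ℝ) N) = u2 at *
    generalize √(gnum (q : ℝ) p) = yp at *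
    generalize √(gnum (q : ℝ) (N - p)) = z' at *
    generalize √(gnum (q : ℝ) (N + 1 - p)) = z at *
    generalize √(gnum (q : ℝ) (N - k)) = w at *
    try rw [f1]
    try rw [f0]
    clear c₀ d₀ c₁ d₁ hA hB d₂ c₂ he hz hz' s2 s4 f0 f1 f2
    have hK : (q : ℝ) ^ k ≠ 0 := zpow_ne_zero _ hq
    generalize (q : ℝ) ^ p = P at *
    generalize (q : ℝ) ^ N = Q at *
    generalize (q : ℝ) ^ k = K at *
    field_simp
    all_goals
      field_simp at *
      grind

theorem neg_β_v {s : Fin 2} {N k p : ℤ} (hl : IsLabel s N k p) :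
    conjRep q (rotEquiv q (isRot_cosRot q)) (-β q) (v N k p s) =
      act (bPlus q) N k p (v (N + 1) (k + 1) p) s +
        act (bMinus q) N k p (v (N - 1) k (p - 1)) s := by
  have hp := isLabel_le hl
  have hk := hl.1
  have hq : (q : ℝ) ≠ 0 := q.2.1.ne'
  have hP : (q : ℝ) ^ p ≠ 0 := zpow_ne_zero _ hq
  have hQ : (q : ℝ) ^ N ≠ 0 := zpow_ne_zero _ hq
  have g1 := sqrt_gnum_ne_zero q (m := N + 1) (by omega)
  have g2 := sqrt_gnum_ne_zero q (m := N + 2) (by omega)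
  have s1 := sq_sqrt_gnum q (m := N + 1) (by omega)
  have s2 := sq_sqrt_gnum q (m := N + 2) (by omega)
  have s3 := sq_sqrt_gnum q (m := p) (by omega)
  have s4 := sq_sqrt_gnum q (m := N + 2 - p) (by omega)
  have s5 := sq_sqrt_gnum q (m := N + 1 - p) (by omega)
  have s6 := sq_sqrt_gnum q (m := N) (by omega)
  have hA := neg_β_eInt q N k (p - 1)
  have hB := neg_β_eInt q N k p
  rw [show N + 1 - (p - 1) = N + 2 - p by ring] at hA
  have c₀ := cosRot_eq q hp.2
  have d₀ := sinRot_eq q (N := N) hp.1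
  have c₁ := cosRot_eq q (N := N + 1) (p := p) (by omega)
  have d₁ := sinRot_eq q (N := N + 1) (p := p) (by omega)
  rw [show N + 1 + 1 = N + 2 by ring] at c₁ d₁
  have c₂ := cosRot_eq q (N := N - 1) (p := p - 1) (by omega)
  rw [sub_add_cancel, show N - (p - 1) = N + 1 - p by ring] at c₂
  have hz := zpow_add₀ hq
  have hz' := zpow_sub₀ hq
  simp only [hz, hz', zpow_ofNat, pow_one] at s1 s2 s3 s4 s5 s6 d₀ d₁
  have f1 := gnum_eq_sqrt_sq q (m := N + 1) (by omega)
  have f2 := gnum_eq_sqrt_sq q (m := N + 2) (by omega)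
  refine conjRep_v q (isRot_cosRot q) (p₁ := p) (N₁ := N + 1) (k₁ := k + 1) (p₂ := p - 1)
    hA hB ?_ ?_ ?_ ?_
  all_goals
    intro he
    have hr := of_eInt_ne_zero q he
    obtain rfl | rfl : s = 0 ∨ s = 1 := by omega
  all_goals simp only [rotMat_zero_zero, rotMat_zero_one, rotMat_one_zero, rotMat_one_one,
    bPlus_zero_zero, bPlus_zero_one, bPlus_one_zero, bPlus_one_one, bMinus_zero_zero,
    bMinus_zero_one, bMinus_one_zero, bMinus_one_one, c₀, d₀, c₁, d₁, c₂, hz, hz', zpow_ofNat,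
    pow_one]
  case refine_1.inl | refine_1.inr | refine_2.inl | refine_2.inr =>
    rw [sqrt_gnum_mul_div q (by omega) (by omega) (by omega)]
    generalize √(gnum (q : ℝ) (N + 1)) = u1 at *
    generalize √(gnum (q : ℝ) (N + 2)) = u2 at *
    generalize √(gnum (q : ℝ) p) = yp at *
    generalize √(gnum (q : ℝ) (N + 2 - p)) = zz at *
    generalize √(gnum (q : ℝ) (N + 1 - p)) = z at *
    generalize √(gnum (q : ℝ) (k + 1)) = x at *
    try rw [f1]
    try rw [f2]
    clear c₀ d₀ c₁ d₁ hA hB c₂ hz hz' he s6 f1 f2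
    generalize (q : ℝ) ^ p = P at *
    generalize (q : ℝ) ^ N = Q at *
    field_simp
    all_goals
      field_simp at *
      grind
  -- Spin-lowering entries. The split form of the sine at p - 1 needs p ≥ 1, again known only from
  -- the target vector being nonzero.
  all_goals
    have d₂ := sinRot_eq q (N := N - 1) (p := p - 1) (by omega)
    have s8 := sq_sqrt_gnum q (m := p - 1) (by omega)
    have g3 := sqrt_gnum_ne_zero q (m := N) (by omega)
    have f0 := gnum_eq_sqrt_sq q (m := N) (by omega)
    rw [sub_add_cancel, show N - (p - 1) = N + 1 - p by ring] at d₂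
    rw [sqrt_gnum_mul_div q (by omega) (by omega) (by omega), d₂]
    simp only [hz', hz, zpow_ofNat, pow_one] at s8 ⊢
    generalize √(gnum (q : ℝ) (N + 1)) = u1 at *
    generalize √(gnum (q : ℝ) N) = u2 at *
    generalize √(gnum (q : ℝ) p) = yp at *
    generalize √(gnum (q : ℝ) (p - 1)) = ym at *
    generalize √(gnum (q : ℝ) (N + 1 - p)) = z at *
    generalize √(gnum (q : ℝ) (N - k)) = w at *
    try rw [f1]
    try rw [f0]
    clear c₀ d₀ c₁ d₁ hA hB d₂ c₂ he hz hz' s2 s4 f0 f1 f2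
    have hK : (q : ℝ) ^ k ≠ 0 := zpow_ne_zero _ hq
    generalize (q : ℝ) ^ p = P at *
    generalize (q : ℝ) ^ N = Q at *
    generalize (q : ℝ) ^ k = K at *
    field_simp
    all_goals
      field_simp at *
      grind

end PiPrime

/-! ### Matrix entries of operators on `H` -/

section Entries

theorem v_eq_single (x : HLabel) [DecidableEq HLabel] :
    v x.1.2.1 x.1.2.2.1 x.1.2.2.2 x.1.1 = lp.single 2 x 1 := by
  obtain ⟨⟨s, N, k, p⟩, hx⟩ := x
  rw [v, dif_pos hx]
  congr!

theorem v_apply (N k p : ℤ) (s : Fin 2) (x : HLabel) :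
    v N k p s x = if x.1 = (s, N, k, p) then 1 else 0 := by
  classical
  by_cases h : IsLabel s N k p
  · rw [v, dif_pos h, lp.single_apply, Pi.single_apply]
    simp only [Subtype.ext_iff]
  · rw [v, dif_neg h, if_neg (fun he => h (by simpa [he] using x.2))]
    rfl

theorem inner_v_left (x : HLabel) (y : H) :
    ⟪v x.1.2.1 x.1.2.2.1 x.1.2.2.2 x.1.1, y⟫_ℂ = y x := by
  classical
  rw [v_eq_single, lp.inner_single_left]
  simp

theorem star_v_apply (T : H →L[ℂ] H) (x y : HLabel) :
    star T (v x.1.2.1 x.1.2.2.1 x.1.2.2.2 x.1.1) y =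
      star (T (v y.1.2.1 y.1.2.2.1 y.1.2.2.2 y.1.1) x) := by
  rw [← inner_v_left, ← inner_v_left x, ContinuousLinearMap.star_eq_adjoint,
    ContinuousLinearMap.adjoint_inner_right]
  exact (inner_conj_symm _ _).symm

/-- The coordinates of T* x are the inner products of x with the vectors T v, so the values on the
basis determine T*, and hence T, without a density argument. -/
theorem ext_v {S T : H →L[ℂ] H}
    (h : ∀ s N k p, IsLabel s N k p → S (v N k p s) = T (v N k p s)) : S = T := by
  refine star_injective (ContinuousLinearMap.ext fun x => lp.ext <| funext fun y => ?_)
  rw [← inner_v_left, ← inner_v_left, ContinuousLinearMap.star_eq_adjoint,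
    ContinuousLinearMap.star_eq_adjoint, ContinuousLinearMap.adjoint_inner_right,
    ContinuousLinearMap.adjoint_inner_right, h _ _ _ _ y.2]

/-- The adjoint of a sum of two matrix-weighted shifts. -/
theorem star_apply_v {T : H →L[ℂ] H} {A B : ℤ → ℤ → ℤ → Matrix (Fin 2) (Fin 2) ℝ} {a b c d : ℤ}
    (hT : ∀ s N k p, IsLabel s N k p → T (v N k p s) =
      ∑ r, (A N k p r s : ℂ) • v (N + 1) (k + a) (p + b) r +
        ∑ r, (B N k p r s : ℂ) • v (N - 1) (k + c) (p + d) r)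
    {s : Fin 2} {N k p : ℤ} (hl : IsLabel s N k p) :
    star T (v N k p s) =
      ∑ r, (B (N + 1) (k - c) (p - d) s r : ℂ) • v (N + 1) (k - c) (p - d) r +
        ∑ r, (A (N - 1) (k - a) (p - b) s r : ℂ) • v (N - 1) (k - a) (p - b) r := by
  refine lp.ext <| funext fun y => ?_
  rw [star_v_apply T ⟨(s, N, k, p), hl⟩ y]
  obtain ⟨⟨r, N', k', p'⟩, hy⟩ := y
  rw [hT _ _ _ _ hy]
  simp only [Fin.sum_univ_two, lp.coeFn_add, lp.coeFn_smul, Pi.add_apply, Pi.smul_apply, v_apply,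
    smul_eq_mul, Prod.mk.injEq, mul_ite, mul_one, mul_zero]
  have h1 : (N = N' + 1 ∧ k = k' + a ∧ p = p' + b) ↔ (N' = N - 1 ∧ k' = k - a ∧ p' = p - b) := by
    omega
  have h2 : (N = N' - 1 ∧ k = k' + c ∧ p = p' + d) ↔ (N' = N + 1 ∧ k' = k - c ∧ p' = p - d) := by
    omega
  simp only [h1, h2]
  by_cases h3 : N' = N - 1 ∧ k' = k - a ∧ p' = p - b
  · have h4 : ¬ (N' = N + 1 ∧ k' = k - c ∧ p' = p - d) := by omega
    obtain ⟨rfl, rfl, rfl⟩ := h3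
    simp only [h4, and_false, if_false]
    fin_cases s <;> fin_cases r <;> simp
  · by_cases h4 : N' = N + 1 ∧ k' = k - c ∧ p' = p - d
    · obtain ⟨rfl, rfl, rfl⟩ := h4
      simp only [h3, and_false, if_false]
      fin_cases s <;> fin_cases r <;> simp
    · simp only [h3, h4, and_false, if_false]
      simp

end Entries

/-! ### The four formulas for π' -/

section PiPrime

variable (q : Set.Ioo (0 : ℝ) 1)

/-- The formulas for α and -β* are the adjoints of those for α* and -β, because a *-representation
preserves adjoints and the matrices with a tilde are the corresponding conjugate transposes. -/
theorem isPiPrime_conjRep : IsPiPrime q (conjRep q (rotEquiv q (isRot_cosRot q))) where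
  star_alpha _ _ _ _ := star_α_v q
  neg_beta _ _ _ _ := neg_β_v q
  alpha s N k p hl := by
    have h := star_apply_v (a := 1) (b := 1) (c := 0) (d := 0)
      (A := fun N k p => aPlus q (N / 2) (k - N / 2) (p - N / 2 - 1 / 2))
      (B := fun N k p => aMinus q (N / 2) (k - N / 2) (p - N / 2 - 1 / 2))
      (fun s N k p hl => by
        rw [add_zero, add_zero]
        exact star_α_v q hl) hl
    rw [← map_star, star_star, sub_zero, sub_zero] at h
    rw [h]
    simp only [act, aTildePlus, aTildeMinus, Matrix.conjTranspose_apply, star_trivial]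
    congr! 5 <;> (push_cast; ring)
  neg_star_beta s N k p hl := by
    have h := star_apply_v (a := 1) (b := 0) (c := 0) (d := -1)
      (A := fun N k p => bPlus q (N / 2) (k - N / 2) (p - N / 2 - 1 / 2))
      (B := fun N k p => bMinus q (N / 2) (k - N / 2) (p - N / 2 - 1 / 2))
      (fun s N k p hl => by
        rw [add_zero, add_zero]
        exact neg_β_v q hl) hl
    rw [← map_star, star_neg, sub_zero, sub_zero, sub_neg_eq_add] at h
    rw [h]
    simp only [act, bTildePlus, bTildeMinus, Matrix.conjTranspose_apply, star_trivial]
    congr! 5 <;> (push_cast; ring)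

end PiPrime

/-! ### Weighted shifts in the ideal `Kq` -/

section Ideal

variable (q : Set.Ioo (0 : ℝ) 1)

theorem qPow_v {s : Fin 2} {N k p : ℤ} :
    qPow q (v N k p s) = (((q : ℝ) ^ ((N : ℝ) / 2) : ℝ) : ℂ) • v N k p s := by
  refine lp.ext <| funext fun y => ?_
  rw [qPow, wpull_apply, lp.coeFn_smul, Pi.smul_apply, smul_eq_mul, id, v_apply]
  split_ifs with h
  · rw [h]
  · rw [mul_zero, mul_zero]

/-- Bounded weighted shifts between the two halves of the basis are bounded operators. -/
theorem exists_shift (s r : Fin 2) (n a b : ℤ) (m : ℤ → ℤ → ℤ → ℝ) {C : ℝ} (hC : 0 < C)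
    (hm : ∀ N k p, IsLabel s N k p → IsLabel r (N + n) (k + a) (p + b) → |m N k p| ≤ C) :
    ∃ T : H →L[ℂ] H, ∀ s' N k p, IsLabel s' N k p → T (v N k p s') =
      if s' = s then (m N k p : ℂ) • v (N + n) (k + a) (p + b) r else 0 := by
  -- The index set of the arrows of the shift, those whose source and target are both valid labels.
  let κ : Type := {x : HLabel // x.1.1 = s ∧ IsLabel r (x.1.2.1 + n) (x.1.2.2.1 + a) (x.1.2.2.2 + b)}
  let σ₁ : κ → HLabel := Subtype.val
  let σ₂ : κ → HLabel := fun x =>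
    ⟨(r, x.1.1.2.1 + n, x.1.1.2.2.1 + a, x.1.1.2.2.2 + b), x.2.2⟩
  have h₁ : Function.Injective σ₁ := Subtype.val_injective
  have h₂ : Function.Injective σ₂ := by
    rintro ⟨⟨⟨s₁, N₁, k₁, p₁⟩, _⟩, rfl, _⟩ ⟨⟨⟨s₂, N₂, k₂, p₂⟩, _⟩, h, _⟩ he
    simp only [σ₂, Subtype.mk.injEq, Prod.mk.injEq, add_left_inj, true_and] at he h
    obtain ⟨rfl, rfl, rfl⟩ := he
    simp [h]
  let c : κ → ℝ := fun x => m x.1.1.2.1 x.1.1.2.2.1 x.1.1.2.2.2 / C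
  have hc (x : κ) : |c x| ≤ 1 := by
    rw [abs_div, abs_of_pos hC, div_le_one hC]
    refine hm _ _ _ ?_ x.2.2
    have := x.1.2
    rwa [x.2.1] at this
  -- Read off the weighted coordinates at the sources, then insert them at the targets by the
  -- adjoint of a pull-back. Dividing by C makes the weights at most one, as `wpull` requires.
  refine ⟨(C : ℂ) • ContinuousLinearMap.adjoint (wpull σ₂ h₂ (fun _ => 1) (by simp)) ∘L
    wpull σ₁ h₁ c hc, fun s' N k p hl => ?_⟩
  refine lp.ext <| funext fun y => ?_
  rw [smul_apply, ContinuousLinearMap.comp_apply, lp.coeFn_smul, Pi.smul_apply]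
  have hC' : (C : ℂ) ≠ 0 := by exact_mod_cast hC.ne'
  by_cases hy : ∃ x, σ₂ x = y
  · obtain ⟨x, rfl⟩ := hy
    rw [adjoint_wpull_apply, wpull_apply, v_apply]
    obtain ⟨⟨⟨s₁, N₁, k₁, p₁⟩, hl₁⟩, rfl, hr⟩ := x
    simp only [σ₁, σ₂, c, Prod.mk.injEq]
    by_cases hs : s' = s₁
    · subst hs
      simp only [if_true, lp.coeFn_smul, Pi.smul_apply, v_apply, Prod.mk.injEq, add_left_inj,
        true_and]
      by_cases hN : N₁ = N ∧ k₁ = k ∧ p₁ = p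
      · obtain ⟨rfl, rfl, rfl⟩ := hN
        simp
        field_simp
      · simp [hN]
    · have hs' : ¬ s₁ = s' := fun h => hs h.symm
      simp [hs, hs']
  · rw [adjoint_wpull_apply_of_notMem _ _ _ _ _ _ (fun k hk => hy ⟨k, hk⟩), smul_zero]
    by_cases hs : s' = s
    · subst hs
      rw [if_pos rfl, lp.coeFn_smul, Pi.smul_apply, v_apply, if_neg, smul_zero]
      intro he
      refine hy ⟨⟨⟨(s', N, k, p), hl⟩, rfl, ?_⟩, Subtype.ext he.symm⟩
      have := y.2
      rw [he] at this
      exact this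
    · rw [if_neg hs]
      rfl

variable {q}

theorem qPow_mem_Kq : qPow q ∈ Kq q := TwoSidedIdeal.subset_span rfl

/-- The entries are O(q^N) while `qPow` has weight q^{N/2}. Dividing by this weight leaves bounded
coefficients, so T is a bounded sum of shifts times `qPow`. -/
theorem mem_Kq_of_shift {T : H →L[ℂ] H} {A B : ℤ → ℤ → ℤ → Matrix (Fin 2) (Fin 2) ℝ}
    {a b c d : ℤ} {C : ℝ} (hC : 0 < C)
    (hT : ∀ s N k p, IsLabel s N k p → T (v N k p s) =
      ∑ r, (A N k p r s : ℂ) • v (N + 1) (k + a) (p + b) r +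
        ∑ r, (B N k p r s : ℂ) • v (N - 1) (k + c) (p + d) r)
    (hA : ∀ s r N k p, IsLabel s N k p → IsLabel r (N + 1) (k + a) (p + b) →
      |A N k p r s| ≤ C * (q : ℝ) ^ N)
    (hB : ∀ s r N k p, IsLabel s N k p → IsLabel r (N - 1) (k + c) (p + d) →
      |B N k p r s| ≤ C * (q : ℝ) ^ N) :
    T ∈ Kq q := by
  have hq := q.2.1
  have hpos (N : ℤ) : 0 < (q : ℝ) ^ ((N : ℝ) / 2) := Real.rpow_pos_of_pos hq _
  have hle {s : Fin 2} {N k p : ℤ} (hl : IsLabel s N k p) :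
      (q : ℝ) ^ N ≤ (q : ℝ) ^ ((N : ℝ) / 2) := by
    rw [← Real.rpow_intCast]
    refine Real.rpow_le_rpow_of_exponent_ge hq q.2.2.le ?_
    have : (0 : ℝ) ≤ N := by exact_mod_cast hl.1.1.trans hl.1.2
    linarith
  have key {x : ℝ} {s : Fin 2} {N k p : ℤ} (hl : IsLabel s N k p) (hx : |x| ≤ C * (q : ℝ) ^ N) :
      |x / (q : ℝ) ^ ((N : ℝ) / 2)| ≤ C := by
    rw [abs_div, abs_of_pos (hpos N), div_le_iff₀ (hpos N)]
    exact hx.trans (mul_le_mul_of_nonneg_left (hle hl) hC.le)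
  choose S hS using fun s r => exists_shift s r 1 a b
    (fun N k p => A N k p r s / (q : ℝ) ^ ((N : ℝ) / 2)) hC
    (fun N k p hl hr => key hl (hA s r N k p hl hr))
  choose S' hS' using fun s r => exists_shift s r (-1) c d
    (fun N k p => B N k p r s / (q : ℝ) ^ ((N : ℝ) / 2)) hC
    (fun N k p hl hr => key hl (hB s r N k p hl hr))
  have e : T = (∑ s, ∑ r, (S s r + S' s r)) * qPow q := by
    refine ext_v fun s N k p hl => ?_
    rw [hT s N k p hl, mul_apply_eq_comp, qPow_v, map_smul]
    simp only [sum_apply, add_apply, hS _ _ _ _ _ _ hl, hS' _ _ _ _ _ _ hl]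
    simp only [Finset.sum_add_distrib, smul_add]
    congr 1
    all_goals
      rw [Finset.sum_comm, Finset.smul_sum]
      refine Finset.sum_congr rfl fun r _ => ?_
      rw [Finset.sum_ite_eq, if_pos (Finset.mem_univ _), smul_smul, ← Complex.ofReal_mul,
        mul_div_cancel₀ _ (hpos N).ne']
    rfl
  rw [e]
  exact (Kq q).mul_mem_left _ _ qPow_mem_Kq

/-- The adjoint is again a sum of two shifts, with transposed matrices taken at level N ± 1; the
constant C / q absorbs the change from q^{N-1} to q^N. -/
theorem star_mem_Kq_of_shift {T : H →L[ℂ] H} {A B : ℤ → ℤ → ℤ → Matrix (Fin 2) (Fin 2) ℝ}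
    {a b c d : ℤ} {C : ℝ} (hC : 0 < C)
    (hT : ∀ s N k p, IsLabel s N k p → T (v N k p s) =
      ∑ r, (A N k p r s : ℂ) • v (N + 1) (k + a) (p + b) r +
        ∑ r, (B N k p r s : ℂ) • v (N - 1) (k + c) (p + d) r)
    (hA : ∀ s r N k p, IsLabel s N k p → IsLabel r (N + 1) (k + a) (p + b) →
      |A N k p r s| ≤ C * (q : ℝ) ^ N)
    (hB : ∀ s r N k p, IsLabel s N k p → IsLabel r (N - 1) (k + c) (p + d) →
      |B N k p r s| ≤ C * (q : ℝ) ^ N) :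
    star T ∈ Kq q := by
  have hq := q.2.1
  have hC' : 0 < C / q := div_pos hC hq
  refine mem_Kq_of_shift (a := -c) (b := -d) (c := -a) (d := -b) hC'
    (A := fun N k p => (B (N + 1) (k - c) (p - d)).transpose)
    (B := fun N k p => (A (N - 1) (k - a) (p - b)).transpose)
    (fun s N k p hl => star_apply_v hT hl) (fun s r N k p hl hr => ?_) (fun s r N k p hl hr => ?_)
  · refine (hB r s (N + 1) (k - c) (p - d) hr (by simpa using hl)).trans ?_
    have h1 : (q : ℝ) ^ (N + 1) = (q : ℝ) ^ N * q := zpow_add_one₀ hq.ne' N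
    have h2 : 0 < (q : ℝ) ^ N := zpow_pos hq _
    have h3 : (q : ℝ) * q ≤ 1 := mul_le_one₀ q.2.2.le hq.le q.2.2.le
    rw [h1, div_mul_eq_mul_div, le_div_iff₀ hq]
    calc C * ((q : ℝ) ^ N * q) * q = C * (q : ℝ) ^ N * (q * q) := by ring
      _ ≤ C * (q : ℝ) ^ N * 1 := by gcongr
      _ = C * (q : ℝ) ^ N := mul_one _
  · refine (hA r s (N - 1) (k - a) (p - b) hr (by simpa using hl)).trans ?_
    rw [zpow_sub_one₀ hq.ne']
    apply le_of_eq
    field_simp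

end Ideal

/-! ### The unitary `U` and the comparison of the two representations -/

/-! ### Exponential estimates for the matrix entries -/

section Estimates

variable (q : Set.Ioo (0 : ℝ) 1)

/-- A constant `C` such that the matrix entries compared below differ by at most `C * q ^ N`. -/
def decayConst : ℝ := 12 / (1 - (q : ℝ) ^ 2) ^ 2

theorem gnum_le_one (m : ℤ) : gnum (q : ℝ) m ≤ 1 := by
  rw [gnum]
  linarith [sq_nonneg ((q : ℝ) ^ m)]

theorem sqrt_gnum_le_one (m : ℤ) : √(gnum (q : ℝ) m) ≤ 1 := Real.sqrt_le_one.mpr (gnum_le_one q m)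

theorem zpow_le_zpow_of_le {m n : ℤ} (h : m ≤ n) : (q : ℝ) ^ n ≤ (q : ℝ) ^ m :=
  zpow_le_zpow_right_of_le_one₀ q.2.1 q.2.2.le h

theorem one_sub_gnum_le {N m : ℤ} (hm : 0 ≤ m) (hN : N ≤ m) : 1 - gnum (q : ℝ) m ≤ (q : ℝ) ^ N := by
  have h1 : (q : ℝ) ^ m ≤ 1 := by simpa using zpow_le_zpow_of_le q hm
  have h2 : 0 < (q : ℝ) ^ m := zpow_pos q.2.1 _
  have h3 := zpow_le_zpow_of_le q hN
  rw [gnum]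
  nlinarith

theorem gnum_le_sqrt_gnum {m : ℤ} (hm : 0 ≤ m) : gnum (q : ℝ) m ≤ √(gnum (q : ℝ) m) := by
  refine Real.le_sqrt_of_sq_le ?_
  nlinarith [gnum_le_one q m, gnum_nonneg q hm]

theorem one_sub_sq_le_gnum {m : ℤ} (hm : 1 ≤ m) : 1 - (q : ℝ) ^ 2 ≤ gnum (q : ℝ) m := by
  have h2 : 0 < (q : ℝ) ^ m := zpow_pos q.2.1 _
  have h3 : (q : ℝ) ^ m ≤ q := by simpa using zpow_le_zpow_of_le q hm
  rw [gnum]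
  nlinarith

theorem abs_sqrt_gnum_sub_le {N m n : ℤ} (hm : 0 ≤ m) (hn : 0 ≤ n) (hNm : N ≤ m) (hNn : N ≤ n) :
    |√(gnum (q : ℝ) m) - √(gnum (q : ℝ) n)| ≤ (q : ℝ) ^ N := by
  have h1 := (one_sub_gnum_le q hm hNm)
  have h2 := (one_sub_gnum_le q hn hNn)
  have h3 := gnum_le_sqrt_gnum q hm
  have h4 := gnum_le_sqrt_gnum q hn
  have h5 := sqrt_gnum_le_one q m
  have h6 := sqrt_gnum_le_one q n
  rw [abs_le]
  constructor <;> linarith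

/-- Replacing the denominators by one. -/
theorem abs_mul_div_sub_le {x t u c : ℝ} (hx : 0 ≤ x) (hx1 : x ≤ 1) (hc : 0 < c) (hu : c ≤ u)
    (hu1 : u ≤ 1) (ht : 1 - u ≤ t) : |x / u - x| ≤ t / c := by
  have hu0 := hc.trans_le hu
  have : x / u - x = x * (1 - u) / u := by field_simp
  rw [this, abs_of_nonneg (by have := sub_nonneg.mpr hu1; positivity)]
  have h1 : 0 ≤ 1 - u := by linarith
  exact div_le_div₀ (h1.trans ht) ((mul_le_of_le_one_left h1 hx1).trans ht) hc hu

theorem sq_one_sub_sq_le : (1 - (q : ℝ) ^ 2) ^ 2 ≤ 1 - (q : ℝ) ^ 2 := by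
  have h1 := one_sub_sq_pos q
  have h2 := sq_nonneg (q : ℝ)
  nlinarith

theorem one_sub_sqrt_mul_le {N M : ℤ} (hM : 1 ≤ M) (hN : N ≤ M) :
    1 - √(gnum (q : ℝ) M) * √(gnum (q : ℝ) (M + 1)) ≤ 2 * (q : ℝ) ^ N ∧
      (1 - (q : ℝ) ^ 2) ^ 2 ≤ √(gnum (q : ℝ) M) * √(gnum (q : ℝ) (M + 1)) ∧
      √(gnum (q : ℝ) M) * √(gnum (q : ℝ) (M + 1)) ≤ 1 := by
  have h1 := one_sub_gnum_le q (by omega) hN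
  have h2 := one_sub_gnum_le q (by omega) (show N ≤ M + 1 by omega)
  have h3 := gnum_le_sqrt_gnum q (m := M) (by omega)
  have h4 := gnum_le_sqrt_gnum q (m := M + 1) (by omega)
  have h5 := sqrt_gnum_le_one q M
  have h6 := sqrt_gnum_le_one q (M + 1)
  have h7 := one_sub_sq_le_gnum q hM
  have h8 := one_sub_sq_le_gnum q (show 1 ≤ M + 1 by omega)
  have h9 := one_sub_sq_pos q
  refine ⟨?_, ?_, ?_⟩
  · nlinarith
  · rw [sq]
    gcongr <;> linarith
  · nlinarith

/-- The first term is an entry of U(π ⊕ π)U*, the second one of π'. Both denominators are 1 - O(q^N)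
and bounded below by (1 - q²)², so they may be replaced by 1. What remains is the difference of the
roots at l and l', which the prefactor q^a makes small by hypothesis. -/
theorem abs_entry_sub_le {N a m l l' M M' : ℤ} (ha : 0 ≤ a) (hm : 0 ≤ m) (hl : 0 ≤ l)
    (hM : 1 ≤ M) (hNM : N ≤ M) (hM' : 1 ≤ M') (hNM' : N ≤ M')
    (h : (q : ℝ) ^ a * |√(gnum (q : ℝ) l) - √(gnum (q : ℝ) l')| ≤ (q : ℝ) ^ N) :
    |(q : ℝ) ^ a * √(gnum (q : ℝ) m * gnum (q : ℝ) l / (gnum (q : ℝ) M * gnum (q : ℝ) (M + 1))) -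
      (q : ℝ) ^ a * (√(gnum (q : ℝ) m) * √(gnum (q : ℝ) l')) / gnum (q : ℝ) M'| ≤
      decayConst q * (q : ℝ) ^ N := by
  obtain ⟨h1, h2, h3⟩ := one_sub_sqrt_mul_le q hM hNM
  have hc := one_sub_sq_pos q
  have h4 := one_sub_gnum_le q (by omega) hNM'
  have h5 := (sq_one_sub_sq_le q).trans (one_sub_sq_le_gnum q hM')
  rw [sqrt_gnum_mul_div q hm hl (by omega)]
  have hqa : (q : ℝ) ^ a ≤ 1 := by simpa using zpow_le_zpow_of_le q ha
  have hqa' : 0 < (q : ℝ) ^ a := zpow_pos q.2.1 _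
  have e0 := sqrt_gnum_le_one q m
  have e1 := sqrt_gnum_le_one q l
  have e2 := sqrt_gnum_le_one q l'
  have x0 := Real.sqrt_nonneg (gnum (q : ℝ) m)
  have x1 := Real.sqrt_nonneg (gnum (q : ℝ) l)
  have x2 := Real.sqrt_nonneg (gnum (q : ℝ) l')
  have h6 := gnum_le_one q M'
  have hqN : 0 < (q : ℝ) ^ N := zpow_pos q.2.1 _
  generalize √(gnum (q : ℝ) M) * √(gnum (q : ℝ) (M + 1)) = u at *
  generalize gnum (q : ℝ) M' = u' at *
  generalize √(gnum (q : ℝ) m) = x at *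
  generalize √(gnum (q : ℝ) l) = y at *
  generalize √(gnum (q : ℝ) l') = y' at *
  generalize (q : ℝ) ^ a = A at *
  generalize (q : ℝ) ^ N = Q at *
  have hc2 : 0 < (1 - (q : ℝ) ^ 2) ^ 2 := by positivity
  have b1 := abs_mul_div_sub_le (x := A * (x * y)) (by positivity)
    (mul_le_one₀ hqa (by positivity) (mul_le_one₀ e0 x1 e1)) hc2 h2 h3 h1
  have b2 := abs_mul_div_sub_le (x := A * (x * y')) (by positivity)
    (mul_le_one₀ hqa (by positivity) (mul_le_one₀ e0 x2 e2)) hc2 h5 h6 h4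
  have b3 : |A * (x * y) - A * (x * y')| ≤ Q := by
    rw [show A * (x * y) - A * (x * y') = x * (A * (y - y')) by ring, abs_mul, abs_mul,
      abs_of_nonneg x0, abs_of_pos hqa']
    exact (mul_le_of_le_one_left (by positivity) e0).trans h
  have b4 : Q ≤ Q / (1 - (q : ℝ) ^ 2) ^ 2 := by
    rw [le_div_iff₀ hc2]
    refine mul_le_of_le_one_right hqN.le (h2.trans h3)
  have b5 : decayConst q * Q = 12 * (Q / (1 - (q : ℝ) ^ 2) ^ 2) := by
    rw [decayConst]; ring
  rw [← mul_div_assoc, b5]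
  rw [mul_div_assoc 2] at b1
  rw [abs_le] at *
  constructor <;> linarith

theorem abs_entry_le {N a m l M : ℤ} (ha : N ≤ a) (hm : 0 ≤ m) (hl : 0 ≤ l) (hM : 1 ≤ M) :
    |(q : ℝ) ^ a * √(gnum (q : ℝ) m * gnum (q : ℝ) l / (gnum (q : ℝ) M * gnum (q : ℝ) (M + 1)))| ≤
      decayConst q / 12 * (q : ℝ) ^ N := by
  obtain ⟨-, h2, h3⟩ := one_sub_sqrt_mul_le q hM le_rfl
  have hq : 0 < (q : ℝ) := q.2.1
  have hc := one_sub_sq_pos q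
  have hqa := zpow_le_zpow_of_le q ha
  have hqa' : 0 < (q : ℝ) ^ a := zpow_pos q.2.1 _
  have e0 := sqrt_gnum_le_one q m
  have e1 := sqrt_gnum_le_one q l
  have x0 := Real.sqrt_nonneg (gnum (q : ℝ) m)
  have x1 := Real.sqrt_nonneg (gnum (q : ℝ) l)
  rw [abs_of_nonneg (by positivity), sqrt_gnum_mul_div q hm hl (by omega), ← mul_div_assoc,
    decayConst, div_right_comm, div_mul_eq_mul_div]
  refine div_le_div₀ (by positivity) ?_ (by positivity) h2
  norm_num
  exact (mul_le_of_le_one_right hqa'.le (mul_le_one₀ e0 x1 e1)).trans hqa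

theorem abs_entry_one_le {N a m l M : ℤ} (ha : N ≤ a) (hM : 1 ≤ M) :
    |(q : ℝ) ^ a * (√(gnum (q : ℝ) m) * √(gnum (q : ℝ) l)) / gnum (q : ℝ) M| ≤
      decayConst q / 12 * (q : ℝ) ^ N := by
  have h2 := (sq_one_sub_sq_le q).trans (one_sub_sq_le_gnum q hM)
  have hq : 0 < (q : ℝ) := q.2.1
  have hc := one_sub_sq_pos q
  have hqa := zpow_le_zpow_of_le q ha
  have hqa' : 0 < (q : ℝ) ^ a := zpow_pos q.2.1 _
  have e0 := sqrt_gnum_le_one q m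
  have e1 := sqrt_gnum_le_one q l
  have x0 := Real.sqrt_nonneg (gnum (q : ℝ) m)
  have x1 := Real.sqrt_nonneg (gnum (q : ℝ) l)
  have := gnum_pos q (show 0 < M by omega)
  rw [abs_of_nonneg (by positivity), decayConst, div_right_comm, div_mul_eq_mul_div]
  refine div_le_div₀ (by positivity) ?_ (by positivity) h2
  norm_num
  exact (mul_le_of_le_one_right hqa'.le (mul_le_one₀ e0 x1 e1)).trans hqa

theorem abs_entry_two_le {N a m l M M' : ℤ} (ha : N ≤ a) (hM : 1 ≤ M) (hM' : 1 ≤ M') :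
    |(q : ℝ) ^ a * (1 - (q : ℝ) ^ 2) * (√(gnum (q : ℝ) m) * √(gnum (q : ℝ) l)) /
      (gnum (q : ℝ) M * gnum (q : ℝ) M')| ≤ decayConst q / 12 * (q : ℝ) ^ N := by
  have h2 := one_sub_sq_le_gnum q hM
  have h2' := one_sub_sq_le_gnum q hM'
  have hq : 0 < (q : ℝ) := q.2.1
  have hc := one_sub_sq_pos q
  have hc1 : 1 - (q : ℝ) ^ 2 ≤ 1 := by linarith [sq_nonneg (q : ℝ)]
  have hqa := zpow_le_zpow_of_le q ha
  have hqa' : 0 < (q : ℝ) ^ a := zpow_pos q.2.1 _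
  have e0 := sqrt_gnum_le_one q m
  have e1 := sqrt_gnum_le_one q l
  have x0 := Real.sqrt_nonneg (gnum (q : ℝ) m)
  have x1 := Real.sqrt_nonneg (gnum (q : ℝ) l)
  have := gnum_pos q (show 0 < M by omega)
  have := gnum_pos q (show 0 < M' by omega)
  rw [abs_of_nonneg (by positivity), decayConst, div_right_comm, div_mul_eq_mul_div, sq (1 - (q : ℝ) ^ 2)]
  refine div_le_div₀ (by positivity) ?_ (by positivity) (by gcongr)
  norm_num
  exact (mul_le_of_le_one_right (by positivity) (mul_le_one₀ e0 x1 e1)).trans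
    ((mul_le_of_le_one_right hqa'.le hc1).trans hqa)

end Estimates

/-! ### The degenerate rotation and matrices in rotated bases -/

section Comparison

/-- The degenerate rotation: the cosine. -/
def cosTop (N p : ℤ) : ℝ := if p = N + 1 then 0 else 1

/-- The degenerate rotation: the sine. -/
def sinTop (N p : ℤ) : ℝ := if p = N + 1 ∧ p ≠ 0 then 1 else 0

theorem isRot_cosTop : IsRot cosTop sinTop where
  sq_add_sq N p hN hp hpN := by
    rw [cosTop, sinTop]
    by_cases h : p = N + 1
    · rw [if_pos h, if_pos ⟨h, by omega⟩]
      norm_num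
    · rw [if_neg h, if_neg (fun h' => h h'.1)]
      norm_num
  cos_top N := if_pos rfl
  -- `IsRot` asks for this at every integer N, including N = -1 where p = 0 equals N + 1; hence the
  -- clause p ≠ 0 in `sinTop`.
  sin_zero N := if_neg (by simp)

theorem rotMat_cosTop_of_ne {N p : ℤ} (h : p ≠ N + 1) :
    rotMat cosTop sinTop N p = !![0, 1; 1, 0] := by
  rw [rotMat, cosTop, sinTop, if_neg h, if_neg (fun h' => h h'.1), neg_zero]

theorem rotMat_cosTop_top {N : ℤ} (hN : 0 ≤ N) :
    rotMat cosTop sinTop N (N + 1) = !![1, 0; 0, -1] := by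
  rw [rotMat, cosTop, sinTop, if_pos rfl, if_pos ⟨rfl, by omega⟩]

/-- The matrix of a sum of diagonal operators in the rotated bases. -/
def rotDiag (R R' : Matrix (Fin 2) (Fin 2) ℝ) (A B : ℝ) : Matrix (Fin 2) (Fin 2) ℝ :=
  Matrix.of fun r s => R s 0 * A * R' r 0 + R s 1 * B * R' r 1

variable (q : Set.Ioo (0 : ℝ) 1) {C S : ℤ → ℤ → ℝ} (h : IsRot C S)
include h

/-- The operator is diagonal in the unrotated bases. Since the target rotation is orthogonal,
conjugating the diagonal matrix by the two rotations gives the matrix in the rotated bases. -/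
theorem conjRep_v_rotDiag {x : Alg (q : ℝ)} {N k p N₁ k₁ p₁ N₂ k₂ p₂ : ℤ} {s : Fin 2}
    {A₁ B₁ A₂ B₂ : ℝ}
    (hA : leftReg q x (eInt q N k (p - 1)) = (A₁ : ℂ) • eInt q N₁ k₁ (p₁ - 1) +
      (A₂ : ℂ) • eInt q N₂ k₂ (p₂ - 1))
    (hB : leftReg q x (eInt q N k p) = (B₁ : ℂ) • eInt q N₁ k₁ p₁ + (B₂ : ℂ) • eInt q N₂ k₂ p₂) :
    conjRep q (rotEquiv q h) x (v N k p s) =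
      ∑ r, (rotDiag (rotMat C S N p) (rotMat C S N₁ p₁) A₁ B₁ r s : ℂ) • v N₁ k₁ p₁ r +
        ∑ r, (rotDiag (rotMat C S N p) (rotMat C S N₂ p₂) A₂ B₂ r s : ℂ) • v N₂ k₂ p₂ r := by
  refine conjRep_v q h hA hB ?_ ?_ ?_ ?_
  all_goals
    intro he
    have hr := of_eInt_ne_zero q he
    simp only [rotDiag, Matrix.of_apply]
  · have := h.sq_add_sq N₁ p₁ (by omega) (by omega) (by omega)
    simp only [rotMat_zero_zero, rotMat_zero_one, rotMat_one_zero, rotMat_one_one]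
    linear_combination (-rotMat C S N p s 0 * A₁) * this
  · have := h.sq_add_sq N₁ p₁ (by omega) (by omega) (by omega)
    simp only [rotMat_zero_zero, rotMat_zero_one, rotMat_one_zero, rotMat_one_one]
    linear_combination (-rotMat C S N p s 1 * B₁) * this
  · have := h.sq_add_sq N₂ p₂ (by omega) (by omega) (by omega)
    simp only [rotMat_zero_zero, rotMat_zero_one, rotMat_one_zero, rotMat_one_one]
    linear_combination (-rotMat C S N p s 0 * A₂) * this
  · have := h.sq_add_sq N₂ p₂ (by omega) (by omega) (by omega)
    simp only [rotMat_zero_zero, rotMat_zero_one, rotMat_one_zero, rotMat_one_one]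
    linear_combination (-rotMat C S N p s 1 * B₂) * this
omit h

theorem decayConst_pos : 0 < decayConst q := by
  have := one_sub_sq_pos q
  rw [decayConst]
  positivity

theorem zero_le_decay (N : ℤ) : 0 ≤ decayConst q * (q : ℝ) ^ N :=
  mul_nonneg (decayConst_pos q).le (zpow_nonneg q.2.1.le _)

theorem abs_sub_le_decay {N : ℤ} {x y : ℝ} (hx : |x| ≤ decayConst q / 12 * (q : ℝ) ^ N)
    (hy : |y| ≤ decayConst q / 12 * (q : ℝ) ^ N) : |x - y| ≤ decayConst q * (q : ℝ) ^ N := by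
  have := zero_le_decay q N
  rw [abs_le] at *
  constructor <;> linarith

theorem abs_zero_le_decay (N : ℤ) : |(0 : ℝ)| ≤ decayConst q / 12 * (q : ℝ) ^ N := by
  have := zero_le_decay q N
  rw [abs_zero]
  linarith

end Comparison

/-! ### Entrywise comparison on the generators -/

section Generators

variable (q : Set.Ioo (0 : ℝ) 1)

/-- The coefficient of `α*` raising the spin. -/
def coefAPlus (N k l : ℤ) : ℝ :=
  (q : ℝ) ^ (0 : ℤ) * √(gnum (q : ℝ) (k + 1) * gnum (q : ℝ) (l + 1) /
    (gnum (q : ℝ) (N + 1) * gnum (q : ℝ) (N + 1 + 1)))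

/-- The coefficient of `α*` lowering the spin. -/
def coefAMinus (N k l : ℤ) : ℝ :=
  (q : ℝ) ^ (k + l + 1) * √(gnum (q : ℝ) (N - k) * gnum (q : ℝ) (N - l) /
    (gnum (q : ℝ) N * gnum (q : ℝ) (N + 1)))

/-- The coefficient of `-β` raising the spin. -/
def coefBPlus (N k l : ℤ) : ℝ :=
  (q : ℝ) ^ l * √(gnum (q : ℝ) (k + 1) * gnum (q : ℝ) (N + 1 - l) /
    (gnum (q : ℝ) (N + 1) * gnum (q : ℝ) (N + 1 + 1)))

/-- The coefficient of `β` lowering the spin. -/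
def coefBMinus (N k l : ℤ) : ℝ :=
  (q : ℝ) ^ k * √(gnum (q : ℝ) (N - k) * gnum (q : ℝ) l / (gnum (q : ℝ) N * gnum (q : ℝ) (N + 1)))

theorem star_α_top_v {s : Fin 2} {N k p : ℤ} :
    conjRep q (rotEquiv q isRot_cosTop) (star (α q)) (v N k p s) =
      ∑ r, (rotDiag (rotMat cosTop sinTop N p) (rotMat cosTop sinTop (N + 1) (p + 1))
        (coefAPlus q N k (p - 1)) (coefAPlus q N k p) r s : ℂ) • v (N + 1) (k + 1) (p + 1) r +
      ∑ r, (rotDiag (rotMat cosTop sinTop N p) (rotMat cosTop sinTop (N - 1) p)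
        (coefAMinus q N k (p - 1)) (coefAMinus q N k p) r s : ℂ) • v (N - 1) k p r := by
  have e (l : ℤ) := star_α_eInt q N k l
  simp only [show N + 2 = N + 1 + 1 by ring] at e
  refine conjRep_v_rotDiag q isRot_cosTop ?_ ?_
  · rw [e, coefAPlus, zpow_zero, one_mul, coefAMinus, sub_add_cancel, add_sub_cancel_right]
  · rw [e, coefAPlus, zpow_zero, one_mul, coefAMinus]

theorem neg_β_top_v {s : Fin 2} {N k p : ℤ} :
    conjRep q (rotEquiv q isRot_cosTop) (-β q) (v N k p s) =
      ∑ r, (rotDiag (rotMat cosTop sinTop N p) (rotMat cosTop sinTop (N + 1) p)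
        (coefBPlus q N k (p - 1)) (coefBPlus q N k p) r s : ℂ) • v (N + 1) (k + 1) p r +
      ∑ r, (rotDiag (rotMat cosTop sinTop N p) (rotMat cosTop sinTop (N - 1) (p - 1))
        (-coefBMinus q N k (p - 1)) (-coefBMinus q N k p) r s : ℂ) • v (N - 1) k (p - 1) r := by
  have e (l : ℤ) := neg_β_eInt q N k l
  simp only [show N + 2 = N + 1 + 1 by ring] at e
  refine conjRep_v_rotDiag q isRot_cosTop ?_ ?_
  · rw [e, coefBPlus, coefBMinus]
  · rw [e, coefBPlus, coefBMinus]

/-- The degenerate rotation is an exchange for p ≤ N and diagonal for p = N + 1. The conjugated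
matrix is thus diagonal, unless the shift crosses between the two ranges, where it becomes
off-diagonal. -/
theorem rotDiag_swap_swap (A B : ℝ) :
    rotDiag !![0, 1; 1, 0] !![0, 1; 1, 0] A B = !![B, 0; 0, A] := by
  ext r s; fin_cases r <;> fin_cases s <;> simp [rotDiag]

theorem rotDiag_top_top (A B : ℝ) :
    rotDiag !![1, 0; 0, -1] !![1, 0; 0, -1] A B = !![A, 0; 0, B] := by
  ext r s; fin_cases r <;> fin_cases s <;> simp [rotDiag]

theorem rotDiag_swap_top (A B : ℝ) :
    rotDiag !![0, 1; 1, 0] !![1, 0; 0, -1] A B = !![0, A; -B, 0] := by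
  ext r s; fin_cases r <;> fin_cases s <;> simp [rotDiag]

theorem rotDiag_top_swap (A B : ℝ) :
    rotDiag !![1, 0; 0, -1] !![0, 1; 1, 0] A B = !![0, -B; A, 0] := by
  ext r s; fin_cases r <;> fin_cases s <;> simp [rotDiag]

variable {q}

theorem eq_zero_of_top {r : Fin 2} {N k : ℤ} (hr : IsLabel r N k (N + 1)) : r = 0 := by
  by_contra h
  have := hr.2
  rw [if_neg h] at this
  omega

theorem isLabel_one {N k p : ℤ} (hr : IsLabel 1 N k p) : 1 ≤ p ∧ p ≤ N := by
  have := hr.2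
  rwa [if_neg one_ne_zero] at this

/-- This shift preserves N - p, so source and target are both at the top or both below it. The
coefficients do not decay, so the diagonal roots must agree up to O(q^N). -/
theorem abs_aPlus_sub_le {s r : Fin 2} {N k p : ℤ} (hs : IsLabel s N k p)
    (hr : IsLabel r (N + 1) (k + 1) (p + 1)) :
    |rotDiag (rotMat cosTop sinTop N p) (rotMat cosTop sinTop (N + 1) (p + 1))
        (coefAPlus q N k (p - 1)) (coefAPlus q N k p) r s -
      aPlus q (N / 2) (k - N / 2) (p - N / 2 - 1 / 2) r s| ≤ decayConst q * (q : ℝ) ^ N := by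
  have hk := hs.1
  have hp := isLabel_le hs
  have hN : 0 ≤ (q : ℝ) ^ N := zpow_nonneg q.2.1.le N
  by_cases ht : p = N + 1
  · subst ht
    obtain rfl := eq_zero_of_top hs
    obtain rfl := eq_zero_of_top hr
    rw [rotMat_cosTop_top (by omega), rotMat_cosTop_top (by omega), rotDiag_top_top, aPlus_zero_zero]
    -- At the top the roots at N + 1 and N + 2 are compared; both are within q^N of 1.
    have := abs_entry_sub_le q (N := N) (a := 0) (m := k + 1) (l := N + 1 - 1 + 1) (l' := N + 1 + 1)
      (M := N + 1) (M' := N + 2) le_rfl (by omega) (by omega) (by omega) (by omega) (by omega)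
      (by omega) (by
        rw [zpow_zero, one_mul]
        exact abs_sqrt_gnum_sub_le q (by omega) (by omega) (by omega) (by omega))
    simpa [coefAPlus] using this
  · rw [rotMat_cosTop_of_ne ht, rotMat_cosTop_of_ne (by omega), rotDiag_swap_swap]
    obtain rfl | rfl : s = 0 ∨ s = 1 := by omega
    all_goals obtain rfl | rfl : r = 0 ∨ r = 1 := by omega
    · rw [aPlus_zero_zero]
      have := abs_entry_sub_le q (N := N) (a := 0) (m := k + 1) (l := p + 1) (l' := p + 1)
        (M := N + 1) (M' := N + 2) le_rfl (by omega) (by omega) (by omega) (by omega) (by omega)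
        (by omega) (by rwa [sub_self, abs_zero, mul_zero])
      simpa [coefAPlus] using this
    · rw [aPlus_one_zero]
      exact abs_sub_le_decay q (abs_zero_le_decay q N)
        (abs_entry_two_le q (by omega) (by omega) (by omega))
    · rw [aPlus_zero_one]
      exact abs_sub_le_decay q (abs_zero_le_decay q N) (abs_zero_le_decay q N)
    · rw [aPlus_one_one]
      have hp1 := isLabel_one hs
      have := abs_entry_sub_le q (N := N) (a := 0) (m := k + 1) (l := p) (l' := p)
        (M := N + 1) (M' := N + 1) le_rfl (by omega) (by omega) (by omega) (by omega) (by omega)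
        (by omega) (by rwa [sub_self, abs_zero, mul_zero])
      simpa [coefAPlus] using this

/-- A prefactor q^a means that the roots need only agree up to q^{N-a}. -/
theorem zpow_mul_abs_sqrt_gnum_sub_le {N a m n : ℤ} (hm : 0 ≤ m) (hn : 0 ≤ n)
    (hNm : N - a ≤ m) (hNn : N - a ≤ n) :
    (q : ℝ) ^ a * |√(gnum (q : ℝ) m) - √(gnum (q : ℝ) n)| ≤ (q : ℝ) ^ N := by
  have h := abs_sqrt_gnum_sub_le q (N := N - a) hm hn hNm hNn
  calc _ ≤ (q : ℝ) ^ a * (q : ℝ) ^ (N - a) :=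
        mul_le_mul_of_nonneg_left h (zpow_nonneg q.2.1.le _)
    _ = (q : ℝ) ^ N := by rw [← zpow_add₀ q.2.1.ne', add_sub_cancel]

/-- The target reaches the top when p = N. There the matrices have different shapes, but every
nonzero entry carries at least q^{k+N} and is small by itself. -/
theorem abs_aMinus_sub_le {s r : Fin 2} {N k p : ℤ} (hs : IsLabel s N k p)
    (hr : IsLabel r (N - 1) k p) :
    |rotDiag (rotMat cosTop sinTop N p) (rotMat cosTop sinTop (N - 1) p)
        (coefAMinus q N k (p - 1)) (coefAMinus q N k p) r s -
      aMinus q (N / 2) (k - N / 2) (p - N / 2 - 1 / 2) r s| ≤ decayConst q * (q : ℝ) ^ N := by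
  have hk := hr.1
  have hp := isLabel_le hr
  rw [rotMat_cosTop_of_ne (by omega)]
  by_cases ht : p = N
  · subst ht
    obtain ⟨M, rfl⟩ : ∃ M, p = M + 1 := ⟨p - 1, by ring⟩
    rw [add_sub_cancel_right] at hr ⊢
    obtain rfl := eq_zero_of_top hr
    rw [rotMat_cosTop_top (by omega), rotDiag_swap_top]
    obtain rfl | rfl : s = 0 ∨ s = 1 := by omega
    · rw [aMinus_zero_zero]
      exact abs_sub_le_decay q (abs_zero_le_decay q _) (abs_entry_one_le q (by omega) (by omega))
    · rw [aMinus_zero_one]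
      refine abs_sub_le_decay q (abs_entry_le q (by omega) (by omega) (by omega) (by omega)) ?_
      rw [abs_neg]
      exact abs_entry_two_le q (by omega) (by omega) (by omega)
  · rw [rotMat_cosTop_of_ne (by omega), rotDiag_swap_swap]
    obtain rfl | rfl : s = 0 ∨ s = 1 := by omega
    all_goals obtain rfl | rfl : r = 0 ∨ r = 1 := by omega
    · rw [aMinus_zero_zero]
      exact abs_entry_sub_le q (by omega) (by omega) (by omega) (by omega) (by omega) (by omega)
        (by omega) (zpow_mul_abs_sqrt_gnum_sub_le (by omega) (by omega) (by omega)
          (by omega))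
    · rw [aMinus_one_zero]
      exact abs_sub_le_decay q (abs_zero_le_decay q N) (abs_zero_le_decay q N)
    · rw [aMinus_zero_one]
      refine abs_sub_le_decay q (abs_zero_le_decay q N) ?_
      rw [abs_neg]
      exact abs_entry_two_le q (by omega) (by omega) (by omega)
    -- The exponent is rewritten as k + (p - 1) + 1, its form in `coefAMinus` at l = p - 1.
    · rw [aMinus_one_one, ← sub_add_cancel (k + p) 1, show k + p - 1 = k + (p - 1) by ring]
      exact abs_entry_sub_le q (by omega) (by omega) (by omega) (by omega) (by omega) (by omega)
        (by omega) (zpow_mul_abs_sqrt_gnum_sub_le (by omega) (by omega) (by omega)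
          (by omega))

/-- The source leaves the top when p = N + 1, since the top moves to N + 2. The nonzero entries
there carry at least q^N. -/
theorem abs_bPlus_sub_le {s r : Fin 2} {N k p : ℤ} (hs : IsLabel s N k p) :
    |rotDiag (rotMat cosTop sinTop N p) (rotMat cosTop sinTop (N + 1) p)
        (coefBPlus q N k (p - 1)) (coefBPlus q N k p) r s -
      bPlus q (N / 2) (k - N / 2) (p - N / 2 - 1 / 2) r s| ≤ decayConst q * (q : ℝ) ^ N := by
  have hk := hs.1
  have hp := isLabel_le hs
  rw [rotMat_cosTop_of_ne (N := N + 1) (by omega)]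
  by_cases ht : p = N + 1
  · subst ht
    obtain rfl := eq_zero_of_top hs
    rw [rotMat_cosTop_top (by omega), rotDiag_top_swap]
    obtain rfl | rfl : r = 0 ∨ r = 1 := by omega
    · rw [bPlus_zero_zero]
      exact abs_sub_le_decay q (abs_zero_le_decay q _) (abs_entry_one_le q (by omega) (by omega))
    · rw [bPlus_one_zero]
      refine abs_sub_le_decay q (abs_entry_le q (by omega) (by omega) (by omega) (by omega)) ?_
      rw [abs_neg]
      exact abs_entry_two_le q (by omega) (by omega) (by omega)
  · rw [rotMat_cosTop_of_ne ht, rotDiag_swap_swap]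
    obtain rfl | rfl : s = 0 ∨ s = 1 := by omega
    all_goals obtain rfl | rfl : r = 0 ∨ r = 1 := by omega
    · rw [bPlus_zero_zero]
      exact abs_entry_sub_le q (by omega) (by omega) (by omega) (by omega) (by omega) (by omega)
        (by omega) (zpow_mul_abs_sqrt_gnum_sub_le (by omega) (by omega) (by omega)
          (by omega))
    · rw [bPlus_one_zero]
      refine abs_sub_le_decay q (abs_zero_le_decay q N) ?_
      rw [abs_neg]
      exact abs_entry_two_le q (by omega) (by omega) (by omega)
    · rw [bPlus_zero_one]
      exact abs_sub_le_decay q (abs_zero_le_decay q N) (abs_zero_le_decay q N)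
    · rw [bPlus_one_one]
      have hp1 := isLabel_one hs
      exact abs_entry_sub_le q (by omega) (by omega) (by omega) (by omega) (by omega) (by omega)
        (by omega) (zpow_mul_abs_sqrt_gnum_sub_le (by omega) (by omega) (by omega)
          (by omega))

theorem abs_neg_sub_neg (x y : ℝ) : |-x - -y| = |x - y| := by
  rw [neg_sub_neg, abs_sub_comm]

/-- The prefactor q^k need not decay with N, but the shift preserves N - p. The roots agree exactly
below the top, and at the top they are those at N and N + 1 in terms of the source level. -/
theorem abs_bMinus_sub_le {s r : Fin 2} {N k p : ℤ} (hs : IsLabel s N k p)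
    (hr : IsLabel r (N - 1) k (p - 1)) :
    |rotDiag (rotMat cosTop sinTop N p) (rotMat cosTop sinTop (N - 1) (p - 1))
        (-coefBMinus q N k (p - 1)) (-coefBMinus q N k p) r s -
      bMinus q (N / 2) (k - N / 2) (p - N / 2 - 1 / 2) r s| ≤ decayConst q * (q : ℝ) ^ N := by
  have hk := hr.1
  have hp := isLabel_le hr
  by_cases ht : p = N + 1
  · subst ht
    obtain rfl := eq_zero_of_top hs
    obtain ⟨M, rfl⟩ : ∃ M, N = M + 1 := ⟨N - 1, by ring⟩
    simp only [add_sub_cancel_right] at hr ⊢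
    obtain rfl := eq_zero_of_top hr
    rw [rotMat_cosTop_top (by omega), rotMat_cosTop_top (by omega), rotDiag_top_top, bMinus_zero_zero]
    refine (abs_neg_sub_neg _ _).trans_le ?_
    refine abs_entry_sub_le q (by omega) (by omega) (by omega) (by omega) (by omega) (by omega)
      (by omega) (zpow_mul_abs_sqrt_gnum_sub_le (by omega) (by omega) (by omega)
          (by omega))
  · rw [rotMat_cosTop_of_ne ht, rotMat_cosTop_of_ne (by omega), rotDiag_swap_swap]
    have hN : 0 ≤ (q : ℝ) ^ N := zpow_nonneg q.2.1.le N
    obtain rfl | rfl : s = 0 ∨ s = 1 := by omega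
    all_goals obtain rfl | rfl : r = 0 ∨ r = 1 := by omega
    · rw [bMinus_zero_zero]
      refine (abs_neg_sub_neg _ _).trans_le ?_
      exact abs_entry_sub_le q (by omega) (by omega) (by omega) (by omega) (by omega) (by omega)
        (by omega) (by rwa [sub_self, abs_zero, mul_zero])
    · rw [bMinus_one_zero]
      exact abs_sub_le_decay q (abs_zero_le_decay q N) (abs_zero_le_decay q N)
    · rw [bMinus_zero_one]
      have hp1 := isLabel_one hs
      refine abs_sub_le_decay q (abs_zero_le_decay q N) ?_
      rw [abs_neg]
      exact abs_entry_two_le q (by omega) (by omega) (by omega)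
    · rw [bMinus_one_one]
      refine (abs_neg_sub_neg _ _).trans_le ?_
      exact abs_entry_sub_le q (by omega) (by omega) (by omega) (by omega) (by omega) (by omega)
        (by omega) (by rwa [sub_self, abs_zero, mul_zero])

end Generators

/-! ### From the generators to the polynomial algebra -/

section Difference

variable (q : Set.Ioo (0 : ℝ) 1)

/-- The unitary `U`. -/
def unitaryU : WithLp 2 (L2 q × L2 q) ≃ₗᵢ[ℂ] H := rotEquiv q isRot_cosTop

/-- The representation `π'`. -/
def piPrime : Alg (q : ℝ) →⋆ₐ[ℂ] (H →L[ℂ] H) := conjRep q (rotEquiv q (isRot_cosRot q))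

theorem sum_sub_sum {A₁ A₂ : Matrix (Fin 2) (Fin 2) ℝ} {w : Fin 2 → H} (s : Fin 2) :
    ∑ r, (A₁ r s : ℂ) • w r - ∑ r, (A₂ r s : ℂ) • w r = ∑ r, ((A₁ - A₂) r s : ℂ) • w r := by
  rw [← Finset.sum_sub_distrib]
  refine Finset.sum_congr rfl fun r _ => ?_
  rw [Matrix.sub_apply, Complex.ofReal_sub, sub_smul]

/-- Membership of the adjoint is proved alongside: it gives the statement for α, and the induction
over the generated *-subalgebra needs both. -/
theorem star_α_sub_mem : conjRep q (unitaryU q) (star (α q)) - piPrime q (star (α q)) ∈ Kq q ∧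
    star (conjRep q (unitaryU q) (star (α q)) - piPrime q (star (α q))) ∈ Kq q := by
  have hT : ∀ s N k p, IsLabel s N k p →
      (conjRep q (unitaryU q) (star (α q)) - piPrime q (star (α q))) (v N k p s) =
      ∑ r, ((rotDiag (rotMat cosTop sinTop N p) (rotMat cosTop sinTop (N + 1) (p + 1))
        (coefAPlus q N k (p - 1)) (coefAPlus q N k p) -
          aPlus q (N / 2) (k - N / 2) (p - N / 2 - 1 / 2)) r s : ℂ) • v (N + 1) (k + 1) (p + 1) r +
      ∑ r, ((rotDiag (rotMat cosTop sinTop N p) (rotMat cosTop sinTop (N - 1) p)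
        (coefAMinus q N k (p - 1)) (coefAMinus q N k p) -
          aMinus q (N / 2) (k - N / 2) (p - N / 2 - 1 / 2)) r s : ℂ) •
            v (N - 1) (k + 0) (p + 0) r := fun s N k p hl => by
    rw [sub_apply, unitaryU, piPrime, star_α_top_v, star_α_v q hl, add_sub_add_comm, act, act,
      sum_sub_sum, sum_sub_sum, add_zero, add_zero]
  exact ⟨mem_Kq_of_shift (decayConst_pos q) hT (fun s r N k p hs hr => abs_aPlus_sub_le hs hr)
    (fun s r N k p hs hr => abs_aMinus_sub_le hs (by simpa using hr)),
    star_mem_Kq_of_shift (decayConst_pos q) hT (fun s r N k p hs hr => abs_aPlus_sub_le hs hr)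
    (fun s r N k p hs hr => abs_aMinus_sub_le hs (by simpa using hr))⟩

theorem neg_β_sub_mem : conjRep q (unitaryU q) (-β q) - piPrime q (-β q) ∈ Kq q ∧
    star (conjRep q (unitaryU q) (-β q) - piPrime q (-β q)) ∈ Kq q := by
  have hT : ∀ s N k p, IsLabel s N k p →
      (conjRep q (unitaryU q) (-β q) - piPrime q (-β q)) (v N k p s) =
      ∑ r, ((rotDiag (rotMat cosTop sinTop N p) (rotMat cosTop sinTop (N + 1) p)
        (coefBPlus q N k (p - 1)) (coefBPlus q N k p) -
          bPlus q (N / 2) (k - N / 2) (p - N / 2 - 1 / 2)) r s : ℂ) • v (N + 1) (k + 1) (p + 0) r +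
      ∑ r, ((rotDiag (rotMat cosTop sinTop N p) (rotMat cosTop sinTop (N - 1) (p - 1))
        (-coefBMinus q N k (p - 1)) (-coefBMinus q N k p) -
          bMinus q (N / 2) (k - N / 2) (p - N / 2 - 1 / 2)) r s : ℂ) •
            v (N - 1) (k + 0) (p + -1) r := fun s N k p hl => by
    rw [sub_apply, unitaryU, piPrime, neg_β_top_v, neg_β_v q hl, add_sub_add_comm, act, act,
      sum_sub_sum, sum_sub_sum, add_zero, add_zero, ← sub_eq_add_neg]
  exact ⟨mem_Kq_of_shift (decayConst_pos q) hT (fun s r N k p hs hr => abs_bPlus_sub_le hs)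
    (fun s r N k p hs hr => abs_bMinus_sub_le hs (by rwa [add_zero, ← sub_eq_add_neg] at hr)),
    star_mem_Kq_of_shift (decayConst_pos q) hT (fun s r N k p hs hr => abs_bPlus_sub_le hs)
    (fun s r N k p hs hr => abs_bMinus_sub_le hs (by rwa [add_zero, ← sub_eq_add_neg] at hr))⟩

/-- Two *-representations which agree on generators and their adjoints modulo an ideal agree on the
generated *-subalgebra modulo this ideal. -/
theorem sub_mem_of_mem_adjoin {A B : Type*} [Ring A] [StarRing A] [Algebra ℂ A] [StarModule ℂ A]
    [Ring B] [StarRing B] [Algebra ℂ B] (I : TwoSidedIdeal B) (φ ψ : A →⋆ₐ[ℂ] B) {s : Set A}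
    (h : ∀ x ∈ s, φ x - ψ x ∈ I ∧ φ (star x) - ψ (star x) ∈ I) {x : A}
    (hx : x ∈ StarAlgebra.adjoin ℂ s) : φ x - ψ x ∈ I := by
  have key : φ x - ψ x ∈ I ∧ φ (star x) - ψ (star x) ∈ I := by
    have hmul {x y : A} (hx : φ x - ψ x ∈ I) (hy : φ y - ψ y ∈ I) : φ (x * y) - ψ (x * y) ∈ I := by
      -- The Leibniz-type identity that makes agreement modulo an ideal multiplicative.
      have e : φ (x * y) - ψ (x * y) = φ x * (φ y - ψ y) + (φ x - ψ x) * ψ y := by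
        rw [map_mul, map_mul]; noncomm_ring
      rw [e]
      exact I.add_mem (I.mul_mem_left _ _ hy) (I.mul_mem_right _ _ hx)
    induction hx using StarAlgebra.adjoin_induction with
    | mem x hx => exact h x hx
    | algebraMap r =>
      rw [← algebraMap_star_comm, AlgHomClass.commutes, AlgHomClass.commutes, AlgHomClass.commutes,
        AlgHomClass.commutes, sub_self, sub_self]
      exact ⟨I.zero_mem, I.zero_mem⟩
    | add x y _ _ hx hy =>
      rw [star_add, map_add, map_add, map_add, map_add, add_sub_add_comm, add_sub_add_comm]
      exact ⟨I.add_mem hx.1 hy.1, I.add_mem hx.2 hy.2⟩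
    | mul x y _ _ hx hy =>
      rw [star_mul]
      exact ⟨hmul hx.1 hy.1, hmul hy.2 hx.2⟩
    | star x _ hx => exact ⟨hx.2, by rw [star_star]; exact hx.1⟩
  exact key.1

theorem conjRep_sub_mem {a : Alg (q : ℝ)} (ha : a ∈ polyAlg (q : ℝ)) :
    conjRep q (unitaryU q) a - piPrime q a ∈ Kq q := by
  refine sub_mem_of_mem_adjoin (Kq q) _ _ (fun x hx => ?_) ha
  rcases hx with rfl | hx
  · have h := star_α_sub_mem q
    refine ⟨?_, h.1⟩
    simpa only [star_sub, ← map_star, star_star] using h.2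
  · obtain rfl : x = β q := hx
    have h := neg_β_sub_mem q
    have e (y : Alg (q : ℝ)) (hy : conjRep q (unitaryU q) (-y) - piPrime q (-y) ∈ Kq q) :
        conjRep q (unitaryU q) y - piPrime q y ∈ Kq q := by
      have := (Kq q).neg_mem hy
      rwa [map_neg, map_neg, neg_sub_neg, neg_sub] at this
    refine ⟨e _ h.1, e _ ?_⟩
    simpa only [star_sub, ← map_star, star_neg] using h.2

end Difference

/-! ### The values of U on the basis vectors -/

section Basis

variable (q : Set.Ioo (0 : ℝ) 1)

theorem unitaryU_inl {N : ℕ} {k l : ℤ} (hl : 0 ≤ l) (hlN : l < N) :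
    unitaryU q (WithLp.toLp 2 (e q N k l, 0)) = dVec N k (l + 1) := by
  rw [← eInt_natCast, toLp_inl q isRot_cosTop ⟨hl, hlN.le⟩, cosTop, sinTop, if_neg (by omega),
    if_neg (by omega), Complex.ofReal_zero, zero_smul, zero_add, Complex.ofReal_one, one_smul,
    unitaryU, rotEquiv_rotVec]

theorem unitaryU_inl_top {N : ℕ} {k : ℤ} :
    unitaryU q (WithLp.toLp 2 (e q N k N, 0)) = uVec N k (N + 1) := by
  rw [← eInt_natCast, toLp_inl q isRot_cosTop ⟨by omega, le_rfl⟩, cosTop, sinTop, if_pos rfl,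
    if_pos ⟨rfl, by omega⟩, Complex.ofReal_zero, zero_smul, add_zero, Complex.ofReal_one, one_smul,
    unitaryU, rotEquiv_rotVec]

theorem unitaryU_inr {N : ℕ} {k l : ℤ} (hl : 0 ≤ l) (hlN : l ≤ N) :
    unitaryU q (WithLp.toLp 2 (0, e q N k l)) = uVec N k l := by
  rw [← eInt_natCast, toLp_inr q isRot_cosTop ⟨hl, hlN⟩, cosTop, sinTop, if_neg (by omega),
    if_neg (by omega), Complex.ofReal_zero, zero_smul, sub_zero, Complex.ofReal_one, one_smul,
    unitaryU, rotEquiv_rotVec]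

end Basis

/-! ### Unitary transport of unbounded diagonal operators -/

section DiagOp

theorem summable_sum_iff {α β E : Type*} [AddCommGroup E] [UniformSpace E] [CompleteSpace E]
    [IsUniformAddGroup E] {f : α ⊕ β → E} :
    Summable f ↔ Summable (fun i => f (.inl i)) ∧ Summable (fun i => f (.inr i)) :=
  ⟨fun h => ⟨h.comp_injective Sum.inl_injective, h.comp_injective Sum.inr_injective⟩,
    fun h => Summable.sum f h.1 h.2⟩

variable {ι₁ ι₂ κ E F G : Type*} [NormedAddCommGroup E] [InnerProductSpace ℂ E]
  [NormedAddCommGroup F] [InnerProductSpace ℂ F] [NormedAddCommGroup G] [InnerProductSpace ℂ G]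

/-- A direct sum of diagonal operators is mapped to a diagonal operator by a unitary mapping basis
vectors to basis vectors. -/
theorem pmapConj_pmapSum_diagOp [CompleteSpace G] (U : WithLp 2 (E × F) ≃ₗᵢ[ℂ] G) {e₁ : ι₁ → E} {c₁ : ι₁ → ℝ}
    {e₂ : ι₂ → F} {c₂ : ι₂ → ℝ} {f : κ → G} {c : κ → ℝ} (σ : ι₁ ⊕ ι₂ ≃ κ)
    (h₁ : ∀ i, U (WithLp.toLp 2 (e₁ i, 0)) = f (σ (.inl i)))
    (h₂ : ∀ i, U (WithLp.toLp 2 (0, e₂ i)) = f (σ (.inr i)))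
    (hc₁ : ∀ i, c (σ (.inl i)) = c₁ i) (hc₂ : ∀ i, c (σ (.inr i)) = c₂ i) :
    pmapConj U (pmapSum (diagOp e₁ c₁) (diagOp e₂ c₂)) = diagOp f c := by
  let V₁ : E →L[ℂ] G := U.toContinuousLinearEquiv.toContinuousLinearMap ∘L
    (WithLp.prodContinuousLinearEquiv 2 ℂ E F).symm.toContinuousLinearMap ∘L
      ContinuousLinearMap.inl ℂ _ _
  let V₂ : F →L[ℂ] G := U.toContinuousLinearEquiv.toContinuousLinearMap ∘L
    (WithLp.prodContinuousLinearEquiv 2 ℂ E F).symm.toContinuousLinearMap ∘L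
      ContinuousLinearMap.inr ℂ _ _
  let W₁ : G →L[ℂ] E := ContinuousLinearMap.fst ℂ _ _ ∘L
    (WithLp.prodContinuousLinearEquiv 2 ℂ E F).toContinuousLinearMap ∘L
      U.symm.toContinuousLinearEquiv.toContinuousLinearMap
  let W₂ : G →L[ℂ] F := ContinuousLinearMap.snd ℂ _ _ ∘L
    (WithLp.prodContinuousLinearEquiv 2 ℂ E F).toContinuousLinearMap ∘L
      U.symm.toContinuousLinearEquiv.toContinuousLinearMap
  have hWV₁ (x : E) : W₁ (V₁ x) = x :=
    congrArg WithLp.fst (U.symm_apply_apply (WithLp.toLp 2 (x, 0)))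
  have hWV₂ (x : F) : W₂ (V₂ x) = x :=
    congrArg WithLp.snd (U.symm_apply_apply (WithLp.toLp 2 (0, x)))
  have hsum (y : G) (x₁ : E) (x₂ : F) : V₁ x₁ + V₂ x₂ = U (WithLp.toLp 2 (x₁, x₂)) := by
    change U (WithLp.toLp 2 (x₁, 0)) + U (WithLp.toLp 2 (0, x₂)) = _
    rw [← map_add, ← WithLp.toLp_add, Prod.mk_add_mk, add_zero, zero_add]
  have hin₁ (x : E) (y : G) : ⟪V₁ x, y⟫_ℂ = ⟪x, W₁ y⟫_ℂ := by
    change ⟪U (WithLp.toLp 2 (x, 0)), y⟫_ℂ = _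
    rw [← U.apply_symm_apply y, U.inner_map_map, WithLp.prod_inner_apply, inner_zero_left, add_zero,
      U.apply_symm_apply]
    rfl
  have hin₂ (x : F) (y : G) : ⟪V₂ x, y⟫_ℂ = ⟪x, W₂ y⟫_ℂ := by
    change ⟪U (WithLp.toLp 2 (0, x)), y⟫_ℂ = _
    rw [← U.apply_symm_apply y, U.inner_map_map, WithLp.prod_inner_apply, inner_zero_left, zero_add,
      U.apply_symm_apply]
    rfl
  have t₁ (y : G) : (fun i => (c (σ (.inl i)) : ℂ) • ⟪f (σ (.inl i)), y⟫_ℂ • f (σ (.inl i))) =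
      fun i => V₁ ((c₁ i : ℂ) • ⟪e₁ i, W₁ y⟫_ℂ • e₁ i) := by
    funext i
    rw [hc₁, map_smul, map_smul, ← hin₁, show V₁ (e₁ i) = f (σ (.inl i)) from h₁ i]
  have t₂ (y : G) : (fun i => (c (σ (.inr i)) : ℂ) • ⟪f (σ (.inr i)), y⟫_ℂ • f (σ (.inr i))) =
      fun i => V₂ ((c₂ i : ℂ) • ⟪e₂ i, W₂ y⟫_ℂ • e₂ i) := by
    funext i
    rw [hc₂, map_smul, map_smul, ← hin₂, show V₂ (e₂ i) = f (σ (.inr i)) from h₂ i]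
  -- The embedding has the bounded left inverse `W₁`, so summability passes in both directions. This
  -- is what gives equality of the domains, not just an inclusion.
  have hs₁ {g : ι₁ → E} : Summable (fun i => V₁ (g i)) ↔ Summable g :=
    ⟨fun h => by simpa only [hWV₁] using h.mapL W₁, fun h => h.mapL V₁⟩
  have hs₂ {g : ι₂ → F} : Summable (fun i => V₂ (g i)) ↔ Summable g :=
    ⟨fun h => by simpa only [hWV₂] using h.mapL W₂, fun h => h.mapL V₂⟩
  refine LinearPMap.ext (Submodule.ext fun y => ?_) fun y hy hy' => ?_
  · change (Summable (fun i => (c₁ i : ℂ) • ⟪e₁ i, W₁ y⟫_ℂ • e₁ i) ∧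
      Summable (fun i => (c₂ i : ℂ) • ⟪e₂ i, W₂ y⟫_ℂ • e₂ i)) ↔
        Summable (fun k => (c k : ℂ) • ⟪f k, y⟫_ℂ • f k)
    rw [← σ.summable_iff, summable_sum_iff, ← hs₁, ← hs₂, ← t₁, ← t₂]
    rfl
  · change U (WithLp.toLp 2 (∑' i, (c₁ i : ℂ) • ⟪e₁ i, W₁ y⟫_ℂ • e₁ i,
      ∑' i, (c₂ i : ℂ) • ⟪e₂ i, W₂ y⟫_ℂ • e₂ i)) = ∑' k, (c k : ℂ) • ⟪f k, y⟫_ℂ • f k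
    have hy₁ : Summable (fun i => (c₁ i : ℂ) • ⟪e₁ i, W₁ y⟫_ℂ • e₁ i) := hy.1
    have hy₂ : Summable (fun i => (c₂ i : ℂ) • ⟪e₂ i, W₂ y⟫_ℂ • e₂ i) := hy.2
    rw [← hsum y, V₁.map_tsum hy₁, V₂.map_tsum hy₂, ← t₁, ← t₂, ← σ.tsum_eq]
    refine (Summable.tsum_sum (f := fun i => (c (σ i) : ℂ) • ⟪f (σ i), y⟫_ℂ • f (σ i)) ?_ ?_).symm
    · rw [Function.comp_def, t₁]
      exact hs₁.mpr hy₁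
    · rw [Function.comp_def, t₂]
      exact hs₂.mpr hy₂

end DiagOp

/-! ### Matching the eigenvalues of D with those of D₁ ⊕ |D₂| -/

section Dirac

theorem isLabel_toH {x : ℕ × ℤ × ℤ} (h : (0 ≤ x.2.1 ∧ x.2.1 ≤ x.1) ∧ (0 ≤ x.2.2 ∧ x.2.2 ≤ x.1)) :
    IsLabel (if x.2.2 = x.1 then 0 else 1) x.1 x.2.1 (x.2.2 + 1) := by
  refine ⟨h.1, ?_⟩
  by_cases hx : x.2.2 = x.1
  · rw [if_pos hx, if_pos rfl]
    omega
  · rw [if_neg hx, if_neg one_ne_zero]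
    omega

/-- The bijection between the labels of the bases which is induced by the unitary `U`. -/
def labelMap : LLabel ⊕ LLabel → HLabel
  | .inl x => ⟨(if x.1.2.2 = x.1.1 then 0 else 1, x.1.1, x.1.2.1, x.1.2.2 + 1), isLabel_toH x.2⟩
  | .inr x => ⟨(0, x.1.1, x.1.2.1, x.1.2.2), x.2.1, by
      rw [if_pos rfl]
      have := x.2.2
      dsimp only
      omega⟩

/-- The u-labels with p = N + 1 come from l = N in the first summand, all d-labels from l < N there,
and the u-labels with p ≤ N from the second summand. -/
theorem labelMap_bijective : Function.Bijective labelMap := by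
  constructor
  · rintro (⟨⟨N, k, l⟩, h⟩ | ⟨⟨N, k, l⟩, h⟩) (⟨⟨N', k', l'⟩, h'⟩ | ⟨⟨N', k', l'⟩, h'⟩) he
    all_goals
      replace he := congrArg Subtype.val he
      dsimp only [labelMap] at h h' he
      simp only [Prod.mk.injEq, Nat.cast_inj, add_left_inj] at he
    · obtain ⟨-, rfl, rfl, rfl⟩ := he
      rfl
    · obtain ⟨he, rfl, rfl, h3⟩ := he
      by_cases hN : l = N
      · omega
      · rw [if_neg hN] at he
        exact absurd he one_ne_zero
    · obtain ⟨he, rfl, rfl, h3⟩ := he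
      by_cases hN : l' = N
      · omega
      · rw [if_neg hN] at he
        exact absurd he zero_ne_one
    · obtain ⟨-, rfl, rfl, rfl⟩ := he
      rfl
  · rintro ⟨⟨s, N, k, p⟩, h⟩
    have hp := isLabel_le h
    have hk := h.1
    dsimp only at hp hk
    obtain ⟨N, rfl⟩ : ∃ M : ℕ, N = M := ⟨N.toNat, by omega⟩
    obtain rfl | rfl : s = 0 ∨ s = 1 := by omega
    · by_cases hN : p = N + 1
      · subst hN
        refine ⟨.inl ⟨(N, k, N), hk, by simp⟩, ?_⟩
        simp [labelMap]
      · exact ⟨.inr ⟨(N, k, p), hk, by dsimp only; omega⟩, rfl⟩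
    · have hp1 := isLabel_one h
      dsimp only at hp1
      refine ⟨.inl ⟨(N, k, p - 1), hk, by dsimp only; omega⟩, ?_⟩
      simp [labelMap]
      omega

variable (q : Set.Ioo (0 : ℝ) 1)

theorem unitaryU_labelMap_inl (x : LLabel) :
    unitaryU q (WithLp.toLp 2 (e q x.1.1 x.1.2.1 x.1.2.2, 0)) =
      v (labelMap (.inl x)).1.2.1 (labelMap (.inl x)).1.2.2.1 (labelMap (.inl x)).1.2.2.2
        (labelMap (.inl x)).1.1 := by
  obtain ⟨⟨N, k, l⟩, hk, hl⟩ := x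
  by_cases hN : l = N
  · subst hN
    simpa [labelMap] using unitaryU_inl_top q
  · have : l < N := by simp at hl; omega
    simpa [labelMap, hN] using unitaryU_inl q hl.1 this

theorem unitaryU_labelMap_inr (x : LLabel) :
    unitaryU q (WithLp.toLp 2 (0, e q x.1.1 x.1.2.1 x.1.2.2)) =
      v (labelMap (.inr x)).1.2.1 (labelMap (.inr x)).1.2.2.1 (labelMap (.inr x)).1.2.2.2
        (labelMap (.inr x)).1.1 :=
  unitaryU_inr q x.2.2.1 x.2.2.2

/-- The eigenvalues of `D`. -/
def eigD (x : HLabel) : ℝ := if x.1.1 = 0 then x.1.2.1 + 1 else -x.1.2.1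

theorem eigD_inl (x : LLabel) : eigD (labelMap (.inl x)) = eigD₁ x := by
  rw [eigD, eigD₁, labelMap]
  by_cases h : x.1.2.2 = x.1.1 <;> simp [h]

theorem eigD_inr (x : LLabel) : eigD (labelMap (.inr x)) = |eigD₂ x| := by
  rw [eigD, eigD₂, labelMap]
  have : (0 : ℝ) ≤ x.1.1 + 1 := by positivity
  by_cases h : x.1.2.2 = x.1.1
  · simp [h, abs_of_nonneg this]
  · simp only [h, if_false, if_true, ← neg_add', abs_neg, abs_of_nonneg this]
    simp

theorem pmapConj_eq_D : pmapConj (unitaryU q) (pmapSum (D₁ q) (absD₂ q)) = D :=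
  pmapConj_pmapSum_diagOp (unitaryU q) (Equiv.ofBijective labelMap labelMap_bijective)
    (unitaryU_labelMap_inl q) (unitaryU_labelMap_inr q) eigD_inl eigD_inr

end Dirac

end SUq2

end

open SUq2
theorem theorem3p2 (q : Set.Ioo (0 : ℝ) 1) :
    ∃ U : WithLp 2 (L2 q × L2 q) ≃ₗᵢ[ℂ] H,
      (∀ (N : ℕ) (k l : ℤ), 0 ≤ k → k ≤ N → 0 ≤ l → l < N →
        U (WithLp.toLp 2 (e q N k l, 0)) = dVec N k (l + 1)) ∧
      (∀ (N : ℕ) (k : ℤ), 0 ≤ k → k ≤ N →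
        U (WithLp.toLp 2 (e q N k N, 0)) = uVec N k (N + 1)) ∧
      (∀ (N : ℕ) (k l : ℤ), 0 ≤ k → k ≤ N → 0 ≤ l → l ≤ N →
        U (WithLp.toLp 2 (0, e q N k l)) = uVec N k l) ∧
      pmapConj U (pmapSum (D₁ q) (absD₂ q)) = D ∧
      ∃ π' : Alg (q : ℝ) →⋆ₐ[ℂ] (H →L[ℂ] H), IsPiPrime q π' ∧
        ∀ a ∈ polyAlg (q : ℝ),
          opConj U (opSum (leftReg q a) (leftReg q a)) - π' a ∈ Kq q :=
  ⟨unitaryU q, fun _ _ _ _ _ hl hlN => unitaryU_inl q hl hlN, fun _ _ _ _ => unitaryU_inl_top q,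
    fun _ _ _ _ _ hl hlN => unitaryU_inr q hl hlN, pmapConj_eq_D q, piPrime q, isPiPrime_conjRep q,
    fun _ ha => conjRep_sub_mem q ha⟩
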